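/- **Setting.** Let $\delta>0$, $d_1=d_3=-\tfrac13$, $d_2=\tfrac{3}{2\delta^2}$, and $0<\eta\le 1$. Let $\chi_1,\dots,\chi_4$ be measurable $\{0,1\}$-valued functions of $(y_1,y_2)$ with $\chi_1+\chi_2+\chi_3+\chi_4=1$, and put $$\tilde\chi_1=1-2(\chi_2+\chi_3),\qquad \tilde\chi_2=1-2(\chi_3+\chi_4),\qquad \tilde\chi_3=1-2(\chi_2+\chi_4),\qquad M=\begin{pmatrix} d_1&\tilde\chi_3&\tilde\chi_2\\ \tilde\chi_3&d_2&\tilde\chi_1\\ \tilde\chi_2&\tilde\chi_1&d_3\end{pmatrix}.$$ Let $e=e(y_1,y_2)$ be a strain, $e=\tfrac12(\nabla u+(\nabla u)^t)$ with $u$ having values in $\mathbb R^3$, and write $B_\rho$ for the open ball of radius $\rho$ around $0$ in $\mathbb R^3$. $|\cdot|$ is the Euclidean (Frobenius) norm and $\int|\nabla\chi_i|$ the total variation. **(1)** There are universal constants $r>0$ and $C>0$ such that the following holds. Let $u\in W^{1,\infty}(B_1;\mathbb R^3)$ and suppose that $$E:=\eta^{1/3}\sum_{i=1}^4\int_{B_1}|\nabla\chi_i|\,dy+\eta^{-2/3}\int_{B_1}|e-M|^2\,dy\le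 1 .$$ Then there is a measurable $f:\mathbb R\to\{-1,1\}$ such that $$\int_{B_r}|\tilde\chi_3-f(y_1)|\,dy\le C E^{1/2}\qquad\text{or}\qquad \int_{B_r}|\tilde\chi_3-f(y_2)|\,dy\le C E^{1/2}.$$ **(2), (3) (periodic setting)** For every $K>0$ there is a constant $C>0$, depending only on $K$, such that the following holds. Let $\chi_i$ and $e$ be one-periodic in $y_1$ and $y_2$, $u\in W^{1,\infty}_{loc}(\mathbb R^3;\mathbb R^3)$, $\mathbb T^2=\mathbb R^2/\mathbb Z^2$, and suppose that $$E:=\eta^{1/3}\sum_{i=1}^4\int_{\mathbb T^2}|\nabla\chi_i|\,dy+\eta^{-2/3}\int_{\mathbb T^2}|e-M|^2\,dy\le 1 .$$ Let $f:\mathbb R\to\{-1,1\}$ be measurable and one-periodic, and suppose that the first case of (1) holds on the torus, i.e. $\int_{\mathbb T^2}|\tilde\chi_3-f(y_1)|\,dy\le K E^{1/2}$ (equivalently $\|\tilde\chi_3-f\|_{L^2(\mathbb T^2)}\le (2K)^{1/2}E^{1/4}$). Let $\theta_i=\int_{\mathbb T^2}\chi_i\,dy$, $F(s)=\int_0^s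 f$, $\Phi(s,t)=(s,t-F(s))$ and $Q=\Phi^{-1}([-\tfrac12,\tfrac12]^2)$. Then (2) $\displaystyle |\theta_1(\theta_2+\theta_4)-\theta_4(\theta_1+\theta_3)|\le C E^{1/4}$; (3) there is a measurable function $g=g(t)$ of one variable such that $$\|\tilde\chi_1\circ\Phi-g(t)\|_{L^2(Q)}^2\le C\,\eta^{-2/9}E^{5/6},\qquad \|\tilde\chi_2\circ\Phi-f(s)g(t)\|_{L^2(Q)}\le C\max\{\eta^{-1/9}E^{5/12},E^{1/4}\}.$$ **Symmetric cases.** Let $(a,b,c)$ be any permutation of $(1,2,3)$, and put $v(1)=4$, $v(2)=2$, $v(3)=3$. The same holds, with the same constants, if $\chi_i$ and $e$ depend on $(y_a,y_b)$ instead of $(y_1,y_2)$, when $\tilde\chi_1,\tilde\chi_2,\tilde\chi_3$ and $\theta_4,\theta_2,\theta_3$ are replaced in the conclusions and in the hypothesis on $f$ by $\tilde\chi_a,\tilde\chi_b,\tilde\chi_c$ and $\theta_{v(a)},\theta_{v(b)},\theta_{v(c)}$; the matrix $M$ and the definition of the $\tilde\chi_i$ remain unchanged. -/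

import Mathlib

open MeasureTheory Set
open scoped ENNReal ContDiff

namespace CrossingTwins

/-- Three-dimensional Euclidean space. -/
abbrev E3 : Type := EuclideanSpace ℝ (Fin 3)

/-! ### Phases

All indices are shifted by one: `χ 0, χ 1, χ 2, χ 3` are the four phases $\chi_1, \dots, \chi_4$,
and `modChar χ 0, modChar χ 1, modChar χ 2` are $\tilde\chi_1, \tilde\chi_2, \tilde\chi_3$.
All phases are functions of the two planar variables. -/

/-- Characteristic functions of the four martensitic phases, as functions of two variables. -/
structure IsPhase (χ : Fin 4 → ℝ × ℝ → ℝ) : Prop where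
  measurable : ∀ i, Measurable (χ i)
  zero_or_one : ∀ i p, χ i p = 0 ∨ χ i p = 1
  sum_eq_one : ∀ p, χ 0 p + χ 1 p + χ 2 p + χ 3 p = 1

/-- The modified characteristic functions. -/
def modChar (χ : Fin 4 → ℝ × ℝ → ℝ) : Fin 3 → ℝ × ℝ → ℝ :=
  ![fun p => 1 - 2 * (χ 1 p + χ 2 p),
    fun p => 1 - 2 * (χ 2 p + χ 3 p),
    fun p => 1 - 2 * (χ 1 p + χ 3 p)]

/-- The (rescaled) stress-free strain that belongs to the phases, with diagonal entries
$d_1 = -1/3$, $d_2 = 3/(2\delta^2)$, $d_3 = -1/3$. -/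
noncomputable def phaseStrain (δ : ℝ) (χ : Fin 4 → ℝ × ℝ → ℝ) (p : ℝ × ℝ) :
    Matrix (Fin 3) (Fin 3) ℝ :=
  !![-1 / 3, modChar χ 2 p, modChar χ 1 p;
     modChar χ 2 p, 3 / (2 * δ ^ 2), modChar χ 0 p;
     modChar χ 1 p, modChar χ 0 p, -1 / 3]

/-- The phase, other than the first one, on which the `k`-th modified characteristic function
is `1`: $\tilde\chi_1, \tilde\chi_2, \tilde\chi_3$ belong to the phases 4, 2, 3. -/
def partner : Fin 3 → Fin 4 := ![3, 1, 2]

/-! ### Strains of displacements -/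

/-- `G` is the weak gradient of `u` on the open set `U` (`G y i j` is the `j`-th derivative of the
`i`-th component), and `u` and `G` are essentially bounded on bounded parts of `U`.  For `U` a ball
this says that `u` is in $W^{1,\infty}(U)$, for `U` the whole space that it is in
$W^{1,\infty}_{loc}$. -/
structure HasBoundedWeakGradient (U : Set E3) (u : E3 → E3)
    (G : E3 → Matrix (Fin 3) (Fin 3) ℝ) : Prop where
  memLp : ∀ (R : ℝ) (i : Fin 3),
    MemLp (fun y => u y i) ∞ (volume.restrict (U ∩ Metric.ball 0 R))
  memLp_grad : ∀ (R : ℝ) (i j : Fin 3),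
    MemLp (fun y => G y i j) ∞ (volume.restrict (U ∩ Metric.ball 0 R))
  weak : ∀ ψ : E3 → ℝ, ContDiff ℝ ∞ ψ → HasCompactSupport ψ → tsupport ψ ⊆ U →
    ∀ i j : Fin 3,
      ∫ y in U, u y i * fderiv ℝ ψ y (EuclideanSpace.single j 1) = - ∫ y in U, G y i j * ψ y

/-- The two planar variables $(y_a, y_b)$ with `a = σ 0`, `b = σ 1`. -/
def planar (σ : Equiv.Perm (Fin 3)) (y : E3) : ℝ × ℝ := (y (σ 0), y (σ 1))

/-- `e`, read as the function $y \mapsto e(y_a, y_b)$, is the strain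
$\frac{1}{2}(\nabla u + (\nabla u)^t)$ of a displacement `u` on `U`. -/
def IsPlanarStrain (σ : Equiv.Perm (Fin 3)) (U : Set E3)
    (e : ℝ × ℝ → Matrix (Fin 3) (Fin 3) ℝ) : Prop :=
  (∀ i j, Measurable fun p => e p i j) ∧
  ∃ (u : E3 → E3) (G : E3 → Matrix (Fin 3) (Fin 3) ℝ), HasBoundedWeakGradient U u G ∧
    ∀ᵐ y ∂(volume.restrict U), ∀ i j, (G y i j + G y j i) / 2 = e (planar σ y) i j

/-- Squared (Frobenius) norm of a matrix. -/
def normSqMat (A : Matrix (Fin 3) (Fin 3) ℝ) : ℝ := ∑ i, ∑ j, (A i j) ^ 2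

/-! ### Energy on the unit ball -/

/-- Total variation $\int_U |\nabla h|$ of `h` on the open set `U`. -/
noncomputable def totalVar (U : Set E3) (h : E3 → ℝ) : ℝ≥0∞ :=
  ⨆ (φ : E3 → E3) (_ : ContDiff ℝ 1 φ ∧ HasCompactSupport φ ∧ tsupport φ ⊆ U ∧ ∀ y, ‖φ y‖ ≤ 1),
    ENNReal.ofReal (∫ y in U, h y * ∑ j, fderiv ℝ φ y (EuclideanSpace.single j 1) j)

/-- Surface energy on the unit ball of $\mathbb{R}^3$. -/
noncomputable def surfEnergy (σ : Equiv.Perm (Fin 3)) (χ : Fin 4 → ℝ × ℝ → ℝ) : ℝ≥0∞ :=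
  ∑ i, totalVar (Metric.ball 0 1) (fun y => χ i (planar σ y))

/-- Elastic energy on the unit ball of $\mathbb{R}^3$. -/
noncomputable def elastEnergy (σ : Equiv.Perm (Fin 3)) (δ : ℝ)
    (e : ℝ × ℝ → Matrix (Fin 3) (Fin 3) ℝ) (χ : Fin 4 → ℝ × ℝ → ℝ) : ℝ≥0∞ :=
  ∫⁻ y in Metric.ball (0 : E3) 1,
    ENNReal.ofReal (normSqMat (e (planar σ y) - phaseStrain δ χ (planar σ y)))

/-- Total energy $\eta^{1/3} E_{surf} + \eta^{-2/3} E_{elast}$ on the unit ball. -/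
noncomputable def energy (σ : Equiv.Perm (Fin 3)) (δ η : ℝ)
    (e : ℝ × ℝ → Matrix (Fin 3) (Fin 3) ℝ) (χ : Fin 4 → ℝ × ℝ → ℝ) : ℝ≥0∞ :=
  ENNReal.ofReal (η ^ (1 / 3 : ℝ)) * surfEnergy σ χ
    + ENNReal.ofReal (η ^ (-2 / 3 : ℝ)) * elastEnergy σ δ e χ

/-! ### Energy on the torus -/

/-- One-periodic in both planar variables. -/
def Periodic2 {α : Type} (h : ℝ × ℝ → α) : Prop :=
  ∀ s t, h (s + 1, t) = h (s, t) ∧ h (s, t + 1) = h (s, t)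

/-- The closed unit square, a fundamental domain of the torus $\mathbb{R}^2/\mathbb{Z}^2$. -/
def square : Set (ℝ × ℝ) := Icc (-1 / 2) (1 / 2) ×ˢ Icc (-1 / 2) (1 / 2)

/-- Total variation of a periodic function on the torus. -/
noncomputable def torusVar (h : ℝ × ℝ → ℝ) : ℝ≥0∞ :=
  ⨆ (φ : (ℝ × ℝ → ℝ) × (ℝ × ℝ → ℝ))
    (_ : (ContDiff ℝ 1 φ.1 ∧ Periodic2 φ.1) ∧ (ContDiff ℝ 1 φ.2 ∧ Periodic2 φ.2) ∧
      ∀ p, φ.1 p ^ 2 + φ.2 p ^ 2 ≤ 1),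
    ENNReal.ofReal (∫ p in square, h p * (fderiv ℝ φ.1 p (1, 0) + fderiv ℝ φ.2 p (0, 1)))

/-- Total energy $\eta^{1/3} E_{surf} + \eta^{-2/3} E_{elast}$ on the torus. -/
noncomputable def torusEnergy (δ η : ℝ)
    (e : ℝ × ℝ → Matrix (Fin 3) (Fin 3) ℝ) (χ : Fin 4 → ℝ × ℝ → ℝ) : ℝ≥0∞ :=
  ENNReal.ofReal (η ^ (1 / 3 : ℝ)) * ∑ i, torusVar (χ i)
    + ENNReal.ofReal (η ^ (-2 / 3 : ℝ)) *
      ∫⁻ p in square, ENNReal.ofReal (normSqMat (e p - phaseStrain δ χ p))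

/-- Volume fraction of the `i`-th phase on the torus. -/
noncomputable def volFrac (χ : Fin 4 → ℝ × ℝ → ℝ) (i : Fin 4) : ℝ := ∫ p in square, χ i p

/-- A measurable function of one variable with values in `{-1, 1}`. -/
def IsSign (f : ℝ → ℝ) : Prop := Measurable f ∧ ∀ s, f s = 1 ∨ f s = -1

/-- The shear $\Phi(s,t) = (s, t - F(s))$, where $F$ is the primitive of `f` with $F(0) = 0$. -/
noncomputable def shear (f : ℝ → ℝ) (p : ℝ × ℝ) : ℝ × ℝ :=
  (p.1, p.2 - ∫ x in (0 : ℝ)..p.1, f x)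

end CrossingTwins

open CrossingTwins

/-!
The energy penalizes two things: variation of the phases, with weight `η ^ (1/3)`, and the distance
of the strain `e` from the strain of the phases, with weight `η ^ (-2/3)`. The diagonal entries
preferred by the phases are constants, and the off-diagonal entry in the places `a, b` is the
modified characteristic function with the third index `c`. The three modified characteristic
functions take the values `1` and `-1`, and their product is one (`IsPhase.modChar_one_eq`), so
the one with index `b` is the product of the other two. Everything is done for a permutation
`σ = (a, b, c)` at once, in the planar coordinates `(y_a, y_b)`.

*The estimate on the ball* (`exists_isSign_ball`). Saint-Venant's condition
`∂_b ∂_b e_aa + ∂_a ∂_a e_bb = 2 ∂_a ∂_b e_ab` is tested with products of smooth steps of width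
`ε` in the two variables (`enorm_mixed_le`). The constant diagonal entries drop out, and it remains
that the mixed second differences of `w = χ̃_c`, averaged at scale `ε`, are bounded by the elastic
energy; on average, the squares of the bounds for the terms with two derivatives of the steps cost
`ε⁻²`. Replacing the averages by `w` itself costs the variation of `w` at scale `ε`. The choice
`ε = η ^ (1/3) / 8` bounds both by the energy `E`. Since `w` takes two values only, a mixed
difference is zero or at least two, so it vanishes outside a set of measure of order `E`
(`exists_isSign_of_compat`). If the mixed differences based at a point `q` vanish at `(x, y)`, then
`w` cannot change both from `q` to `(x, q.2)` and from `q` to `(q.1, y)`. So the set of those `x`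
for which the first changes or the set of those `y` for which the second does has measure of order
`E ^ (1/2)`, and `w` is close to a function of one variable
(`exists_isSign_of_mixed_difference`).

*The torus* (`torus_estimates`). Let `w = χ̃_c`, which is close to a function `f` of the first
variable, and `h = χ̃_a`. The remaining compatibility conditions say that the curl of
`(p, q) = (e_ac, e_bc)` in the plane has vanishing gradient (`IsPlanarStrain.exists_isCurlCompat`),
hence the field is curl-free by periodicity (`IsCurlCompat.mollify_curl`), and its mollifications
have potentials. Its entries are close in `L²` to `w h` and `h`. Along the curves `t = const` in the
coordinates of the shear, which have the direction `(1, -f)`, the derivative of the potential is the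
`drift` `p - f q`, which is small because `p ≈ w h ≈ f h ≈ f q`. So the integral of `q` over a
vertical segment of length `ε`, the `rise`, varies little along these curves
(`IsCurlCompat.rise_sub`).

- For `ε = 1`, the contributions of the drift at the two ends of the segment cancel by
  periodicity. Therefore the vertical means of `q` are constant and `q` is uncorrelated with
  functions of the first variable (`IsCurlCompat.integral_mul_fst`), which makes the covariance of
  `h` and `w` small (`IsCurlCompat.abs_covariance_le`). The expression in the volume fractions is
  a quarter of this covariance (`IsPhase.volFrac_eq_covariance`).
- For `ε` at most one, `rise / ε` differs from `h` in sheared coordinates by the elastic energy and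
  by the variation of `h` at scale `ε`, so `h` is close to its trace on a suitable line `s = const`
  (`exists_trace`). The translation error is of order `ε η ^ (-1/3) E`, the drift contributes
  `ε⁻² E ^ (1/2)`, and these balance, with value `η ^ (-2/9) E ^ (5/6)`, when
  `ε = η ^ (1/9) E ^ (-1/6)`. If this exceeds one, then averages over the full period are used
  instead, to which the drift does not contribute (`IsCurlCompat.exists_profile`). The estimate for
  `χ̃_b = w h` follows from those for `w` and `h` (`lintegral_mul_sub_mul_sq_le`).
-/

namespace CrossingTwins
open Filter Topology
open scoped Convolution
/-! ### Mollification and translations of functions of bounded variation -/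

/-- A sequence of smooth bumps on the plane whose supports shrink to the origin. -/
noncomputable def planeBump (n : ℕ) : ContDiffBump (0 : ℝ × ℝ) where
  rIn := 1 / (2 * (n + 1))
  rOut := 1 / (n + 1)
  rIn_pos := by positivity
  rIn_lt_rOut := by
    apply one_div_lt_one_div_of_lt <;> [positivity; nlinarith [(Nat.cast_nonneg n : (0:ℝ) ≤ n)]]

/-- Smooth approximations of a function on the plane, by convolution with normalized bumps. -/
noncomputable def mollify (n : ℕ) (k : ℝ × ℝ → ℝ) : ℝ × ℝ → ℝ :=
  (planeBump n).normed volume ⋆[ContinuousLinearMap.lsmul ℝ ℝ, volume] k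

theorem mollify_apply (n : ℕ) (k : ℝ × ℝ → ℝ) (x : ℝ × ℝ) :
    mollify n k x = ∫ t, (planeBump n).normed volume t * k (x - t) := rfl

theorem locallyIntegrable_of_bounded {k : ℝ × ℝ → ℝ} {C : ℝ} (hk : Measurable k)
    (hb : ∀ x, |k x| ≤ C) : LocallyIntegrable k volume :=
  (memLp_top_of_bound hk.aestronglyMeasurable C (Eventually.of_forall hb)).locallyIntegrable le_top

theorem contDiff_mollify {k : ℝ × ℝ → ℝ} {C : ℝ} (hk : Measurable k)
    (hb : ∀ x, |k x| ≤ C) (n : ℕ) : ContDiff ℝ ∞ (mollify n k) :=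
  (planeBump n).hasCompactSupport_normed.contDiff_convolution_left _
    (planeBump n).contDiff_normed (locallyIntegrable_of_bounded hk hb)

theorem abs_mollify_le {k : ℝ × ℝ → ℝ} {C : ℝ} (hb : ∀ x, |k x| ≤ C) (n : ℕ)
    (x : ℝ × ℝ) : |mollify n k x| ≤ C := by
  have h := norm_integral_le_of_norm_le (μ := volume)
    (f := fun t => (planeBump n).normed volume t * k (x - t))
    (g := fun t => (planeBump n).normed volume t * C)
    ((planeBump n).integrable_normed.mul_const C) (Eventually.of_forall fun t => by
      rw [norm_mul, Real.norm_of_nonneg ((planeBump n).nonneg_normed t)]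
      exact mul_le_mul_of_nonneg_left (hb _) ((planeBump n).nonneg_normed t))
  rw [integral_mul_const, ContDiffBump.integral_normed, one_mul] at h
  exact h

theorem tendsto_mollify {k : ℝ × ℝ → ℝ} {C : ℝ} (hk : Measurable k)
    (hb : ∀ x, |k x| ≤ C) :
    ∀ᵐ x, Tendsto (fun n => mollify n k x) atTop (𝓝 (k x)) := by
  refine ContDiffBump.ae_convolution_tendsto_right_of_locallyIntegrable (φ := planeBump)
    (l := atTop) (K := 2) ?_ ?_ (locallyIntegrable_of_bounded hk hb)
  · exact tendsto_one_div_add_atTop_nhds_zero_nat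
  · refine Eventually.of_forall fun n => ?_
    change 1 / ((n : ℝ) + 1) ≤ 2 * (1 / (2 * (n + 1)))
    have : (n : ℝ) + 1 ≠ 0 := by positivity
    apply le_of_eq; field_simp

theorem mollify_add_period {k : ℝ × ℝ → ℝ} {v : ℝ × ℝ} (hp : ∀ x, k (x + v) = k x) (n : ℕ)
    (x : ℝ × ℝ) : mollify n k (x + v) = mollify n k x := by
  rw [mollify_apply, mollify_apply]
  congr 1; ext t
  rw [add_sub_right_comm, hp]

theorem mollify_eq_zero {k : ℝ × ℝ → ℝ} {n : ℕ} {x : ℝ × ℝ}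
    (h : ∀ y, dist y x < 1 / (n + 1) → k y = 0) : mollify n k x = 0 := by
  rw [mollify_apply, integral_eq_zero_of_ae]
  refine Eventually.of_forall fun t => ?_
  by_cases ht : t ∈ Function.support ((planeBump n).normed volume)
  · rw [ContDiffBump.support_normed_eq] at ht
    have h2 : dist (x - t) x < 1 / (n + 1) := by
      rw [dist_eq_norm]; simpa [planeBump] using ht
    simp [h _ h2]
  · simp only [Function.mem_support, not_not] at ht
    simp [ht]

theorem measurableSet_square : MeasurableSet square := measurableSet_Icc.prod measurableSet_Icc

theorem isCompact_square : IsCompact square := isCompact_Icc.prod isCompact_Icc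

instance : IsFiniteMeasure (volume.restrict square) :=
  ⟨by rw [Measure.restrict_apply_univ]; exact isCompact_square.measure_lt_top⟩

/-- If every translate of `k` by at most `T` along `v` is a test function for the derivative of
`h` along `v`, which has total mass at most `V`, then pairing `h` with a difference of
`k` costs at most `T * V`. -/
theorem integral_mul_sub_translate_le {h k : ℝ × ℝ → ℝ} {C : ℝ} (hh : Measurable h)
    (hb : ∀ x, |h x| ≤ C) (hk : ContDiff ℝ 1 k) (v : ℝ × ℝ) {T V : ℝ} (hT : 0 ≤ T)
    (H : ∀ τ ∈ Icc 0 T, ∫ x in square, h x * fderiv ℝ (fun y => k (y - τ • v)) x v ≤ V) :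
    ∫ x in square, h x * (k x - k (x - T • v)) ≤ T * V := by
  have hcont : Continuous fun q : (ℝ × ℝ) × ℝ => fderiv ℝ k (q.1 - q.2 • v) v :=
    ((hk.continuous_fderiv one_ne_zero).comp (by fun_prop)).clm_apply continuous_const
  have key : ∀ x, ∫ σ in (0:ℝ)..T, fderiv ℝ k (x - σ • v) v = k x - k (x - T • v) := by
    intro x
    have h1 : ∀ σ ∈ uIcc 0 T, HasDerivAt (fun σ : ℝ => -k (x - σ • v))
        (fderiv ℝ k (x - σ • v) v) σ := by
      intro σ _
      have h2 : HasDerivAt (fun σ : ℝ => x - σ • v) (-v) σ := by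
        simpa using ((hasDerivAt_id σ).smul_const v).const_sub x
      have h3 := ((hk.differentiable one_ne_zero (x - σ • v)).hasFDerivAt).comp_hasDerivAt σ h2
      have h4 := h3.neg
      rw [map_neg, neg_neg] at h4
      exact h4
    rw [intervalIntegral.integral_eq_sub_of_hasDerivAt h1]
    · simp; ring
    · exact (hcont.comp (by fun_prop : Continuous fun σ : ℝ => (x, σ))).intervalIntegrable _ _
  obtain ⟨B, hB⟩ := (isCompact_square.prod (isCompact_Icc (a := (0:ℝ)) (b := T)))
    |>.exists_bound_of_continuousOn hcont.continuousOn
  have hint : Integrable (Function.uncurry fun x σ => h x * fderiv ℝ k (x - σ • v) v)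
      ((volume.restrict square).prod (volume.restrict (Ioc 0 T))) := by
    refine Integrable.of_bound (C := C * B) ?_ ?_
    · exact ((hh.comp measurable_fst).mul hcont.measurable).aestronglyMeasurable
    · rw [Measure.prod_restrict]
      refine (ae_restrict_mem (measurableSet_square.prod measurableSet_Ioc)).mono fun q hq => ?_
      simp only [Function.uncurry, norm_mul]
      exact mul_le_mul (hb _) (hB q ⟨hq.1, Ioc_subset_Icc_self hq.2⟩) (norm_nonneg _)
        ((abs_nonneg _).trans (hb 0))
  calc ∫ x in square, h x * (k x - k (x - T • v))
      = ∫ x in square, ∫ σ in Ioc 0 T, h x * fderiv ℝ k (x - σ • v) v := by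
        congr 1; ext x
        rw [← key, intervalIntegral.integral_of_le hT, integral_const_mul]
    _ = ∫ σ in Ioc 0 T, ∫ x in square, h x * fderiv ℝ k (x - σ • v) v :=
        integral_integral_swap hint
    _ ≤ ∫ σ in Ioc 0 T, V := by
        refine setIntegral_mono_on ?_ (by simp) measurableSet_Ioc fun σ hσ => ?_
        · exact hint.swap.integral_prod_left
        · refine le_trans (le_of_eq ?_) (H σ (Ioc_subset_Icc_self hσ))
          congr 1; ext x
          rw [fderiv_comp_sub]
    _ = T * V := by simp [hT]

/-! ### Periodic functions and functions on a square -/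

/-- Lebesgue measure on `[-1/2, 1/2]`, one period of the circle. -/
noncomputable def periodMeasure : Measure ℝ := volume.restrict (Icc (-1 / 2) (1 / 2))

instance : IsProbabilityMeasure periodMeasure :=
  ⟨by rw [periodMeasure, Measure.restrict_apply_univ, Real.volume_Icc]; norm_num⟩

theorem volume_restrict_square :
    (volume.restrict square : Measure (ℝ × ℝ)) = periodMeasure.prod periodMeasure := by
  rw [periodMeasure, Measure.prod_restrict]; rfl

instance : IsProbabilityMeasure (volume.restrict square) :=
  volume_restrict_square ▸ inferInstance

theorem periodMeasure_eq_Ioc (a : ℝ) (ha : a = -1 / 2) :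
    periodMeasure = volume.restrict (Ioc a (a + 1)) := by
  rw [periodMeasure, restrict_Ioc_eq_restrict_Icc, ha]; norm_num

theorem lintegral_periodMeasure_add {g : ℝ → ℝ≥0∞} (hg : Function.Periodic g 1) (τ : ℝ) :
    ∫⁻ t, g (t + τ) ∂periodMeasure = ∫⁻ t, g t ∂periodMeasure := by
  rw [periodMeasure_eq_Ioc _ rfl]
  have h1 := (measurePreserving_add_right volume τ).setLIntegral_comp_preimage_emb
    (MeasurableEquiv.addRight τ).measurableEmbedding g (Ioc (-1 / 2 + τ) (-1 / 2 + 1 + τ))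
  have h2 : (fun x => x + τ) ⁻¹' Ioc (-1 / 2 + τ) (-1 / 2 + 1 + τ) = Ioc (-1 / 2) (-1 / 2 + 1) := by
    simp
  rw [h2] at h1
  rw [h1, show (-1 / 2 + 1 + τ : ℝ) = (-1 / 2 + τ) + 1 by ring]
  refine IsAddFundamentalDomain.setLIntegral_eq (G := AddSubgroup.zmultiples (1:ℝ))
    (isAddFundamentalDomain_Ioc zero_lt_one (-1 / 2 + τ))
    (isAddFundamentalDomain_Ioc zero_lt_one (-1 / 2)) g ?_
  rintro ⟨_, n, rfl⟩ x
  change g ((n • (1:ℝ)) + x) = g x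
  rw [add_comm]
  exact hg.zsmul n x

theorem integral_periodMeasure_add {g : ℝ → ℝ} (hg : Function.Periodic g 1) (τ : ℝ) :
    ∫ t, g (t + τ) ∂periodMeasure = ∫ t, g t ∂periodMeasure := by
  rw [periodMeasure_eq_Ioc _ rfl, ← intervalIntegral.integral_of_le (by norm_num),
    ← intervalIntegral.integral_of_le (by norm_num),
    intervalIntegral.integral_comp_add_right (fun t => g t),
    show (-1 / 2 + 1 + τ : ℝ) = (-1 / 2 + τ) + 1 by ring]
  exact hg.intervalIntegral_add_eq _ _

theorem Periodic2.fst {α : Type} {h : ℝ × ℝ → α} (hp : Periodic2 h) (t : ℝ) :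
    Function.Periodic (fun s => h (s, t)) 1 := fun s => (hp s t).1

theorem Periodic2.snd {α : Type} {h : ℝ × ℝ → α} (hp : Periodic2 h) (s : ℝ) :
    Function.Periodic (fun t => h (s, t)) 1 := fun t => (hp s t).2

theorem Periodic2.add_one_fst {α : Type} {h : ℝ × ℝ → α} (hp : Periodic2 h) (x : ℝ × ℝ) :
    h (x + (1, 0)) = h x := by
  obtain ⟨s, t⟩ := x; simpa using (hp s t).1

theorem Periodic2.add_one_snd {α : Type} {h : ℝ × ℝ → α} (hp : Periodic2 h) (x : ℝ × ℝ) :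
    h (x + (0, 1)) = h x := by
  obtain ⟨s, t⟩ := x; simpa using (hp s t).2

theorem Periodic2.comp_add {α : Type} {h : ℝ × ℝ → α} (hp : Periodic2 h) (v : ℝ × ℝ) :
    Periodic2 fun x => h (x + v) := by
  refine fun s t => ⟨?_, ?_⟩
  · change h _ = h _
    rw [← hp.add_one_fst ((s, t) + v)]; congr 1; ext <;> simp; ring
  · change h _ = h _
    rw [← hp.add_one_snd ((s, t) + v)]; congr 1; ext <;> simp; ring

theorem Periodic2.mollify {k : ℝ × ℝ → ℝ} (hp : Periodic2 k) (n : ℕ) :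
    Periodic2 (mollify n k) := by
  refine fun s t => ⟨?_, ?_⟩
  · simpa using mollify_add_period hp.add_one_fst n (s, t)
  · simpa using mollify_add_period hp.add_one_snd n (s, t)

theorem integral_square_add {g : ℝ × ℝ → ℝ} {C : ℝ} (hg : Measurable g) (hb : ∀ x, |g x| ≤ C)
    (hp : Periodic2 g) (v : ℝ × ℝ) : ∫ x in square, g (x + v) = ∫ x in square, g x := by
  have hi : ∀ v, Integrable (fun x => g (x + v)) (periodMeasure.prod periodMeasure) := fun v =>
    Integrable.of_bound (C := C) (hg.comp (measurable_id.add_const v)).aestronglyMeasurable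
      (Eventually.of_forall fun x => hb _)
  have hi0 : Integrable g (periodMeasure.prod periodMeasure) := by simpa using hi 0
  rw [volume_restrict_square, integral_prod _ (hi v), integral_prod _ hi0]
  calc ∫ s, ∫ t, g ((s, t) + v) ∂periodMeasure ∂periodMeasure
      = ∫ s, ∫ t, g (s + v.1, t) ∂periodMeasure ∂periodMeasure := by
        congr 1; ext s
        exact integral_periodMeasure_add (g := fun t => g (s + v.1, t)) (hp.snd _) v.2
    _ = ∫ s, ∫ t, g (s, t) ∂periodMeasure ∂periodMeasure := by
        refine integral_periodMeasure_add (g := fun s => ∫ t, g (s, t) ∂periodMeasure) ?_ v.1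
        intro s; exact integral_congr_ae (Eventually.of_forall fun t => (hp s t).1)

theorem lintegral_square_shear {g : ℝ × ℝ → ℝ≥0∞} (hg : Measurable g) {F : ℝ → ℝ}
    (hF : Measurable F) (hp : ∀ s, Function.Periodic (fun t => g (s, t)) 1) :
    ∫⁻ x in square, g (x.1, x.2 + F x.1) = ∫⁻ x in square, g x := by
  rw [volume_restrict_square, lintegral_prod _ (by fun_prop), lintegral_prod _ (by fun_prop)]
  congr 1; ext s
  exact lintegral_periodMeasure_add (hp s) (F s)

/-- The sign of a real number, with value `1` at zero. -/
noncomputable def signOne (x : ℝ) : ℝ := if 0 ≤ x then 1 else -1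

theorem measurable_signOne : Measurable signOne :=
  Measurable.ite measurableSet_Ici measurable_const measurable_const

theorem mul_signOne (x : ℝ) : x * signOne x = |x| := by
  unfold signOne; split_ifs with h
  · rw [mul_one, abs_of_nonneg h]
  · rw [abs_of_neg (not_le.1 h)]; ring

theorem abs_signOne (x : ℝ) : |signOne x| = 1 := by unfold signOne; split_ifs <;> simp

/-- Passage to the limit in a duality estimate along the mollifications of a test function. -/
theorem integral_mul_sub_le_of_mollify {h k : ℝ × ℝ → ℝ} {C c : ℝ} (hh : Measurable h)
    (hb : ∀ x, |h x| ≤ C) (hk : Measurable k) (hkb : ∀ x, |k x| ≤ 1) (w : ℝ × ℝ)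
    (H : ∀ᶠ n in atTop, ∫ x in square, h x * (mollify n k x - mollify n k (x - w)) ≤ c) :
    ∫ x in square, h x * (k x - k (x - w)) ≤ c := by
  refine le_of_tendsto (tendsto_integral_of_dominated_convergence (fun _ => C * 2) ?_ ?_ ?_ ?_) H
  · intro n
    have := (contDiff_mollify hk hkb n).continuous.measurable
    exact (by fun_prop : Measurable fun x => h x * (mollify n k x - mollify n k (x - w)))
      |>.aestronglyMeasurable
  · exact integrable_const _
  · refine fun n => Eventually.of_forall fun x => ?_
    rw [norm_mul]
    refine mul_le_mul (hb x) ?_ (norm_nonneg _) ((abs_nonneg _).trans (hb 0))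
    refine (norm_sub_le _ _).trans ?_
    have h1 := abs_mollify_le hkb n x
    have h2 := abs_mollify_le hkb n (x - w)
    simp only [Real.norm_eq_abs]; linarith
  · have h1 := tendsto_mollify hk hkb
    have h2 := (measurePreserving_sub_right volume w).quasiMeasurePreserving.ae h1
    filter_upwards [ae_restrict_of_ae h1, ae_restrict_of_ae h2] with x h1 h2
    exact (h1.sub h2).const_mul _

/-- Translation estimate for functions of bounded variation, away from the boundary of the
square. -/
theorem setIntegral_abs_sub_translate_le {h : ℝ × ℝ → ℝ} (hh : Measurable h)
    (hb : ∀ x, |h x| ≤ 1) (v : ℝ × ℝ) {T V d : ℝ} (hT : 0 ≤ T) (hd : 0 < d)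
    {K : Set (ℝ × ℝ)} (hK : MeasurableSet K)
    (hKd : ∀ x ∈ K, ∀ τ ∈ Icc 0 T, ∀ y, dist y (x + τ • v) ≤ d → y ∈ square)
    (H : ∀ φ : ℝ × ℝ → ℝ, ContDiff ℝ 1 φ → (∀ p, p ∉ square → φ p = 0) → (∀ p, |φ p| ≤ 1) →
      ∫ x in square, h x * fderiv ℝ φ x v ≤ V) :
    ∫ x in K, |h x - h (x + T • v)| ≤ T * V := by
  set k : ℝ × ℝ → ℝ := K.indicator fun x => signOne (h x - h (x + T • v)) with hk_def
  have hk : Measurable k :=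
    (measurable_signOne.comp (hh.sub (hh.comp (measurable_id.add_const _)))).indicator hK
  have hkb : ∀ x, |k x| ≤ 1 := by
    intro x
    by_cases hx : x ∈ K
    · rw [hk_def, indicator_of_mem hx, abs_signOne]
    · rw [hk_def, indicator_of_notMem hx]; simp
  have hKs : ∀ x ∈ K, ∀ τ ∈ Icc 0 T, x + τ • v ∈ square := fun x hx τ hτ =>
    hKd x hx τ hτ _ (by simpa using hd.le)
  have main : ∫ x in square, h x * (k x - k (x - T • v)) ≤ T * V := by
    refine integral_mul_sub_le_of_mollify hh hb hk hkb _ ?_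
    filter_upwards [(tendsto_one_div_add_atTop_nhds_zero_nat (𝕜 := ℝ)).eventually_lt_const hd]
      with n hn
    have hsm := (contDiff_mollify hk hkb n).of_le (m := 1) (by simp)
    refine integral_mul_sub_translate_le hh hb hsm v hT fun τ hτ => ?_
    refine H _ (hsm.comp (by fun_prop)) ?_ (fun p => abs_mollify_le hkb n _)
    refine fun p hp => mollify_eq_zero fun y hy => ?_
    rw [hk_def, indicator_of_notMem]
    refine fun hyK => hp (hKd y hyK τ hτ p ?_)
    have : dist p (y + τ • v) = dist y (p - τ • v) := by
      rw [dist_comm, dist_eq_norm, dist_eq_norm]; congr 1; abel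
    rw [this]; exact (hy.trans hn).le
  have hsub : K ⊆ square := fun x hx => by simpa using hKs x hx 0 ⟨le_rfl, hT⟩
  have hbi : ∀ (g : ℝ × ℝ → ℝ), Measurable g → (∀ x, |g x| ≤ 1) → (∀ x ∉ square, g x = 0) →
      Integrable g := by
    intro g hg hgb hg0
    rw [← integrableOn_iff_integrable_of_support_subset (s := square)]
    · exact Integrable.of_bound (C := 1) hg.aestronglyMeasurable (Eventually.of_forall hgb)
    · exact fun x hx => by_contra fun h' => hx (hg0 x h')
  have hmul : ∀ a b : ℝ, |a| ≤ 1 → |b| ≤ 1 → |a * b| ≤ 1 := fun a b ha hb => by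
    rw [abs_mul]; exact mul_le_one₀ ha (abs_nonneg _) hb
  have hk0 : ∀ x ∉ square, k x = 0 := fun x hx => indicator_of_notMem (fun hxK => hx (hsub hxK)) _
  have hk1 : ∀ x ∉ square, k (x - T • v) = 0 := fun x hx =>
    indicator_of_notMem (fun hxK => hx (by simpa using hKs _ hxK T ⟨hT, le_rfl⟩)) _
  have e1 : ∫ x in square, h x * (k x - k (x - T • v)) = ∫ x, h x * (k x - k (x - T • v)) :=
    setIntegral_eq_integral_of_forall_compl_eq_zero fun x hx => by rw [hk0 x hx, hk1 x hx]; simp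
  have i1 : Integrable fun x => h x * k x := hbi _ (hh.mul hk) (fun x => hmul _ _ (hb x) (hkb x))
    fun x hx => by rw [hk0 x hx, mul_zero]
  have i2 : Integrable fun x => h x * k (x - T • v) :=
    hbi _ (hh.mul (hk.comp (measurable_id.sub_const _))) (fun x => hmul _ _ (hb x) (hkb _))
    fun x hx => by rw [hk1 x hx, mul_zero]
  have i3 : Integrable fun x => h (x + T • v) * k x :=
    hbi _ ((hh.comp (measurable_id.add_const _)).mul hk) (fun x => hmul _ _ (hb _) (hkb _))
    fun x hx => by rw [hk0 x hx, mul_zero]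
  have e2 : ∫ x, h x * k (x - T • v) = ∫ x, h (x + T • v) * k x := by
    rw [← integral_add_right_eq_self (fun x => h x * k (x - T • v)) (T • v)]; simp
  have e3 : ∫ x in K, |h x - h (x + T • v)| = ∫ x, (h x - h (x + T • v)) * k x := by
    rw [← integral_indicator hK]
    congr 1; ext x
    by_cases hx : x ∈ K
    · simp only [hk_def, indicator_of_mem hx, mul_signOne]
    · simp only [hk_def, indicator_of_notMem hx, mul_zero]
  rw [e3]
  refine le_trans (le_of_eq ?_) main
  rw [e1]
  simp only [mul_sub, sub_mul]
  rw [integral_sub i1 i2, integral_sub i1 i3, e2]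

/-- Translation estimate for functions of bounded variation on the torus. -/
theorem Periodic2.integral_abs_sub_translate_le {h : ℝ × ℝ → ℝ} (hh : Measurable h)
    (hb : ∀ x, |h x| ≤ 1) (hp : Periodic2 h) (v : ℝ × ℝ) {T V : ℝ} (hT : 0 ≤ T)
    (H : ∀ φ : ℝ × ℝ → ℝ, ContDiff ℝ 1 φ → Periodic2 φ → (∀ p, |φ p| ≤ 1) →
      ∫ x in square, h x * fderiv ℝ φ x v ≤ V) :
    ∫ x in square, |h x - h (x + T • v)| ≤ T * V := by
  set k : ℝ × ℝ → ℝ := fun x => signOne (h x - h (x + T • v)) with hk_def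
  have hk : Measurable k :=
    measurable_signOne.comp (hh.sub (hh.comp (measurable_id.add_const _)))
  have hkb : ∀ x, |k x| ≤ 1 := fun x => (abs_signOne _).le
  have hkp : Periodic2 k := fun s t => by
    have h1 := hp.comp_add (T • v) s t
    exact ⟨by simp only [hk_def, h1.1, (hp s t).1], by simp only [hk_def, h1.2, (hp s t).2]⟩
  have main : ∫ x in square, h x * (k x - k (x - T • v)) ≤ T * V := by
    refine integral_mul_sub_le_of_mollify hh hb hk hkb _ (Eventually.of_forall fun n => ?_)
    have hsm := (contDiff_mollify hk hkb n).of_le (m := 1) (by simp)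
    refine integral_mul_sub_translate_le hh hb hsm v hT fun τ hτ => ?_
    refine H _ (hsm.comp (by fun_prop)) ?_ (fun p => abs_mollify_le hkb n _)
    simpa only [sub_eq_add_neg] using (hkp.mollify n).comp_add (-(τ • v))
  have hmul : ∀ a b : ℝ, |a| ≤ 1 → |b| ≤ 1 → |a * b| ≤ 1 := fun a b ha hb => by
    rw [abs_mul]; exact mul_le_one₀ ha (abs_nonneg _) hb
  have hbi : ∀ (g : ℝ × ℝ → ℝ), Measurable g → (∀ x, |g x| ≤ 1) →
      Integrable g (volume.restrict square) := fun g hg hgb =>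
    Integrable.of_bound (C := 1) hg.aestronglyMeasurable (Eventually.of_forall hgb)
  have m1 : Measurable fun x => h x * k (x - T • v) := hh.mul (hk.comp (measurable_id.sub_const _))
  have i1 := hbi (fun x => h x * k x) (hh.mul hk) (fun x => hmul _ _ (hb x) (hkb x))
  have i2 := hbi _ m1 (fun x => hmul _ _ (hb x) (hkb _))
  have i3 := hbi (fun x => h (x + T • v) * k x)
    ((hh.comp (measurable_id.add_const _)).mul hk) (fun x => hmul _ _ (hb _) (hkb _))
  have e2 : ∫ x in square, h x * k (x - T • v) = ∫ x in square, h (x + T • v) * k x := by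
    rw [← integral_square_add m1 (fun x => hmul _ _ (hb x) (hkb _)) ?_ (T • v)]
    · simp
    · have h1 := hkp.comp_add (-(T • v))
      simp only [← sub_eq_add_neg] at h1
      exact fun s t => ⟨by simp only [(h1 s t).1, (hp s t).1],
        by simp only [(h1 s t).2, (hp s t).2]⟩
  refine le_trans (le_of_eq ?_) main
  simp only [← mul_signOne]
  have e4 : ∫ x in square, (h x - h (x + T • v)) * k x
      = (∫ x in square, h x * k x) - ∫ x in square, h (x + T • v) * k x := by
    rw [← integral_sub i1 i3]; simp only [sub_mul]
  have e5 : ∫ x in square, h x * (k x - k (x - T • v))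
      = (∫ x in square, h x * k x) - ∫ x in square, h x * k (x - T • v) := by
    rw [← integral_sub i1 i2]; simp only [mul_sub]
  rw [e5, e2, ← e4]

/-! ### Compatibility conditions for planar strains -/

/-- The coordinates `((y_a, y_b), y_c)` on three-dimensional space, for `(a, b, c) = σ`. -/
noncomputable def coords (σ : Equiv.Perm (Fin 3)) : E3 ≃ᵐ (ℝ × ℝ) × ℝ where
  toFun y := (planar σ y, y (σ 2))
  invFun q := WithLp.toLp 2 fun i => ![q.1.1, q.1.2, q.2] (σ.symm i)
  left_inv y := by
    ext i
    obtain ⟨j, rfl⟩ := σ.surjective i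
    fin_cases j <;> simp [planar]
  right_inv q := by simp [planar]
  measurable_toFun := by
    unfold planar
    exact Measurable.prodMk (by fun_prop) (by fun_prop)
  measurable_invFun := by
    refine (WithLp.measurable_toLp 2 _).comp (measurable_pi_lambda _ fun i => ?_)
    obtain ⟨j, rfl⟩ := σ.surjective i
    fin_cases j <;> simp <;> fun_prop

theorem coords_apply (σ : Equiv.Perm (Fin 3)) (y : E3) : coords σ y = (planar σ y, y (σ 2)) := rfl

theorem continuous_coords_symm (σ : Equiv.Perm (Fin 3)) : Continuous (coords σ).symm := by
  change Continuous fun q : (ℝ × ℝ) × ℝ =>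
    (WithLp.toLp 2 fun i => ![q.1.1, q.1.2, q.2] (σ.symm i) : E3)
  refine (PiLp.continuous_toLp 2 _).comp (continuous_pi fun i => ?_)
  obtain ⟨j, rfl⟩ := σ.surjective i
  fin_cases j <;> simp <;> fun_prop

theorem measurePreserving_coords (σ : Equiv.Perm (Fin 3)) :
    MeasurePreserving (coords σ) volume volume := by
  have h1 := PiLp.volume_preserving_ofLp (Fin 3)
  have h2 := volume_measurePreserving_piCongrLeft (fun _ : Fin 3 => ℝ) σ.symm
  have h3 := volume_preserving_piFinSuccAbove (fun _ : Fin 3 => ℝ) (Fin.last 2)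
  have h4 := (MeasurePreserving.id (volume : Measure ℝ)).prod
    (volume_preserving_piFinTwo fun _ => ℝ)
  have h5 := Measure.measurePreserving_swap (μ := (volume : Measure ℝ))
    (ν := (volume : Measure (ℝ × ℝ)))
  have h := h5.comp (h4.comp (h3.comp (h2.comp h1)))
  have e : ⇑(coords σ) = Prod.swap ∘ Prod.map id (MeasurableEquiv.piFinTwo fun _ => ℝ) ∘
      (MeasurableEquiv.piFinSuccAbove (fun _ : Fin 3 => ℝ) (Fin.last 2)) ∘
      (MeasurableEquiv.piCongrLeft (fun _ : Fin 3 => ℝ) σ.symm) ∘ WithLp.ofLp := by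
    ext y <;>
      simp [coords_apply, planar, MeasurableEquiv.piCongrLeft, Equiv.piCongrLeft,
        Equiv.piCongrLeft', Fin.removeNth]
    all_goals rfl
  rw [e]
  exact h

theorem planar_single (σ : Equiv.Perm (Fin 3)) :
    planar σ (EuclideanSpace.single (σ 0) (1:ℝ)) = (1, 0) ∧
    planar σ (EuclideanSpace.single (σ 1) (1:ℝ)) = (0, 1) ∧
    planar σ (EuclideanSpace.single (σ 2) (1:ℝ)) = (0, 0) := by
  simp [planar]

/-- The partial derivative of a function on three-dimensional space. -/
noncomputable def pd (j : Fin 3) (Ψ : E3 → ℝ) (y : E3) : ℝ :=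
  fderiv ℝ Ψ y (EuclideanSpace.single j 1)

/-- The partial derivative of a function on the plane in the first variable. -/
noncomputable def pdOne (ψ : ℝ × ℝ → ℝ) (p : ℝ × ℝ) : ℝ := fderiv ℝ ψ p (1, 0)

/-- The partial derivative of a function on the plane in the second variable. -/
noncomputable def pdTwo (ψ : ℝ × ℝ → ℝ) (p : ℝ × ℝ) : ℝ := fderiv ℝ ψ p (0, 1)

/-- The product of a function of the planar variables and a function of the third variable. -/
noncomputable def tensor (σ : Equiv.Perm (Fin 3)) (ψ : ℝ × ℝ → ℝ) (γ : ℝ → ℝ) (y : E3) : ℝ :=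
  ψ (planar σ y) * γ (y (σ 2))

/-- The projection to the planar variables as a continuous linear map. -/
noncomputable def planarL (σ : Equiv.Perm (Fin 3)) : E3 →L[ℝ] ℝ × ℝ :=
  (EuclideanSpace.proj (σ 0)).prod (EuclideanSpace.proj (σ 1))

theorem planarL_apply (σ : Equiv.Perm (Fin 3)) (y : E3) : planarL σ y = planar σ y := rfl

theorem contDiff_tensor {σ : Equiv.Perm (Fin 3)} {ψ : ℝ × ℝ → ℝ} {γ : ℝ → ℝ} {n : ℕ∞}
    (hψ : ContDiff ℝ n ψ) (hγ : ContDiff ℝ n γ) : ContDiff ℝ n (tensor σ ψ γ) :=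
  (hψ.comp (planarL σ).contDiff).mul
    (hγ.comp (EuclideanSpace.proj (𝕜 := ℝ) (σ 2) : E3 →L[ℝ] ℝ).contDiff)

theorem fderiv_tensor {σ : Equiv.Perm (Fin 3)} {ψ : ℝ × ℝ → ℝ} {γ : ℝ → ℝ}
    (hψ : Differentiable ℝ ψ) (hγ : Differentiable ℝ γ) (y v : E3) :
    fderiv ℝ (tensor σ ψ γ) y v = fderiv ℝ ψ (planar σ y) (planar σ v) * γ (y (σ 2))
      + ψ (planar σ y) * (deriv γ (y (σ 2)) * v (σ 2)) := by
  have h1 : HasFDerivAt (fun y => ψ (planarL σ y)) _ y :=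
    (hψ (planarL σ y)).hasFDerivAt.comp y (planarL σ).hasFDerivAt
  have h2 : HasFDerivAt (fun y : E3 => γ (y (σ 2))) _ y :=
    (hγ (y (σ 2))).hasDerivAt.hasFDerivAt.comp y
      (EuclideanSpace.proj (𝕜 := ℝ) (σ 2) : E3 →L[ℝ] ℝ).hasFDerivAt
  have h3 := (h1.mul h2).fderiv
  change fderiv ℝ (tensor σ ψ γ) y = _ at h3
  rw [h3]
  simp [planarL_apply]
  ring

theorem pd_tensor_zero {σ : Equiv.Perm (Fin 3)} {ψ : ℝ × ℝ → ℝ} {γ : ℝ → ℝ}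
    (hψ : Differentiable ℝ ψ) (hγ : Differentiable ℝ γ) :
    pd (σ 0) (tensor σ ψ γ) = tensor σ (pdOne ψ) γ := by
  ext y
  rw [pd, fderiv_tensor hψ hγ, (planar_single σ).1]
  simp [tensor, pdOne]

theorem pd_tensor_one {σ : Equiv.Perm (Fin 3)} {ψ : ℝ × ℝ → ℝ} {γ : ℝ → ℝ}
    (hψ : Differentiable ℝ ψ) (hγ : Differentiable ℝ γ) :
    pd (σ 1) (tensor σ ψ γ) = tensor σ (pdTwo ψ) γ := by
  ext y
  rw [pd, fderiv_tensor hψ hγ, (planar_single σ).2.1]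
  simp [tensor, pdTwo]

theorem pd_tensor_two {σ : Equiv.Perm (Fin 3)} {ψ : ℝ × ℝ → ℝ} {γ : ℝ → ℝ}
    (hψ : Differentiable ℝ ψ) (hγ : Differentiable ℝ γ) :
    pd (σ 2) (tensor σ ψ γ) = tensor σ ψ (deriv γ) := by
  ext y
  rw [pd, fderiv_tensor hψ hγ, (planar_single σ).2.2]
  have : ((0:ℝ), (0:ℝ)) = 0 := rfl
  simp [tensor, this]

theorem hasCompactSupport_tensor (σ : Equiv.Perm (Fin 3)) {ψ : ℝ × ℝ → ℝ} {γ : ℝ → ℝ}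
    (hψ : HasCompactSupport ψ) (hγ : HasCompactSupport γ) : HasCompactSupport (tensor σ ψ γ) := by
  refine HasCompactSupport.intro ((hψ.prod hγ).image (continuous_coords_symm σ)) fun y hy => ?_
  by_contra h
  have h' : ψ (planar σ y) ≠ 0 ∧ γ (y (σ 2)) ≠ 0 := mul_ne_zero_iff.1 h
  exact hy ⟨coords σ y, ⟨subset_tsupport _ h'.1, subset_tsupport _ h'.2⟩,
    (coords σ).symm_apply_apply y⟩

theorem tsupport_tensor_subset (σ : Equiv.Perm (Fin 3)) {ψ : ℝ × ℝ → ℝ} {γ : ℝ → ℝ}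
    (hψ : ∀ p ∉ square, ψ p = 0) (hγ : ∀ z ∉ Icc (-1 / 2 : ℝ) (1 / 2), γ z = 0) :
    tsupport (tensor σ ψ γ) ⊆ Metric.ball 0 1 := by
  have h1 : tsupport (tensor σ ψ γ) ⊆ (coords σ).symm '' (square ×ˢ Icc (-1 / 2 : ℝ) (1 / 2)) := by
    refine closure_minimal ?_ ?_
    · intro y hy
      have h' : ψ (planar σ y) ≠ 0 ∧ γ (y (σ 2)) ≠ 0 := mul_ne_zero_iff.1 hy
      exact ⟨coords σ y, ⟨not_imp_comm.1 (hψ _) h'.1, not_imp_comm.1 (hγ _) h'.2⟩,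
        (coords σ).symm_apply_apply y⟩
    · exact ((isCompact_square.prod isCompact_Icc).image (continuous_coords_symm σ)).isClosed
  refine h1.trans ?_
  rintro _ ⟨q, ⟨⟨⟨h1, h2⟩, h3, h4⟩, h5, h6⟩, rfl⟩
  rw [mem_ball_zero_iff, EuclideanSpace.norm_eq, Real.sqrt_lt' one_pos, ← Equiv.sum_comp σ]
  simp only [Fin.sum_univ_three]
  have e0 : (coords σ).symm q (σ 0) = q.1.1 := by simp [coords]
  have e1 : (coords σ).symm q (σ 1) = q.1.2 := by simp [coords]
  have e2 : (coords σ).symm q (σ 2) = q.2 := by simp [coords]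
  rw [e0, e1, e2]
  simp only [Real.norm_eq_abs, sq_abs]
  nlinarith

theorem integral_planar_mul (σ : Equiv.Perm (Fin 3)) (g ψ : ℝ × ℝ → ℝ) (γ : ℝ → ℝ) :
    ∫ y : E3, g (planar σ y) * tensor σ ψ γ y = (∫ p, g p * ψ p) * ∫ z, γ z := by
  rw [← integral_prod_mul, ← Measure.volume_eq_prod,
    ← (measurePreserving_coords σ).integral_comp (coords σ).measurableEmbedding]
  simp only [coords_apply, tensor, mul_assoc]

theorem lintegral_planar_mul (σ : Equiv.Perm (Fin 3)) {g : ℝ × ℝ → ℝ≥0∞} {γ : ℝ → ℝ≥0∞}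
    (hg : Measurable g) (hγ : Measurable γ) :
    ∫⁻ y : E3, g (planar σ y) * γ (y (σ 2)) = (∫⁻ p, g p) * ∫⁻ z, γ z := by
  rw [← lintegral_prod_mul hg.aemeasurable hγ.aemeasurable, ← Measure.volume_eq_prod,
    ← (measurePreserving_coords σ).lintegral_comp_emb (coords σ).measurableEmbedding]
  simp only [coords_apply]

/-- Smooth test functions with compact support in `U`. -/
structure IsTest (U : Set E3) (Ψ : E3 → ℝ) : Prop where
  contDiff : ContDiff ℝ ∞ Ψ
  compact : HasCompactSupport Ψ
  subset : tsupport Ψ ⊆ U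

theorem IsTest.pd {U : Set E3} {Ψ : E3 → ℝ} (h : IsTest U Ψ) (j : Fin 3) : IsTest U (pd j Ψ) where
  contDiff := (h.contDiff.fderiv_right (m := ∞) (by simp)).clm_apply contDiff_const
  compact := by
    refine (h.compact.fderiv (𝕜 := ℝ)).comp_left
      (g := fun L : E3 →L[ℝ] ℝ => L (EuclideanSpace.single j 1)) (by simp)
  subset := by
    refine subset_trans ?_ h.subset
    refine subset_trans ?_ (tsupport_fderiv_subset ℝ (f := Ψ))
    refine closure_mono fun y hy => ?_
    simp only [Function.mem_support] at hy ⊢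
    intro h0
    exact hy (by simp [CrossingTwins.pd, h0])

theorem pd_comm {Ψ : E3 → ℝ} (h : ContDiff ℝ ∞ Ψ) (j k : Fin 3) :
    pd j (pd k Ψ) = pd k (pd j Ψ) := by
  ext y
  have hd : DifferentiableAt ℝ (fderiv ℝ Ψ) y :=
    (h.fderiv_right (m := 1) (WithTop.coe_le_coe.2 le_top)).differentiable one_ne_zero y
  have h1 : ∀ v w : E3, fderiv ℝ (fun z => fderiv ℝ Ψ z v) y w = fderiv ℝ (fderiv ℝ Ψ) y w v := by
    intro v w
    rw [fderiv_clm_apply hd (differentiableAt_const v)]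
    simp
  have h2 := (h.contDiffAt (x := y)).isSymmSndFDerivAt (by
    simp only [minSmoothness_of_isRCLikeNormedField]; exact WithTop.coe_le_coe.2 le_top)
  change fderiv ℝ (fun z => fderiv ℝ Ψ z _) y _ = fderiv ℝ (fun z => fderiv ℝ Ψ z _) y _
  rw [h1, h1]
  exact h2 _ _

section SaintVenant
variable {U : Set E3} {u : E3 → E3} {G : E3 → Matrix (Fin 3) (Fin 3) ℝ}

theorem HasBoundedWeakGradient.integrableOn_mul (h : HasBoundedWeakGradient U u G)
    {Ψ : E3 → ℝ} (hΨ : IsTest U Ψ) (i j : Fin 3) :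
    IntegrableOn (fun y => G y i j * Ψ y) U := by
  obtain ⟨R, hR⟩ := hΨ.compact.isBounded.subset_ball (0 : E3)
  have h1 : IntegrableOn (fun y => G y i j * Ψ y) (U ∩ Metric.ball 0 R) := by
    have := (hΨ.contDiff.continuous.memLp_top_of_hasCompactSupport hΨ.compact volume).restrict
      (U ∩ Metric.ball 0 R)
    have hfin : IsFiniteMeasure (volume.restrict (U ∩ Metric.ball (0 : E3) R)) :=
      ⟨by rw [Measure.restrict_apply_univ]
          exact (measure_mono inter_subset_right).trans_lt measure_ball_lt_top⟩
    exact (this.mul (h.memLp_grad R i j) (r := ∞)).integrable le_top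
  have h2 : (fun y => G y i j * Ψ y) = (Metric.ball (0 : E3) R).indicator
      (fun y => G y i j * Ψ y) := by
    ext y
    by_cases hy : y ∈ Metric.ball (0 : E3) R
    · rw [indicator_of_mem hy]
    · rw [indicator_of_notMem hy, image_eq_zero_of_notMem_tsupport fun h' => hy (hR h'), mul_zero]
  rw [h2, IntegrableOn, integrable_indicator_iff Metric.isOpen_ball.measurableSet, IntegrableOn,
    Measure.restrict_restrict Metric.isOpen_ball.measurableSet, inter_comm]
  exact h1

theorem HasBoundedWeakGradient.integral_strain (h : HasBoundedWeakGradient U u G)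
    {Ψ : E3 → ℝ} (hΨ : IsTest U Ψ) (i j : Fin 3) :
    ∫ y in U, (G y i j + G y j i) / 2 * Ψ y
      = -((∫ y in U, u y i * pd j Ψ y) + ∫ y in U, u y j * pd i Ψ y) / 2 := by
  have h1 := h.weak Ψ hΨ.contDiff hΨ.compact hΨ.subset i j
  have h2 := h.weak Ψ hΨ.contDiff hΨ.compact hΨ.subset j i
  have h3 : ∫ y in U, (G y i j + G y j i) / 2 * Ψ y
      = ((∫ y in U, G y i j * Ψ y) + ∫ y in U, G y j i * Ψ y) / 2 := by
    rw [← integral_add (h.integrableOn_mul hΨ i j) (h.integrableOn_mul hΨ j i), ← integral_div]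
    congr 1; ext y; ring
  rw [h3]
  simp only [pd]
  rw [h1, h2]; ring

/-- Saint-Venant's compatibility conditions for strains, in the weak form. -/
theorem HasBoundedWeakGradient.saintVenant (h : HasBoundedWeakGradient U u G)
    {Ψ : E3 → ℝ} (hΨ : IsTest U Ψ) (i j k l : Fin 3) :
    (∫ y in U, (G y i j + G y j i) / 2 * pd k (pd l Ψ) y)
      + (∫ y in U, (G y k l + G y l k) / 2 * pd i (pd j Ψ) y)
      - (∫ y in U, (G y i l + G y l i) / 2 * pd j (pd k Ψ) y)
      - (∫ y in U, (G y j k + G y k j) / 2 * pd i (pd l Ψ) y) = 0 := by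
  have hc := fun m n => pd_comm hΨ.contDiff m n
  have hc' := fun m n o => pd_comm (hΨ.pd o).contDiff m n
  rw [h.integral_strain ((hΨ.pd l).pd k), h.integral_strain ((hΨ.pd j).pd i),
    h.integral_strain ((hΨ.pd k).pd j), h.integral_strain ((hΨ.pd l).pd i)]
  have e1 : pd l (pd j (pd k Ψ)) = pd j (pd k (pd l Ψ)) := by rw [hc' l j k, hc l k]
  have e2 : pd k (pd i (pd j Ψ)) = pd i (pd j (pd k Ψ)) := by rw [hc' k i j, hc k j]
  have e3 : pd l (pd i (pd j Ψ)) = pd j (pd i (pd l Ψ)) := by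
    rw [hc' l i j, hc l j, hc' i j l]
  rw [e1, e2, e3, hc' i k l]
  ring
end SaintVenant

section Planar
variable {σ : Equiv.Perm (Fin 3)} {U : Set E3} {e : ℝ × ℝ → Matrix (Fin 3) (Fin 3) ℝ}

/-- Saint-Venant's compatibility conditions for strains that depend on the planar variables
only. -/
theorem IsPlanarStrain.saintVenant (h : IsPlanarStrain σ U e) {Ψ : E3 → ℝ} (hΨ : IsTest U Ψ)
    (i j k l : Fin 3) :
    (∫ y, e (planar σ y) i j * pd k (pd l Ψ) y)
      + (∫ y, e (planar σ y) k l * pd i (pd j Ψ) y)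
      - (∫ y, e (planar σ y) i l * pd j (pd k Ψ) y)
      - (∫ y, e (planar σ y) j k * pd i (pd l Ψ) y) = 0 := by
  obtain ⟨-, u, G, hG, he⟩ := h
  have key : ∀ (i j k l : Fin 3), ∫ y, e (planar σ y) i j * pd k (pd l Ψ) y
      = ∫ y in U, (G y i j + G y j i) / 2 * pd k (pd l Ψ) y := by
    intro i j k l
    rw [← setIntegral_eq_integral_of_forall_compl_eq_zero (s := U)]
    · refine integral_congr_ae ?_
      filter_upwards [he] with y hy
      rw [hy]
    · intro y hy
      rw [image_eq_zero_of_notMem_tsupport fun h' => hy (((hΨ.pd l).pd k).subset h'), mul_zero]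
  simp only [key]
  exact hG.saintVenant hΨ i j k l

theorem IsPlanarStrain.eq_symm (h : IsPlanarStrain σ U e) :
    ∀ᵐ y ∂(volume.restrict U), ∀ i j, e (planar σ y) i j = e (planar σ y) j i := by
  obtain ⟨-, u, G, hG, he⟩ := h
  filter_upwards [he] with y hy i j
  rw [← hy, ← hy, add_comm]

theorem contDiff_pdOne {ψ : ℝ × ℝ → ℝ} (h : ContDiff ℝ ∞ ψ) : ContDiff ℝ ∞ (pdOne ψ) :=
  (h.fderiv_right (m := ∞) (by simp)).clm_apply contDiff_const

theorem contDiff_pdTwo {ψ : ℝ × ℝ → ℝ} (h : ContDiff ℝ ∞ ψ) : ContDiff ℝ ∞ (pdTwo ψ) :=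
  (h.fderiv_right (m := ∞) (by simp)).clm_apply contDiff_const

theorem integral_deriv_eq_zero {γ : ℝ → ℝ} (h : ContDiff ℝ 1 γ) (hc : HasCompactSupport γ) :
    ∫ z, deriv γ z = 0 :=
  integral_eq_zero_of_hasDerivAt_of_integrable
    (fun z => (h.differentiable one_ne_zero z).hasDerivAt)
    ((h.continuous_deriv_one).integrable_of_hasCompactSupport hc.deriv)
    (h.continuous.integrable_of_hasCompactSupport hc)

variable {ψ : ℝ × ℝ → ℝ} {γ : ℝ → ℝ}

theorem IsPlanarStrain.planar_compat (h : IsPlanarStrain σ U e) (hψ : ContDiff ℝ ∞ ψ)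
    (hγ : ContDiff ℝ ∞ γ) (hT : IsTest U (tensor σ ψ γ)) (hγ1 : ∫ z, γ z = 1) :
    (∫ p, e p (σ 0) (σ 0) * pdTwo (pdTwo ψ) p) + (∫ p, e p (σ 1) (σ 1) * pdOne (pdOne ψ) p)
      = 2 * ∫ p, e p (σ 0) (σ 1) * pdOne (pdTwo ψ) p := by
  have h1 := h.saintVenant hT (σ 0) (σ 0) (σ 1) (σ 1)
  have d := hψ.differentiable (by simp)
  have d1 := (contDiff_pdOne hψ).differentiable (by simp)
  have d2 := (contDiff_pdTwo hψ).differentiable (by simp)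
  have dg := hγ.differentiable (by simp)
  simp only [pd_tensor_zero d dg, pd_tensor_one d dg, pd_tensor_zero d1 dg, pd_tensor_zero d2 dg,
    pd_tensor_one d2 dg] at h1
  have hk := fun i j f => integral_planar_mul σ (fun p => e p i j) f γ
  simp only [hk, hγ1] at h1
  linarith

theorem IsPlanarStrain.curl_compat_fst (h : IsPlanarStrain σ U e) (hψ : ContDiff ℝ ∞ ψ)
    (hγ : ContDiff ℝ ∞ γ) (hc : HasCompactSupport γ) (hT : IsTest U (tensor σ ψ γ))
    (hγ1 : ∫ z, γ z = 1) :
    ∫ p, e p (σ 1) (σ 2) * pdOne (pdOne ψ) p = ∫ p, e p (σ 2) (σ 0) * pdTwo (pdOne ψ) p := by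
  have h1 := h.saintVenant hT (σ 1) (σ 2) (σ 0) (σ 0)
  have d := hψ.differentiable (by simp)
  have d1 := (contDiff_pdOne hψ).differentiable (by simp)
  have dg := hγ.differentiable (by simp)
  have dg' := (contDiff_infty_iff_deriv.1 hγ).2.differentiable (by simp)
  simp only [pd_tensor_zero d dg, pd_tensor_two d dg, pd_tensor_zero d1 dg, pd_tensor_one d dg',
    pd_tensor_one d1 dg, pd_tensor_two d1 dg] at h1
  have hk := fun i j f γ => integral_planar_mul σ (fun p => e p i j) f γ
  simp only [hk, hγ1, integral_deriv_eq_zero (hγ.of_le (by simp)) hc] at h1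
  linarith

theorem IsPlanarStrain.curl_compat_snd (h : IsPlanarStrain σ U e) (hψ : ContDiff ℝ ∞ ψ)
    (hγ : ContDiff ℝ ∞ γ) (hc : HasCompactSupport γ) (hT : IsTest U (tensor σ ψ γ))
    (hγ1 : ∫ z, γ z = 1) :
    ∫ p, e p (σ 2) (σ 1) * pdOne (pdTwo ψ) p = ∫ p, e p (σ 0) (σ 2) * pdTwo (pdTwo ψ) p := by
  have h1 := h.saintVenant hT (σ 0) (σ 2) (σ 1) (σ 1)
  have d := hψ.differentiable (by simp)
  have d1 := (contDiff_pdTwo hψ).differentiable (by simp)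
  have dg := hγ.differentiable (by simp)
  have dg' := (contDiff_infty_iff_deriv.1 hγ).2.differentiable (by simp)
  simp only [pd_tensor_one d dg, pd_tensor_two d dg, pd_tensor_zero d1 dg, pd_tensor_zero d dg',
    pd_tensor_one d1 dg, pd_tensor_two d1 dg] at h1
  have hk := fun i j f γ => integral_planar_mul σ (fun p => e p i j) f γ
  simp only [hk, hγ1, integral_deriv_eq_zero (hγ.of_le (by simp)) hc] at h1
  linarith

/-- A smooth nonnegative function of the third variable with unit mass, supported in
`[-1/2, 1/2]`. -/
noncomputable def cutoff : ContDiffBump (0 : ℝ) := ⟨1 / 4, 1 / 2, by norm_num, by norm_num⟩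

theorem cutoff_eq_zero {z : ℝ} (hz : z ∉ Icc (-1 / 2 : ℝ) (1 / 2)) : cutoff z = 0 := by
  apply cutoff.zero_of_le_dist
  change 1 / 2 ≤ _
  rw [Real.dist_0_eq_abs]
  by_contra! h
  rw [abs_lt] at h
  exact hz ⟨by linarith, by linarith⟩

theorem one_half_le_integral_cutoff : 1 / 2 ≤ ∫ z, cutoff z := by
  have := cutoff.measure_closedBall_le_integral volume
  refine le_trans ?_ this
  rw [show cutoff.rIn = 1 / 4 from rfl, Real.volume_real_closedBall (by norm_num)]
  norm_num

end Planar

/-! ### Total variation and the phases -/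

theorem fderiv_eq_zero_of_notMem_square {φ : ℝ × ℝ → ℝ} (h0 : ∀ p ∉ square, φ p = 0) {p : ℝ × ℝ}
    (hp : p ∉ square) : fderiv ℝ φ p = 0 := by
  have : φ =ᶠ[𝓝 p] fun _ => 0 := by
    filter_upwards [isCompact_square.isClosed.isOpen_compl.mem_nhds hp] with q hq using h0 q hq
  rw [this.fderiv_eq]; simp

theorem hasCompactSupport_of_square {φ : ℝ × ℝ → ℝ} (h0 : ∀ p ∉ square, φ p = 0) :
    HasCompactSupport φ := HasCompactSupport.intro isCompact_square fun p hp => h0 p hp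

/-- The planar derivatives of a function of the planar variables are controlled by its total
variation on the unit ball. -/
theorem integral_mul_fderiv_le_totalVar (σ : Equiv.Perm (Fin 3)) {h φ : ℝ × ℝ → ℝ}
    (hTV : totalVar (Metric.ball 0 1) (fun y => h (planar σ y)) ≠ ⊤) (hφ : ContDiff ℝ 1 φ)
    (h0 : ∀ p ∉ square, φ p = 0) (hb : ∀ p, |φ p| ≤ 1) {i : Fin 3} (hi : i ≠ 2) :
    ∫ p in square, h p * fderiv ℝ φ p (planar σ (EuclideanSpace.single (σ i) 1))
      ≤ 2 * (totalVar (Metric.ball 0 1) (fun y => h (planar σ y))).toReal := by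
  set v := planar σ (EuclideanSpace.single (σ i) 1)
  have hcs := cutoff.hasCompactSupport
  have hcd : ContDiff ℝ 1 cutoff := cutoff.contDiff
  set Y : E3 → E3 := fun y => tensor σ φ cutoff y • EuclideanSpace.single (σ i) (1:ℝ) with hY
  have hsub := tsupport_tensor_subset σ h0 (fun z hz => cutoff_eq_zero hz)
  have hten : ContDiff ℝ 1 (tensor σ φ cutoff) := contDiff_tensor (n := 1) hφ hcd
  have hadm : ContDiff ℝ 1 Y ∧ HasCompactSupport Y ∧ tsupport Y ⊆ Metric.ball 0 1 ∧
      ∀ y, ‖Y y‖ ≤ 1 := by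
    refine ⟨hten.smul contDiff_const,
      (hasCompactSupport_tensor σ (hasCompactSupport_of_square h0) hcs).smul_right,
      (closure_mono fun y hy => ?_).trans hsub, fun y => ?_⟩
    · intro h1
      exact hy (by simp [hY, h1])
    · simp only [hY, norm_smul, PiLp.norm_single, norm_one, mul_one, tensor, norm_mul,
        Real.norm_eq_abs]
      refine mul_le_one₀ (hb _) (abs_nonneg _) ?_
      rw [abs_of_nonneg cutoff.nonneg]
      exact cutoff.le_one
  have hdiv : ∀ y, ∑ j, fderiv ℝ Y y (EuclideanSpace.single j 1) j
      = tensor σ (fun p => fderiv ℝ φ p v) cutoff y := by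
    intro y
    have h1 : fderiv ℝ Y y = (fderiv ℝ (tensor σ φ cutoff) y).smulRight
        (EuclideanSpace.single (σ i) (1:ℝ)) := by
      rw [hY, fderiv_smul_const (hten.differentiable one_ne_zero y)]
    rw [h1, Finset.sum_eq_single (σ i)]
    · simp only [ContinuousLinearMap.smulRight_apply]
      rw [fderiv_tensor (hφ.differentiable one_ne_zero) (hcd.differentiable one_ne_zero)]
      have : σ 2 ≠ σ i := fun h' => hi (σ.injective h').symm
      simp [tensor, this, v]
    · intro j _ hj
      simp [hj]
    · simp
  have h1 : ENNReal.ofReal (∫ y in Metric.ball 0 1, h (planar σ y) *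
        ∑ j, fderiv ℝ Y y (EuclideanSpace.single j 1) j)
      ≤ totalVar (Metric.ball 0 1) (fun y => h (planar σ y)) :=
    le_iSup₂_of_le (f := fun (φ : E3 → E3) (_ : ContDiff ℝ 1 φ ∧ HasCompactSupport φ ∧
        tsupport φ ⊆ Metric.ball 0 1 ∧ ∀ y, ‖φ y‖ ≤ 1) =>
      ENNReal.ofReal (∫ y in Metric.ball 0 1, h (planar σ y) *
        ∑ j, fderiv ℝ φ y (EuclideanSpace.single j 1) j)) Y hadm le_rfl
  have h2 := (ENNReal.ofReal_le_iff_le_toReal hTV).1 h1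
  simp only [hdiv] at h2
  have hv0 : ∀ p ∉ square, fderiv ℝ φ p v = 0 := fun p hp => by
    rw [fderiv_eq_zero_of_notMem_square h0 hp]; rfl
  rw [setIntegral_eq_integral_of_forall_compl_eq_zero, integral_planar_mul] at h2
  · rw [setIntegral_eq_integral_of_forall_compl_eq_zero fun p hp => by rw [hv0 p hp, mul_zero]]
    have h3 := one_half_le_integral_cutoff
    have h4 : 0 ≤ (totalVar (Metric.ball 0 1) (fun y => h (planar σ y))).toReal :=
      ENNReal.toReal_nonneg
    by_contra! h5
    nlinarith
  · intro y hy
    have hsub' := tsupport_tensor_subset σ hv0 (fun z hz => cutoff_eq_zero hz)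
    rw [image_eq_zero_of_notMem_tsupport fun h' => hy (hsub' h'), mul_zero]

theorem planar_single_cases (σ : Equiv.Perm (Fin 3)) {v : ℝ × ℝ} (hv : v = (1, 0) ∨ v = (0, 1)) :
    ∃ i : Fin 3, i ≠ 2 ∧ v = planar σ (EuclideanSpace.single (σ i) 1) := by
  rcases hv with rfl | rfl
  · exact ⟨0, by decide, (planar_single σ).1.symm⟩
  · exact ⟨1, by decide, (planar_single σ).2.1.symm⟩

section Phases
variable {χ : Fin 4 → ℝ × ℝ → ℝ}

theorem IsPhase.abs_le_one (h : IsPhase χ) (i : Fin 4) (p : ℝ × ℝ) : |χ i p| ≤ 1 := by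
  rcases h.zero_or_one i p with h | h <;> simp [h]

theorem IsPhase.measurable_modChar (h : IsPhase χ) (k : Fin 3) : Measurable (modChar χ k) := by
  have := h.measurable
  fin_cases k <;> simp [modChar] <;> fun_prop

theorem IsPhase.modChar_eq (h : IsPhase χ) (k : Fin 3) (p : ℝ × ℝ) :
    modChar χ k p = 1 ∨ modChar χ k p = -1 := by
  have h4 := h.sum_eq_one p
  rcases h.zero_or_one 0 p with h0 | h0 <;> rcases h.zero_or_one 1 p with h1 | h1 <;>
    rcases h.zero_or_one 2 p with h2 | h2 <;> rcases h.zero_or_one 3 p with h3 | h3 <;>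
    simp only [h0, h1, h2, h3] at h4 <;> norm_num at h4 <;>
    fin_cases k <;> simp [modChar, h1, h2, h3] <;> norm_num

/-- The product of the three modified characteristic functions is one. -/
theorem IsPhase.modChar_one_eq (h : IsPhase χ) (σ : Equiv.Perm (Fin 3)) (p : ℝ × ℝ) :
    modChar χ (σ 1) p = modChar χ (σ 2) p * modChar χ (σ 0) p := by
  have key : modChar χ 0 p * modChar χ 1 p * modChar χ 2 p = 1 := by
    have h4 := h.sum_eq_one p
    rcases h.zero_or_one 0 p with h0 | h0 <;> rcases h.zero_or_one 1 p with h1 | h1 <;>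
      rcases h.zero_or_one 2 p with h2 | h2 <;> rcases h.zero_or_one 3 p with h3 | h3 <;>
      simp only [h0, h1, h2, h3] at h4 <;> norm_num at h4 <;>
      simp [modChar, h1, h2, h3] <;> norm_num
  have key2 : modChar χ (σ 0) p * modChar χ (σ 1) p * modChar χ (σ 2) p = 1 := by
    rw [← key]
    have := Equiv.prod_comp σ fun k => modChar χ k p
    simpa [Fin.prod_univ_three] using this
  rcases h.modChar_eq (σ 0) p with h0 | h0 <;> rcases h.modChar_eq (σ 1) p with h1 | h1 <;>
    rcases h.modChar_eq (σ 2) p with h2 | h2 <;> rw [h0, h1, h2] at key2 ⊢ <;> linarith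

theorem abs_modChar_sub_le (χ : Fin 4 → ℝ × ℝ → ℝ) (k : Fin 3) (p q : ℝ × ℝ) :
    |modChar χ k p - modChar χ k q| ≤ 2 * ∑ i, |χ i p - χ i q| := by
  rw [Fin.sum_univ_four]
  have key : ∀ i j : Fin 4, |1 - 2 * (χ i p + χ j p) - (1 - 2 * (χ i q + χ j q))|
      ≤ 2 * (|χ i p - χ i q| + |χ j p - χ j q|) := by
    intro i j
    rw [show 1 - 2 * (χ i p + χ j p) - (1 - 2 * (χ i q + χ j q))
      = -(2 * ((χ i p - χ i q) + (χ j p - χ j q))) by ring, abs_neg, abs_mul, abs_two]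
    exact mul_le_mul_of_nonneg_left (abs_add_le _ _) zero_le_two
  have h0 := abs_nonneg (χ 0 p - χ 0 q)
  have h1 := abs_nonneg (χ 1 p - χ 1 q)
  have h2 := abs_nonneg (χ 2 p - χ 2 q)
  have h3 := abs_nonneg (χ 3 p - χ 3 q)
  fin_cases k
  · exact (key 1 2).trans (by linarith)
  · exact (key 2 3).trans (by linarith)
  · exact (key 1 3).trans (by linarith)

/-- The off-diagonal entries of the strain of the phases. -/
theorem phaseStrain_offDiag (δ : ℝ) (χ : Fin 4 → ℝ × ℝ → ℝ) (σ : Equiv.Perm (Fin 3)) (p : ℝ × ℝ) :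
    phaseStrain δ χ p (σ 0) (σ 1) = modChar χ (σ 2) p := by
  have h : ∀ i j k : Fin 3, i ≠ j → i ≠ k → j ≠ k → phaseStrain δ χ p i j = modChar χ k p := by
    intro i j k
    fin_cases i <;> fin_cases j <;> fin_cases k <;> simp [phaseStrain]
  refine h _ _ _ ?_ ?_ ?_ <;> exact fun h' => absurd (σ.injective h') (by decide)

theorem phaseStrain_diag (δ : ℝ) (χ : Fin 4 → ℝ × ℝ → ℝ) (i : Fin 3) :
    ∃ d : ℝ, ∀ p, phaseStrain δ χ p i i = d := by
  fin_cases i <;> simp [phaseStrain]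

/-- Translation estimate for the modified characteristic functions, in the interior. -/
theorem IsPhase.setIntegral_modChar_le (h : IsPhase χ) {σ : Equiv.Perm (Fin 3)}
    (hS : surfEnergy σ χ ≠ ⊤) (k : Fin 3) {v : ℝ × ℝ} (hv : v = (1, 0) ∨ v = (0, 1))
    {T d : ℝ} (hT : 0 ≤ T) (hd : 0 < d) {K : Set (ℝ × ℝ)} (hK : MeasurableSet K)
    (hKd : ∀ x ∈ K, ∀ τ ∈ Icc 0 T, ∀ y, dist y (x + τ • v) ≤ d → y ∈ square) :
    ∫ x in K, |modChar χ k x - modChar χ k (x + T • v)| ≤ T * (4 * (surfEnergy σ χ).toReal) := by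
  obtain ⟨i, hi, rfl⟩ := planar_single_cases σ hv
  have hS' : ∀ j, totalVar (Metric.ball 0 1) (fun y => χ j (planar σ y)) ≠ ⊤ := fun j =>
    ((ENNReal.sum_ne_top.1 hS) j (Finset.mem_univ j))
  have h1 := fun j => setIntegral_abs_sub_translate_le (h.measurable j) (h.abs_le_one j) _ hT hd hK
    hKd fun φ hφ h0 hb => integral_mul_fderiv_le_totalVar σ (hS' j) hφ h0 hb hi
  have hKs : K ⊆ square := fun x hx => hKd x hx 0 ⟨le_rfl, hT⟩ x (by simpa using hd.le)
  have hfin : IsFiniteMeasure (volume.restrict K) :=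
    ⟨by rw [Measure.restrict_apply_univ]
        exact (measure_mono hKs).trans_lt isCompact_square.measure_lt_top⟩
  have hint : ∀ j, Integrable (fun x => |χ j x -
      χ j (x + T • planar σ (EuclideanSpace.single (σ i) 1))|) (volume.restrict K) := fun j => by
    refine Integrable.of_bound (C := 2) (Measurable.aestronglyMeasurable ?_)
      (Eventually.of_forall fun x => ?_)
    · have := h.measurable j
      fun_prop
    · rw [Real.norm_eq_abs, abs_abs]
      refine (abs_sub _ _).trans ?_
      linarith [h.abs_le_one j x,
        h.abs_le_one j (x + T • planar σ (EuclideanSpace.single (σ i) 1))]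
  calc _ ≤ ∫ x in K, 2 * ∑ j, |χ j x - χ j (x + T • planar σ (EuclideanSpace.single (σ i) 1))| := by
        refine integral_mono_of_nonneg (Eventually.of_forall fun x => abs_nonneg _) ?_
          (Eventually.of_forall fun x => abs_modChar_sub_le χ k _ _)
        exact (integrable_finsetSum _ fun j _ => hint j).const_mul 2
    _ = 2 * ∑ j, ∫ x in K, |χ j x - χ j (x + T • planar σ (EuclideanSpace.single (σ i) 1))| := by
        rw [integral_const_mul, integral_finsetSum _ fun j _ => hint j]
    _ ≤ 2 * ∑ j, T * (2 * (totalVar (Metric.ball 0 1) (fun y => χ j (planar σ y))).toReal) :=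
        mul_le_mul_of_nonneg_left (Finset.sum_le_sum fun j _ => h1 j) zero_le_two
    _ = T * (4 * (surfEnergy σ χ).toReal) := by
        rw [surfEnergy, ENNReal.toReal_sum fun j _ => hS' j, ← Finset.mul_sum, ← Finset.mul_sum]
        ring

/-- Translation estimate for the modified characteristic functions, on the torus. -/
theorem IsPhase.integral_modChar_le (h : IsPhase χ) (hp : ∀ i, Periodic2 (χ i))
    (hS : ∑ i, torusVar (χ i) ≠ ⊤) (k : Fin 3) {T : ℝ} (hT : 0 ≤ T) :
    ∫ x in square, |modChar χ k x - modChar χ k (x + T • (0, 1))|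
      ≤ T * (2 * (∑ i, torusVar (χ i)).toReal) := by
  have hS' : ∀ j, torusVar (χ j) ≠ ⊤ := fun j =>
    ((ENNReal.sum_ne_top.1 hS) j (Finset.mem_univ j))
  have h1 : ∀ j, ∫ x in square, |χ j x - χ j (x + T • (0, 1))| ≤ T * (torusVar (χ j)).toReal := by
    refine fun j => (hp j).integral_abs_sub_translate_le (h.measurable j) (h.abs_le_one j) _ hT
      fun φ hφ hφp hb => ?_
    refine (ENNReal.ofReal_le_iff_le_toReal (hS' j)).1 ?_
    refine le_iSup₂_of_le (f := fun (φ : (ℝ × ℝ → ℝ) × (ℝ × ℝ → ℝ))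
      (_ : (ContDiff ℝ 1 φ.1 ∧ Periodic2 φ.1) ∧ (ContDiff ℝ 1 φ.2 ∧ Periodic2 φ.2) ∧
        ∀ p, φ.1 p ^ 2 + φ.2 p ^ 2 ≤ 1) =>
      ENNReal.ofReal (∫ p in square, χ j p * (fderiv ℝ φ.1 p (1, 0) + fderiv ℝ φ.2 p (0, 1))))
      (fun _ => 0, φ) ⟨⟨contDiff_const, fun _ _ => ⟨rfl, rfl⟩⟩, ⟨hφ, hφp⟩, fun p => ?_⟩ ?_
    · have := abs_le.1 (hb p)
      simp only; nlinarith
    · simp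
  have hint : ∀ j, Integrable (fun x => |χ j x - χ j (x + T • (0, 1))|)
      (volume.restrict square) := fun j => by
    refine Integrable.of_bound (C := 2) (Measurable.aestronglyMeasurable ?_)
      (Eventually.of_forall fun x => ?_)
    · have := h.measurable j
      fun_prop
    · rw [Real.norm_eq_abs, abs_abs]
      refine (abs_sub _ _).trans ?_
      linarith [h.abs_le_one j x, h.abs_le_one j (x + T • (0, 1))]
  calc _ ≤ ∫ x in square, 2 * ∑ j, |χ j x - χ j (x + T • (0, 1))| := by
        refine integral_mono_of_nonneg (Eventually.of_forall fun x => abs_nonneg _) ?_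
          (Eventually.of_forall fun x => abs_modChar_sub_le χ k _ _)
        exact (integrable_finsetSum _ fun j _ => hint j).const_mul 2
    _ = 2 * ∑ j, ∫ x in square, |χ j x - χ j (x + T • (0, 1))| := by
        rw [integral_const_mul, integral_finsetSum _ fun j _ => hint j]
    _ ≤ 2 * ∑ j, T * (torusVar (χ j)).toReal :=
        mul_le_mul_of_nonneg_left (Finset.sum_le_sum fun j _ => h1 j) zero_le_two
    _ = _ := by
        rw [ENNReal.toReal_sum fun j _ => hS' j, ← Finset.mul_sum]
        ring
end Phases

theorem sq_entry_le_normSqMat (A : Matrix (Fin 3) (Fin 3) ℝ) (i j : Fin 3) :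
    A i j ^ 2 ≤ normSqMat A := by
  refine le_trans ?_ (Finset.single_le_sum (f := fun i => ∑ j, A i j ^ 2)
    (fun i _ => Finset.sum_nonneg fun j _ => sq_nonneg _) (Finset.mem_univ i))
  exact Finset.single_le_sum (f := fun j => A i j ^ 2) (fun j _ => sq_nonneg _) (Finset.mem_univ j)

theorem lintegral_square_le_ball (σ : Equiv.Perm (Fin 3)) {g : ℝ × ℝ → ℝ≥0∞} (hg : Measurable g) :
    ∫⁻ p in square, g p ≤ ∫⁻ y in Metric.ball (0 : E3) 1, g (planar σ y) := by
  have h := lintegral_planar_mul σ (hg.indicator measurableSet_square)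
    ((measurable_const (a := (1 : ℝ≥0∞))).indicator (measurableSet_Icc (a := (-1 / 2 : ℝ))
      (b := 1 / 2)))
  rw [lintegral_indicator measurableSet_square, lintegral_indicator measurableSet_Icc,
    setLIntegral_const, Real.volume_Icc] at h
  norm_num at h
  rw [← h, ← lintegral_indicator Metric.isOpen_ball.measurableSet]
  refine lintegral_mono fun y => ?_
  by_cases h1 : planar σ y ∈ square
  · by_cases h2 : y (σ 2) ∈ Icc (-1 / 2 : ℝ) (1 / 2)
    · have hy : y ∈ Metric.ball (0 : E3) 1 := by
        obtain ⟨⟨h3, h4⟩, h5, h6⟩ := h1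
        obtain ⟨h7, h8⟩ := h2
        simp only [planar] at h3 h4 h5 h6
        rw [mem_ball_zero_iff, EuclideanSpace.norm_eq, Real.sqrt_lt' one_pos, ← Equiv.sum_comp σ]
        simp only [Fin.sum_univ_three, Real.norm_eq_abs, sq_abs]
        nlinarith
      rw [indicator_of_mem hy, indicator_of_mem h1, mul_comm]
      exact mul_le_of_le_one_left' (indicator_le (fun _ _ => le_rfl) _)
    · have : y (σ 2) ∉ Icc (-(1 / 2) : ℝ) (1 / 2) := by rwa [← neg_div]
      rw [indicator_of_notMem this, mul_zero]; exact zero_le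
  · rw [indicator_of_notMem h1]; simp

theorem lintegral_ball_le_square (σ : Equiv.Perm (Fin 3)) {g : ℝ × ℝ → ℝ≥0∞} (hg : Measurable g) :
    ∫⁻ y in Metric.ball (0 : E3) (1 / 4), g (planar σ y)
      ≤ ∫⁻ p in Icc (-1 / 4) (1 / 4) ×ˢ Icc (-1 / 4) (1 / 4), g p := by
  have hm : MeasurableSet (Icc (-1 / 4 : ℝ) (1 / 4) ×ˢ Icc (-1 / 4 : ℝ) (1 / 4)) :=
    measurableSet_Icc.prod measurableSet_Icc
  have h := lintegral_planar_mul σ (hg.indicator hm)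
    ((measurable_const (a := (1 : ℝ≥0∞))).indicator (measurableSet_Icc (a := (-1 / 4 : ℝ))
      (b := 1 / 4)))
  rw [lintegral_indicator hm, lintegral_indicator measurableSet_Icc,
    setLIntegral_const, Real.volume_Icc] at h
  refine le_trans ?_ (h.le.trans ?_)
  · rw [← lintegral_indicator Metric.isOpen_ball.measurableSet]
    refine lintegral_mono fun y => ?_
    by_cases hy : y ∈ Metric.ball (0 : E3) (1 / 4)
    · have hi : ∀ i, y i ∈ Icc (-1 / 4 : ℝ) (1 / 4) := fun i => by
        have h1 := PiLp.norm_apply_le y i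
        have h2 := mem_ball_zero_iff.1 hy
        have h3 := abs_le.1 (h1.trans h2.le)
        exact ⟨by linarith [h3.1], h3.2⟩
      have h1 : planar σ y ∈ Icc (-1 / 4 : ℝ) (1 / 4) ×ˢ Icc (-1 / 4 : ℝ) (1 / 4) := ⟨hi _, hi _⟩
      rw [indicator_of_mem hy, indicator_of_mem h1, indicator_of_mem (hi _), mul_one]
    · rw [indicator_of_notMem hy]; exact zero_le
  · refine mul_le_of_le_one_right' ?_
    rw [one_mul, ENNReal.ofReal_le_one]; norm_num

/-! ### Functions with few mixed differences -/

/-- Lebesgue measure on `[-1/4, 1/4]`. -/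
noncomputable def innerMeasure : Measure ℝ := volume.restrict (Icc (-1 / 4) (1 / 4))

theorem innerMeasure_univ : innerMeasure univ = ENNReal.ofReal (1 / 2) := by
  rw [innerMeasure, Measure.restrict_apply_univ, Real.volume_Icc]; norm_num

theorem innerMeasure_univ_le : innerMeasure univ ≤ 1 := by
  rw [innerMeasure_univ, ENNReal.ofReal_le_one]; norm_num

instance : IsFiniteMeasure innerMeasure := ⟨innerMeasure_univ_le.trans_lt ENNReal.one_lt_top⟩

/-- The square `[-1/4, 1/4]²`. -/
def innerSquare : Set (ℝ × ℝ) := Icc (-1 / 4) (1 / 4) ×ˢ Icc (-1 / 4) (1 / 4)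

theorem measurableSet_innerSquare : MeasurableSet innerSquare :=
  measurableSet_Icc.prod measurableSet_Icc

theorem volume_restrict_innerSquare :
    (volume.restrict innerSquare : Measure (ℝ × ℝ)) = innerMeasure.prod innerMeasure := by
  rw [innerMeasure, Measure.prod_restrict]; rfl

theorem lintegral_const_innerMeasure_le (c : ℝ≥0∞) : ∫⁻ _, c ∂innerMeasure ≤ c := by
  rw [lintegral_const]; exact mul_le_of_le_one_right' innerMeasure_univ_le

theorem enorm_sub_le_of_sign {a b : ℝ} (ha : a = 1 ∨ a = -1) (hb : b = 1 ∨ b = -1) :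
    ‖a - b‖ₑ ≤ 2 := by
  rw [Real.enorm_eq_ofReal_abs, ← ENNReal.ofReal_ofNat 2]
  apply ENNReal.ofReal_le_ofReal
  rcases ha with rfl | rfl <;> rcases hb with rfl | rfl <;> norm_num

/-- A function with values `1` and `-1` whose mixed differences mostly vanish is close to a function
of one of the variables: outside a small set it is a sum of functions of one variable each, and
both can be nonconstant only where the sum leaves `{-1, 1}`. -/
theorem exists_isSign_of_mixed_difference {w : ℝ × ℝ → ℝ} (hw : Measurable w)
    (hw1 : ∀ p, w p = 1 ∨ w p = -1) {D : ℝ × ℝ → ℝ≥0∞} (hD : Measurable D) {B : ℝ} (hB : 0 ≤ B)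
    (h1 : ∀ p ∈ innerSquare, ∀ q ∈ innerSquare,
      w p - w (q.1, p.2) - w (p.1, q.2) + w q ≠ 0 → 1 ≤ D p + D (q.1, p.2) + D (p.1, q.2) + D q)
    (h2 : ∫⁻ p in innerSquare, D p ≤ ENNReal.ofReal B) :
    ∃ f : ℝ → ℝ, IsSign f ∧
      ((∫⁻ p in innerSquare, ‖w p - f p.1‖ₑ ≤ ENNReal.ofReal (2 * (16 * B + √(16 * B)))) ∨
       (∫⁻ p in innerSquare, ‖w p - f p.2‖ₑ ≤ ENNReal.ofReal (2 * (16 * B + √(16 * B))))) := by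
  set N : ℝ × ℝ → Set (ℝ × ℝ) := fun q => {p | w p - w (q.1, p.2) - w (p.1, q.2) + w q ≠ 0} with hN
  have hNm : ∀ q, MeasurableSet (N q) := fun q => by
    have : Measurable fun p : ℝ × ℝ => w p - w (q.1, p.2) - w (p.1, q.2) + w q := by fun_prop
    exact this (measurableSet_singleton 0).compl
  set H : ℝ × ℝ → ℝ≥0∞ := fun q => (∫⁻ p in innerSquare, D p)
      + (∫⁻ y, D (q.1, y) ∂innerMeasure) + (∫⁻ x, D (x, q.2) ∂innerMeasure) + D q with hH
  have mH1 : Measurable fun q : ℝ × ℝ => ∫⁻ y, D (q.1, y) ∂innerMeasure :=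
    hD.lintegral_prod_right'.comp measurable_fst
  have mH2 : Measurable fun q : ℝ × ℝ => ∫⁻ x, D (x, q.2) ∂innerMeasure :=
    (hD.lintegral_prod_left').comp measurable_snd
  have hHm : Measurable H := ((measurable_const.add mH1).add mH2).add hD
  have hNH : ∀ q ∈ innerSquare, volume.restrict innerSquare (N q) ≤ H q := by
    intro q hq
    have m1 : Measurable fun p : ℝ × ℝ => D (q.1, p.2) := by fun_prop
    have m2 : Measurable fun p : ℝ × ℝ => D (p.1, q.2) := by fun_prop
    calc volume.restrict innerSquare (N q)
        = ∫⁻ p in innerSquare, (N q).indicator 1 p := (lintegral_indicator_one (hNm q)).symm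
      _ ≤ ∫⁻ p in innerSquare, (D p + D (q.1, p.2) + D (p.1, q.2) + D q) := by
          refine setLIntegral_mono' measurableSet_innerSquare fun p hp => ?_
          by_cases hpN : p ∈ N q
          · rw [indicator_of_mem hpN]; exact h1 p hp q hq hpN
          · rw [indicator_of_notMem hpN]; exact zero_le
      _ = (∫⁻ p in innerSquare, D p) + (∫⁻ p in innerSquare, D (q.1, p.2))
          + (∫⁻ p in innerSquare, D (p.1, q.2)) + ∫⁻ p in innerSquare, D q := by
          rw [lintegral_add_right _ measurable_const, lintegral_add_right _ m2,
            lintegral_add_right _ m1]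
      _ ≤ H q := by
          simp only [hH]
          gcongr
          · rw [volume_restrict_innerSquare, lintegral_prod _ m1.aemeasurable]
            exact lintegral_const_innerMeasure_le _
          · rw [volume_restrict_innerSquare, lintegral_prod _ m2.aemeasurable]
            exact lintegral_mono fun x => lintegral_const_innerMeasure_le _
          · rw [volume_restrict_innerSquare, lintegral_prod _ measurable_const.aemeasurable]
            exact (lintegral_mono fun x => lintegral_const_innerMeasure_le _).trans
              (lintegral_const_innerMeasure_le _)
  have hvol : volume innerSquare = ENNReal.ofReal (1 / 4) := by
    rw [← Measure.restrict_apply_univ, volume_restrict_innerSquare, ← univ_prod_univ,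
      Measure.prod_prod, innerMeasure_univ, ← ENNReal.ofReal_mul (by norm_num)]
    norm_num
  have hHint : ∫⁻ q in innerSquare, H q ≤ 4 * ENNReal.ofReal B := by
    have e1 : ∫⁻ q in innerSquare, (∫⁻ p in innerSquare, D p) ≤ ENNReal.ofReal B := by
      rw [setLIntegral_const, hvol]
      exact (mul_le_of_le_one_right' (by rw [ENNReal.ofReal_le_one]; norm_num)).trans h2
    have e2 : ∫⁻ q in innerSquare, (∫⁻ y, D (q.1, y) ∂innerMeasure) ≤ ENNReal.ofReal B := by
      refine le_trans ?_ h2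
      rw [volume_restrict_innerSquare, lintegral_prod _ mH1.aemeasurable,
        lintegral_prod _ hD.aemeasurable]
      exact lintegral_mono fun x => lintegral_const_innerMeasure_le _
    have e3 : ∫⁻ q in innerSquare, (∫⁻ x, D (x, q.2) ∂innerMeasure) ≤ ENNReal.ofReal B := by
      refine le_trans ?_ h2
      rw [volume_restrict_innerSquare, lintegral_prod _ mH2.aemeasurable,
        lintegral_prod_symm _ hD.aemeasurable]
      exact lintegral_const_innerMeasure_le _
    simp only [hH]
    rw [lintegral_add_right _ hD, lintegral_add_right _ mH2, lintegral_add_right _ mH1]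
    calc _ ≤ ENNReal.ofReal B + ENNReal.ofReal B + ENNReal.ofReal B + ENNReal.ofReal B := by gcongr
      _ = _ := by ring
  -- a base point at which the set of nonvanishing mixed differences is small
  obtain ⟨q, hq, hqH⟩ := exists_le_setLAverage (μ := volume) (s := innerSquare)
    (by rw [hvol]; norm_num) (by rw [hvol]; exact ENNReal.ofReal_ne_top) hHm.aemeasurable
  set δ := 16 * B with hδ
  have hδ0 : 0 ≤ δ := by positivity
  have hbad : volume.restrict innerSquare (N q) ≤ ENNReal.ofReal δ := by
    refine (hNH q hq).trans (hqH.trans ?_)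
    rw [setLAverage_eq, hvol]
    refine (ENNReal.div_le_div_right hHint _).trans (le_of_eq ?_)
    rw [← ENNReal.ofReal_ofNat 4, ← ENNReal.ofReal_mul (by norm_num),
      ← ENNReal.ofReal_div_of_pos (by norm_num)]
    congr 1; ring
  set a : ℝ → ℝ := fun x => w (x, q.2) with ha
  set b : ℝ → ℝ := fun y => w (q.1, y) with hb
  have ma : Measurable a := by fun_prop
  have mb : Measurable b := by fun_prop
  set A : Set ℝ := {x | a x ≠ w q}
  set A' : Set ℝ := {y | b y ≠ w q}
  have mA : MeasurableSet A := ma (measurableSet_singleton _).compl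
  have mA' : MeasurableSet A' := mb (measurableSet_singleton _).compl
  -- if `w` changes in both variables, then the mixed difference does not vanish
  have hprod : innerMeasure A * innerMeasure A' ≤ ENNReal.ofReal δ := by
    rw [← Measure.prod_prod, ← volume_restrict_innerSquare]
    refine (measure_mono ?_).trans hbad
    rintro ⟨x, y⟩ ⟨hx, hy⟩
    simp only [A, A', mem_ofPred_eq, ha, hb] at hx hy
    simp only [hN, mem_ofPred_eq]
    intro h0
    rcases hw1 q with e | e <;> rcases hw1 (x, q.2) with e1 | e1 <;>
      rcases hw1 (q.1, y) with e2 | e2 <;> rcases hw1 (x, y) with e3 | e3 <;>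
      rw [e, e1, e2, e3] at h0 <;> simp [e, e1, e2] at hx hy <;> norm_num at h0
  have hor : innerMeasure A' ≤ ENNReal.ofReal √δ ∨ innerMeasure A ≤ ENNReal.ofReal √δ := by
    by_contra! h
    refine absurd hprod (not_le.2 ?_)
    calc ENNReal.ofReal δ = ENNReal.ofReal √δ * ENNReal.ofReal √δ := by
          rw [← ENNReal.ofReal_mul (Real.sqrt_nonneg _), Real.mul_self_sqrt hδ0]
      _ < _ := ENNReal.mul_lt_mul h.2 h.1
  have hset : ∀ (f : ℝ × ℝ → ℝ) (S : Set (ℝ × ℝ)), Measurable f → MeasurableSet S →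
      (∀ p, f p = 1 ∨ f p = -1) → (∀ p, p ∉ N q → p ∉ S → w p = f p) →
      volume.restrict innerSquare S ≤ ENNReal.ofReal √δ →
      ∫⁻ p in innerSquare, ‖w p - f p‖ₑ ≤ ENNReal.ofReal (2 * (δ + √δ)) := by
    intro f S mf mS hf hfS hS
    calc ∫⁻ p in innerSquare, ‖w p - f p‖ₑ
        ≤ ∫⁻ p in innerSquare, (N q ∪ S).indicator (fun _ => 2) p := by
          refine lintegral_mono fun p => ?_
          by_cases hp : p ∈ N q ∪ S
          · rw [indicator_of_mem hp]; exact enorm_sub_le_of_sign (hw1 p) (hf p)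
          · rw [indicator_of_notMem hp, hfS p (fun h => hp (Or.inl h)) fun h => hp (Or.inr h)]
            simp
      _ = 2 * volume.restrict innerSquare (N q ∪ S) :=
          lintegral_indicator_const ((hNm q).union mS) 2
      _ ≤ 2 * (ENNReal.ofReal δ + ENNReal.ofReal √δ) := by
          gcongr
          exact (measure_union_le _ _).trans (add_le_add hbad hS)
      _ = _ := by
          rw [ENNReal.ofReal_mul zero_le_two, ENNReal.ofReal_add hδ0 (Real.sqrt_nonneg _),
            ENNReal.ofReal_ofNat]
  rcases hor with h | h
  · refine ⟨a, ⟨ma, fun s => hw1 _⟩, Or.inl (hset (fun p => a p.1) (univ ×ˢ A')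
      (ma.comp measurable_fst) (MeasurableSet.univ.prod mA') (fun p => hw1 _) ?_ ?_)⟩
    · rintro ⟨x, y⟩ hp hS
      simp only [hN, mem_ofPred_eq, not_not] at hp
      simp only [A', mem_prod, mem_univ, true_and, mem_ofPred_eq, not_not, hb] at hS
      simp only [ha]; linarith
    · rw [volume_restrict_innerSquare, Measure.prod_prod]
      exact (mul_le_of_le_one_left' innerMeasure_univ_le).trans h
  · refine ⟨b, ⟨mb, fun s => hw1 _⟩, Or.inr (hset (fun p => b p.2) (A ×ˢ univ)
      (mb.comp measurable_snd) (mA.prod MeasurableSet.univ) (fun p => hw1 _) ?_ ?_)⟩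
    · rintro ⟨x, y⟩ hp hS
      simp only [hN, mem_ofPred_eq, not_not] at hp
      simp only [A, mem_prod, mem_univ, and_true, mem_ofPred_eq, not_not, ha] at hS
      simp only [hb]; linarith
    · rw [volume_restrict_innerSquare, Measure.prod_prod]
      exact (mul_le_of_le_one_right' innerMeasure_univ_le).trans h

/-! ### Smooth steps and strips -/

/-- A smooth function that increases from `0` to `1` on `[x, x + ε]`. -/
noncomputable def ramp (ε x z : ℝ) : ℝ := Real.smoothTransition ((z - x) / ε)

theorem contDiff_ramp (ε x : ℝ) : ContDiff ℝ ∞ (ramp ε x) :=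
  Real.smoothTransition.contDiff.comp (by fun_prop)

theorem ramp_of_le {ε x z : ℝ} (hε : 0 < ε) (h : z ≤ x) : ramp ε x z = 0 :=
  Real.smoothTransition.zero_of_nonpos (div_nonpos_of_nonpos_of_nonneg (by linarith) hε.le)

theorem ramp_of_ge {ε x z : ℝ} (hε : 0 < ε) (h : x + ε ≤ z) : ramp ε x z = 1 :=
  Real.smoothTransition.one_of_one_le ((one_le_div hε).2 (by linarith))

theorem deriv_comp_ramp {S : ℝ → ℝ} (hS : Differentiable ℝ S) (ε x z : ℝ) :
    deriv (fun z => S ((z - x) / ε)) z = ε⁻¹ * deriv S ((z - x) / ε) := by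
  have h1 : HasDerivAt (fun z => (z - x) / ε) (1 / ε) z :=
    ((hasDerivAt_id z).sub_const x).div_const ε
  have h2 := ((hS ((z - x) / ε)).hasDerivAt.comp z h1).deriv
  rw [one_div, mul_comm] at h2
  exact h2

/-- Bounds on the first two derivatives of the ramp, with a universal constant. -/
theorem exists_ramp_bound : ∃ c : ℝ, 1 ≤ c ∧ ∀ ε : ℝ, 0 < ε → ∀ x z : ℝ,
    |deriv (ramp ε x) z| ≤ (Icc x (x + ε)).indicator (fun _ => c / ε) z ∧
    |deriv (deriv (ramp ε x)) z| ≤ (Icc x (x + ε)).indicator (fun _ => c / ε ^ 2) z := by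
  set S := Real.smoothTransition
  have hS : ContDiff ℝ ∞ S := Real.smoothTransition.contDiff
  have hS1 : ContDiff ℝ ∞ (deriv S) := (contDiff_infty_iff_deriv.1 hS).2
  have hS2 : ContDiff ℝ ∞ (deriv (deriv S)) := (contDiff_infty_iff_deriv.1 hS1).2
  have z1 : ∀ t ∉ Icc (0 : ℝ) 1, deriv S =ᶠ[𝓝 t] fun _ => 0 := by
    intro t ht
    filter_upwards [isClosed_Icc.isOpen_compl.mem_nhds ht] with s hs
    have : S =ᶠ[𝓝 s] fun _ => S s := by
      rcases lt_or_ge s 0 with h | h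
      · filter_upwards [Iio_mem_nhds h] with r hr
        exact (Real.smoothTransition.zero_of_nonpos (le_of_lt hr)).trans
          (Real.smoothTransition.zero_of_nonpos h.le).symm
      · have h' : 1 < s := by by_contra! h'; exact hs ⟨h, h'⟩
        filter_upwards [Ioi_mem_nhds h'] with r hr
        exact (Real.smoothTransition.one_of_one_le (le_of_lt hr)).trans
          (Real.smoothTransition.one_of_one_le h'.le).symm
    rw [this.deriv_eq]; simp
  have z2 : ∀ t ∉ Icc (0 : ℝ) 1, deriv (deriv S) t = 0 := fun t ht => by
    rw [(z1 t ht).deriv_eq]; simp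
  obtain ⟨c1, hc1⟩ := (isCompact_Icc (a := (0:ℝ)) (b := 1)).exists_bound_of_continuousOn
    hS1.continuous.continuousOn
  obtain ⟨c2, hc2⟩ := (isCompact_Icc (a := (0:ℝ)) (b := 1)).exists_bound_of_continuousOn
    hS2.continuous.continuousOn
  refine ⟨max 1 (max c1 c2), le_max_left _ _, fun ε hε x z => ?_⟩
  have hmem : (z - x) / ε ∈ Icc (0 : ℝ) 1 ↔ z ∈ Icc x (x + ε) := by
    simp only [mem_Icc, div_le_one hε, le_div_iff₀ hε]
    constructor <;> rintro ⟨h1, h2⟩ <;> constructor <;> linarith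
  have e1 : deriv (ramp ε x) = fun z => ε⁻¹ * deriv S ((z - x) / ε) :=
    funext fun z => deriv_comp_ramp (hS.differentiable (by simp)) ε x z
  have e2 : deriv (deriv (ramp ε x)) z = ε⁻¹ * (ε⁻¹ * deriv (deriv S) ((z - x) / ε)) := by
    rw [e1, deriv_const_mul_field, deriv_comp_ramp (hS1.differentiable (by simp))]
  rw [e2, e1]
  beta_reduce
  by_cases hz : z ∈ Icc x (x + ε)
  · rw [indicator_of_mem hz, indicator_of_mem hz]
    have h1 := hc1 _ (hmem.2 hz)
    have h2 := hc2 _ (hmem.2 hz)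
    rw [Real.norm_eq_abs] at h1 h2
    simp only [abs_mul, abs_inv, abs_of_pos hε]
    constructor
    · rw [inv_mul_eq_div]
      exact div_le_div_of_nonneg_right (h1.trans (by simp)) hε.le
    · rw [← mul_assoc, ← mul_inv, ← sq, inv_mul_eq_div]
      exact div_le_div_of_nonneg_right (h2.trans (by simp)) (by positivity)
  · rw [indicator_of_notMem hz, indicator_of_notMem hz, z2 _ (mt hmem.1 hz),
      (z1 _ (mt hmem.1 hz)).self_of_nhds]
    simp

theorem integral_deriv_ramp {ε x : ℝ} (hε : 0 < ε) (h1 : -1 / 2 ≤ x) (h2 : x + ε ≤ 1 / 2) :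
    ∫ z, deriv (ramp ε x) z ∂periodMeasure = 1 := by
  rw [periodMeasure, ← restrict_Ioc_eq_restrict_Icc,
    ← intervalIntegral.integral_of_le (by norm_num),
    intervalIntegral.integral_deriv_eq_sub
      (fun z _ => (contDiff_ramp ε x).differentiable (by simp) z)
      (((contDiff_ramp ε x).continuous_deriv (by simp)).intervalIntegrable _ _),
    ramp_of_ge hε h2, ramp_of_le hε h1, sub_zero]

/-- The difference of two ramps is a smooth bump. -/
noncomputable def rampDiff (ε x x' z : ℝ) : ℝ := ramp ε x z - ramp ε x' z

theorem contDiff_rampDiff (ε x x' : ℝ) : ContDiff ℝ ∞ (rampDiff ε x x') :=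
  (contDiff_ramp ε x).sub (contDiff_ramp ε x')

theorem abs_rampDiff_le (ε x x' z : ℝ) : |rampDiff ε x x' z| ≤ 1 := by
  rw [rampDiff, ramp, ramp, abs_le]
  constructor <;> linarith [Real.smoothTransition.nonneg ((z - x) / ε),
    Real.smoothTransition.nonneg ((z - x') / ε), Real.smoothTransition.le_one ((z - x) / ε),
    Real.smoothTransition.le_one ((z - x') / ε)]

theorem rampDiff_eq_zero {ε x x' z : ℝ} (hε : 0 < ε) (hε' : ε ≤ 1 / 8)
    (hx : x ∈ Icc (-1 / 4 : ℝ) (1 / 4)) (hx' : x' ∈ Icc (-1 / 4 : ℝ) (1 / 4))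
    (hz : z ∉ Icc (-1 / 2 : ℝ) (1 / 2)) : rampDiff ε x x' z = 0 := by
  obtain ⟨h1, h2⟩ := hx
  obtain ⟨h3, h4⟩ := hx'
  rcases lt_or_ge z (-1 / 2) with h | h
  · rw [rampDiff, ramp_of_le hε (by linarith), ramp_of_le hε (by linarith), sub_zero]
  · have : 1 / 2 < z := by by_contra! h'; exact hz ⟨h, h'⟩
    rw [rampDiff, ramp_of_ge hε (by linarith), ramp_of_ge hε (by linarith), sub_self]

theorem deriv_rampDiff (ε x x' : ℝ) :
    deriv (rampDiff ε x x') = fun z => deriv (ramp ε x) z - deriv (ramp ε x') z :=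
  funext fun z => deriv_sub ((contDiff_ramp ε x).differentiable (by simp) z)
    ((contDiff_ramp ε x').differentiable (by simp) z)

theorem deriv_deriv_rampDiff (ε x x' : ℝ) :
    deriv (deriv (rampDiff ε x x'))
      = fun z => deriv (deriv (ramp ε x)) z - deriv (deriv (ramp ε x')) z := by
  rw [deriv_rampDiff]
  have h : ∀ x, Differentiable ℝ (deriv (ramp ε x)) := fun x =>
    (contDiff_infty_iff_deriv.1 (contDiff_ramp ε x)).2.differentiable (by simp)
  exact funext fun z => deriv_sub (h x z) (h x' z)

theorem fderiv_mul_prod {α β : ℝ → ℝ} (hα : Differentiable ℝ α) (hβ : Differentiable ℝ β)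
    (p v : ℝ × ℝ) : fderiv ℝ (fun p : ℝ × ℝ => α p.1 * β p.2) p v
      = deriv α p.1 * v.1 * β p.2 + α p.1 * (deriv β p.2 * v.2) := by
  have h1 : HasFDerivAt (fun p : ℝ × ℝ => α p.1) _ p :=
    (hα p.1).hasDerivAt.hasFDerivAt.comp p hasFDerivAt_fst
  have h2 : HasFDerivAt (fun p : ℝ × ℝ => β p.2) _ p :=
    (hβ p.2).hasDerivAt.hasFDerivAt.comp p hasFDerivAt_snd
  have h3 : fderiv ℝ (fun p : ℝ × ℝ => α p.1 * β p.2) p = _ := (h1.mul h2).fderiv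
  rw [h3]
  simp
  ring

theorem pdOne_mul_prod {α β : ℝ → ℝ} (hα : Differentiable ℝ α) (hβ : Differentiable ℝ β) :
    pdOne (fun p : ℝ × ℝ => α p.1 * β p.2) = fun p => deriv α p.1 * β p.2 := by
  ext p; rw [pdOne, fderiv_mul_prod hα hβ]; simp

theorem pdTwo_mul_prod {α β : ℝ → ℝ} (hα : Differentiable ℝ α) (hβ : Differentiable ℝ β) :
    pdTwo (fun p : ℝ × ℝ => α p.1 * β p.2) = fun p => α p.1 * deriv β p.2 := by
  ext p; rw [pdTwo, fderiv_mul_prod hα hβ]; simp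

/-- The Cauchy–Schwarz inequality against the constant one. -/
theorem sq_lintegral_le {α : Type*} [MeasurableSpace α] (μ : Measure α) {f : α → ℝ≥0∞}
    (hf : AEMeasurable f μ) : (∫⁻ a, f a ∂μ) ^ 2 ≤ μ univ * ∫⁻ a, f a ^ 2 ∂μ := by
  have h := ENNReal.lintegral_mul_le_Lp_mul_Lq μ Real.HolderConjugate.two_two hf
    (aemeasurable_const (b := (1 : ℝ≥0∞)))
  simp only [Pi.mul_apply, mul_one, ENNReal.rpow_two, one_pow, lintegral_const,
    one_mul] at h
  calc (∫⁻ a, f a ∂μ) ^ 2 ≤ ((∫⁻ a, f a ^ 2 ∂μ) ^ (1 / 2 : ℝ) * μ univ ^ (1 / 2 : ℝ)) ^ 2 := by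
        gcongr
    _ = μ univ * ∫⁻ a, f a ^ 2 ∂μ := by
        rw [mul_pow, ← ENNReal.rpow_natCast, ← ENNReal.rpow_natCast, ← ENNReal.rpow_mul,
          ← ENNReal.rpow_mul]
        norm_num
        rw [mul_comm]

/-- The mass of `ρ` on the part of the square where the coordinate `π` lies in
`[x, x + ε]`. -/
noncomputable def stripMass (ρ : ℝ × ℝ → ℝ≥0∞) (π : ℝ × ℝ → ℝ) (ε x : ℝ) : ℝ≥0∞ :=
  ∫⁻ p in square, (Icc x (x + ε)).indicator (fun _ => ρ p) (π p)

theorem measurable_strip_indicator {ρ : ℝ × ℝ → ℝ≥0∞} (hρ : Measurable ρ) {π : ℝ × ℝ → ℝ}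
    (hπ : Measurable π) (ε : ℝ) :
    Measurable fun q : ℝ × (ℝ × ℝ) => (Icc q.1 (q.1 + ε)).indicator (fun _ => ρ q.2) (π q.2) := by
  have hset : MeasurableSet {q : ℝ × (ℝ × ℝ) | π q.2 ∈ Icc q.1 (q.1 + ε)} := by
    have h1 : MeasurableSet {q : ℝ × (ℝ × ℝ) | q.1 ≤ π q.2} :=
      measurableSet_le measurable_fst (hπ.comp measurable_snd)
    have h2 : MeasurableSet {q : ℝ × (ℝ × ℝ) | π q.2 ≤ q.1 + ε} :=
      measurableSet_le (hπ.comp measurable_snd) (measurable_fst.add_const ε)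
    exact h1.inter h2
  exact (hρ.comp measurable_snd).indicator hset

theorem measurable_stripMass {ρ : ℝ × ℝ → ℝ≥0∞} (hρ : Measurable ρ) {π : ℝ × ℝ → ℝ}
    (hπ : Measurable π) (ε : ℝ) : Measurable (stripMass ρ π ε) :=
  (measurable_strip_indicator hρ hπ ε).lintegral_prod_right'

/-- The masses on strips of width `ε` are square integrable, with a gain of `ε²`. -/
theorem lintegral_stripMass_sq_le {ρ : ℝ × ℝ → ℝ≥0∞} (hρ : Measurable ρ) {π : ℝ × ℝ → ℝ}
    (hπ : Measurable π) {ε : ℝ} (hε : 0 < ε)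
    (hvol : ∀ x, volume.restrict square (π ⁻¹' Icc x (x + ε)) ≤ ENNReal.ofReal ε) :
    ∫⁻ x, stripMass ρ π ε x ^ 2 ≤ ENNReal.ofReal (ε ^ 2) * ∫⁻ p in square, ρ p ^ 2 := by
  have hm : ∀ x, MeasurableSet (π ⁻¹' Icc x (x + ε)) := fun x => hπ measurableSet_Icc
  have h1 : ∀ x, stripMass ρ π ε x ^ 2 ≤ ENNReal.ofReal ε *
      ∫⁻ p in square, (Icc x (x + ε)).indicator (fun _ => ρ p ^ 2) (π p) := by
    intro x
    have e1 : ∀ f : ℝ × ℝ → ℝ≥0∞, ∫⁻ p in square, (Icc x (x + ε)).indicator (fun _ => f p) (π p)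
        = ∫⁻ p in π ⁻¹' Icc x (x + ε), f p ∂(volume.restrict square) := by
      intro f
      rw [← lintegral_indicator (hm x)]
      rfl
    rw [stripMass, e1, e1 (fun p => ρ p ^ 2)]
    refine (sq_lintegral_le _ hρ.aemeasurable).trans ?_
    rw [Measure.restrict_apply_univ]
    gcongr
    exact hvol x
  calc ∫⁻ x, stripMass ρ π ε x ^ 2
      ≤ ∫⁻ x, ENNReal.ofReal ε *
          ∫⁻ p in square, (Icc x (x + ε)).indicator (fun _ => ρ p ^ 2) (π p) := lintegral_mono h1
    _ = ENNReal.ofReal ε * ∫⁻ p in square,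
          ∫⁻ x, (Icc x (x + ε)).indicator (fun _ => ρ p ^ 2) (π p) := by
        rw [lintegral_const_mul _ (measurable_strip_indicator (hρ.pow_const 2)
          hπ ε).lintegral_prod_right', lintegral_lintegral_swap
          (measurable_strip_indicator (hρ.pow_const 2) hπ ε).aemeasurable]
    _ = ENNReal.ofReal ε * ∫⁻ p in square, ρ p ^ 2 * ENNReal.ofReal ε := by
        congr 2; ext p
        have : ∀ x, (Icc x (x + ε)).indicator (fun _ => ρ p ^ 2) (π p)
            = (Icc (π p - ε) (π p)).indicator (fun _ => ρ p ^ 2) x := by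
          intro x
          have h2 : π p ∈ Icc x (x + ε) ↔ x ∈ Icc (π p - ε) (π p) := by
            simp only [mem_Icc, tsub_le_iff_right]; tauto
          by_cases hx : x ∈ Icc (π p - ε) (π p)
          · rw [indicator_of_mem hx, indicator_of_mem (h2.2 hx)]
          · rw [indicator_of_notMem hx, indicator_of_notMem (mt h2.1 hx)]
        simp only [this]
        rw [lintegral_indicator_const measurableSet_Icc, Real.volume_Icc]
        simp
    _ = _ := by
        rw [lintegral_mul_const _ (hρ.pow_const 2), sq ε, ENNReal.ofReal_mul hε.le]
        ring

theorem volume_strip_fst_le {ε : ℝ} (x : ℝ) :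
    volume.restrict square (Prod.fst ⁻¹' Icc x (x + ε)) ≤ ENNReal.ofReal ε := by
  rw [volume_restrict_square, ← prod_univ, Measure.prod_prod, measure_univ, mul_one]
  refine (Measure.restrict_apply_le _ _).trans ?_
  rw [Real.volume_Icc]; simp

theorem volume_strip_snd_le {ε : ℝ} (x : ℝ) :
    volume.restrict square (Prod.snd ⁻¹' Icc x (x + ε)) ≤ ENNReal.ofReal ε := by
  rw [volume_restrict_square, ← univ_prod, Measure.prod_prod, measure_univ, one_mul]
  refine (Measure.restrict_apply_le _ _).trans ?_
  rw [Real.volume_Icc]; simp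

/-- A function dominated by two strips is integrated with the help of the strip masses. -/
theorem enorm_integral_mul_le_stripMass {r a : ℝ × ℝ → ℝ} {ρ : ℝ × ℝ → ℝ≥0∞} (hρ : Measurable ρ)
    {π : ℝ × ℝ → ℝ} (hπ : Measurable π) {ε x x' c : ℝ} (hc : 0 ≤ c) (hr : ∀ p, ‖r p‖ₑ ≤ ρ p)
    (ha : ∀ p, |a p| ≤ (Icc x (x + ε)).indicator (fun _ => c) (π p)
      + (Icc x' (x' + ε)).indicator (fun _ => c) (π p)) :
    ‖∫ p in square, r p * a p‖ₑ
      ≤ ENNReal.ofReal c * (stripMass ρ π ε x + stripMass ρ π ε x') := by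
  have hm : ∀ x, Measurable fun p => (Icc x (x + ε)).indicator (fun _ => ρ p) (π p) := fun x =>
    (measurable_strip_indicator hρ hπ ε).comp measurable_prodMk_left
  calc ‖∫ p in square, r p * a p‖ₑ ≤ ∫⁻ p in square, ‖r p * a p‖ₑ :=
        enorm_integral_le_lintegral_enorm _
    _ ≤ ∫⁻ p in square, ENNReal.ofReal c * ((Icc x (x + ε)).indicator (fun _ => ρ p) (π p)
          + (Icc x' (x' + ε)).indicator (fun _ => ρ p) (π p)) := by
        refine lintegral_mono fun p => ?_
        rw [enorm_mul, mul_comm]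
        have h1 : ‖a p‖ₑ ≤ (Icc x (x + ε)).indicator (fun _ => ENNReal.ofReal c) (π p)
            + (Icc x' (x' + ε)).indicator (fun _ => ENNReal.ofReal c) (π p) := by
          have hi : ∀ x, ENNReal.ofReal ((Icc x (x + ε)).indicator (fun _ => c) (π p))
              = (Icc x (x + ε)).indicator (fun _ => ENNReal.ofReal c) (π p) := fun x => by
            by_cases h : π p ∈ Icc x (x + ε)
            · rw [indicator_of_mem h, indicator_of_mem h]
            · rw [indicator_of_notMem h, indicator_of_notMem h, ENNReal.ofReal_zero]
          rw [Real.enorm_eq_ofReal_abs, ← hi, ← hi, ← ENNReal.ofReal_add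
            (indicator_nonneg (fun _ _ => hc) _) (indicator_nonneg (fun _ _ => hc) _)]
          exact ENNReal.ofReal_le_ofReal (ha p)
        refine (mul_le_mul' h1 (hr p)).trans (le_of_eq ?_)
        rw [add_mul, mul_add]
        congr 1
        · by_cases h : π p ∈ Icc x (x + ε)
          · rw [indicator_of_mem h, indicator_of_mem h]
          · rw [indicator_of_notMem h, indicator_of_notMem h, zero_mul, mul_zero]
        · by_cases h : π p ∈ Icc x' (x' + ε)
          · rw [indicator_of_mem h, indicator_of_mem h]
          · rw [indicator_of_notMem h, indicator_of_notMem h, zero_mul, mul_zero]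
    _ = _ := by
        rw [lintegral_const_mul _ (by exact (hm x).add (hm x')), lintegral_add_left (hm x)]
        rfl

/-! ### Mixed differences from compatibility -/

theorem ennreal_add_sq_le (a b : ℝ≥0∞) : (a + b) ^ 2 ≤ 2 * (a ^ 2 + b ^ 2) := by
  have h := ENNReal.rpow_add_le_mul_rpow_add_rpow a b (one_le_two (α := ℝ))
  norm_num at h
  exact h

section MixedDifference
variable {c ε : ℝ}

/-- If `r₁, r₂, r₀` are the differences between the entries `e_aa, e_bb, e_ab` of a strain and the
preferred values, the last of which is `w`, then compatibility controls
the mixed differences of `w`, averaged at scale `ε`. -/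
theorem enorm_mixed_le {w r0 r1 r2 : ℝ × ℝ → ℝ} {ρ : ℝ × ℝ → ℝ≥0∞} (hρ : Measurable ρ)
    (h0 : ∀ p, ‖r0 p‖ₑ ≤ ρ p) (h1 : ∀ p, ‖r1 p‖ₑ ≤ ρ p) (h2 : ∀ p, ‖r2 p‖ₑ ≤ ρ p)
    (hid : ∀ ψ : ℝ × ℝ → ℝ, ContDiff ℝ ∞ ψ → (∀ p ∉ square, ψ p = 0) →
      (∫ p in square, r1 p * pdTwo (pdTwo ψ) p) + (∫ p in square, r2 p * pdOne (pdOne ψ) p)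
        = 2 * (∫ p in square, r0 p * pdOne (pdTwo ψ) p)
          + 2 * ∫ p in square, w p * pdOne (pdTwo ψ) p)
    (hc : 1 ≤ c) (hramp : ∀ x z : ℝ,
      |deriv (ramp ε x) z| ≤ (Icc x (x + ε)).indicator (fun _ => c / ε) z ∧
      |deriv (deriv (ramp ε x)) z| ≤ (Icc x (x + ε)).indicator (fun _ => c / ε ^ 2) z)
    (hε : 0 < ε) (hε' : ε ≤ 1 / 8) {p q : ℝ × ℝ} (hp : p ∈ innerSquare) (hq : q ∈ innerSquare) :
    ‖∫ z in square, w z * (deriv (rampDiff ε p.1 q.1) z.1 * deriv (rampDiff ε p.2 q.2) z.2)‖ₑ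
      ≤ ENNReal.ofReal (3 * c ^ 2 / ε ^ 2) *
        ((stripMass ρ Prod.fst ε p.1 + stripMass ρ Prod.fst ε q.1)
          + (stripMass ρ Prod.snd ε p.2 + stripMass ρ Prod.snd ε q.2)) := by
  set α := rampDiff ε p.1 q.1
  set β := rampDiff ε p.2 q.2
  have cα : ContDiff ℝ ∞ α := contDiff_rampDiff _ _ _
  have cβ : ContDiff ℝ ∞ β := contDiff_rampDiff _ _ _
  have dα := cα.differentiable (by simp)
  have dβ := cβ.differentiable (by simp)
  have dα' := (contDiff_infty_iff_deriv.1 cα).2.differentiable (by simp)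
  have dβ' := (contDiff_infty_iff_deriv.1 cβ).2.differentiable (by simp)
  have hI := hid (fun z => α z.1 * β z.2) ((cα.comp contDiff_fst).mul (cβ.comp contDiff_snd)) ?_
  · rw [pdTwo_mul_prod dα dβ, pdOne_mul_prod dα dβ, pdTwo_mul_prod dα dβ', pdOne_mul_prod dα' dβ,
      pdOne_mul_prod dα dβ'] at hI
    have hc2 : c ≤ c ^ 2 := by nlinarith
    have t1 := enorm_integral_mul_le_stripMass (r := r1) (a := fun z => α z.1 * deriv (deriv β) z.2)
      hρ measurable_snd (ε := ε) (x := p.2) (x' := q.2) (c := c / ε ^ 2) (by positivity) h1 (by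
        intro z
        rw [abs_mul, deriv_deriv_rampDiff]
        refine (mul_le_of_le_one_left (abs_nonneg _) (abs_rampDiff_le _ _ _ _)).trans ?_
        exact (abs_sub _ _).trans (add_le_add (hramp _ _).2 (hramp _ _).2))
    have t2 := enorm_integral_mul_le_stripMass (r := r2) (a := fun z => deriv (deriv α) z.1 * β z.2)
      hρ measurable_fst (ε := ε) (x := p.1) (x' := q.1) (c := c / ε ^ 2) (by positivity) h2 (by
        intro z
        rw [abs_mul, deriv_deriv_rampDiff]
        refine (mul_le_of_le_one_right (abs_nonneg _) (abs_rampDiff_le _ _ _ _)).trans ?_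
        exact (abs_sub _ _).trans (add_le_add (hramp _ _).2 (hramp _ _).2))
    have hle : ∀ x z, |deriv (ramp ε x) z| ≤ c / ε := fun x z =>
      (hramp x z).1.trans (indicator_le_self' (fun _ _ => by positivity) z)
    have t0 := enorm_integral_mul_le_stripMass (r := r0) (a := fun z => deriv α z.1 * deriv β z.2)
      hρ measurable_snd (ε := ε) (x := p.2) (x' := q.2) (c := 2 * c ^ 2 / ε ^ 2) (by positivity) h0
      (by
        intro z
        rw [abs_mul, deriv_rampDiff, deriv_rampDiff]
        have e1 : |deriv (ramp ε p.1) z.1 - deriv (ramp ε q.1) z.1| ≤ 2 * (c / ε) :=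
          (abs_sub _ _).trans (by linarith [hle p.1 z.1, hle q.1 z.1])
        have e2 := (abs_sub (deriv (ramp ε p.2) z.2) (deriv (ramp ε q.2) z.2)).trans
          (add_le_add (hramp p.2 z.2).1 (hramp q.2 z.2).1)
        refine (mul_le_mul e1 e2 (abs_nonneg _) (by positivity)).trans (le_of_eq ?_)
        rw [mul_add]
        have e3 : ∀ x, 2 * (c / ε) * (Icc x (x + ε)).indicator (fun _ => c / ε) z.2
            = (Icc x (x + ε)).indicator (fun _ => 2 * c ^ 2 / ε ^ 2) z.2 := fun x => by
          by_cases h : z.2 ∈ Icc x (x + ε)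
          · rw [indicator_of_mem h, indicator_of_mem h]; field_simp
          · rw [indicator_of_notMem h, indicator_of_notMem h, mul_zero]
        rw [e3, e3])
    set T1 := ∫ z in square, r1 z * (α z.1 * deriv (deriv β) z.2)
    set T2 := ∫ z in square, r2 z * (deriv (deriv α) z.1 * β z.2)
    set T0 := ∫ z in square, r0 z * (deriv α z.1 * deriv β z.2)
    set T := ∫ z in square, w z * (deriv α z.1 * deriv β z.2)
    set s1 := stripMass ρ Prod.fst ε p.1 + stripMass ρ Prod.fst ε q.1
    set s2 := stripMass ρ Prod.snd ε p.2 + stripMass ρ Prod.snd ε q.2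
    have hT : ‖T‖ₑ ≤ ‖T1‖ₑ + ‖T2‖ₑ + ‖T0‖ₑ := by
      simp only [Real.enorm_eq_ofReal_abs]
      rw [← ENNReal.ofReal_add (abs_nonneg _) (abs_nonneg _),
        ← ENNReal.ofReal_add (by positivity) (abs_nonneg _)]
      apply ENNReal.ofReal_le_ofReal
      have : T = T1 / 2 + T2 / 2 - T0 := by linarith
      rw [this]
      have := abs_nonneg T1
      have := abs_nonneg T2
      refine (abs_sub _ _).trans (add_le_add ((abs_add_le _ _).trans ?_) le_rfl)
      rw [abs_div, abs_div, abs_two]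
      linarith
    have k1 : c / ε ^ 2 ≤ 3 * c ^ 2 / ε ^ 2 :=
      div_le_div_of_nonneg_right (by nlinarith) (by positivity)
    calc ‖T‖ₑ ≤ ‖T1‖ₑ + ‖T2‖ₑ + ‖T0‖ₑ := hT
      _ ≤ ENNReal.ofReal (c / ε ^ 2) * s2 + ENNReal.ofReal (c / ε ^ 2) * s1
          + ENNReal.ofReal (2 * c ^ 2 / ε ^ 2) * s2 := add_le_add (add_le_add t1 t2) t0
      _ = ENNReal.ofReal (c / ε ^ 2) * s1
          + ENNReal.ofReal (c / ε ^ 2 + 2 * c ^ 2 / ε ^ 2) * s2 := by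
        rw [ENNReal.ofReal_add (by positivity) (by positivity)]; ring
      _ ≤ ENNReal.ofReal (3 * c ^ 2 / ε ^ 2) * s1 + ENNReal.ofReal (3 * c ^ 2 / ε ^ 2) * s2 := by
        gcongr
        rw [← add_div]
        exact div_le_div_of_nonneg_right (by nlinarith) (by positivity)
      _ = _ := (mul_add _ _ _).symm
  · rintro ⟨z1, z2⟩ hz
    by_cases h : z1 ∈ Icc (-1 / 2 : ℝ) (1 / 2)
    · have h' : z2 ∉ Icc (-1 / 2 : ℝ) (1 / 2) := fun h' => hz ⟨h, h'⟩
      simp only [β, rampDiff_eq_zero hε hε' hp.2 hq.2 h', mul_zero]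
    · simp only [α, rampDiff_eq_zero hε hε' hp.1 hq.1 h, zero_mul]

/-- The oscillation of `w` on the square of side `ε` at `p`. -/
noncomputable def cellOsc (w : ℝ × ℝ → ℝ) (ε : ℝ) (p : ℝ × ℝ) : ℝ≥0∞ :=
  ∫⁻ τ in Icc 0 ε ×ˢ Icc 0 ε, ‖w p - w (p + τ)‖ₑ

theorem measurable_cellOsc {w : ℝ × ℝ → ℝ} (hw : Measurable w) (ε : ℝ) :
    Measurable (cellOsc w ε) := by
  have : Measurable fun q : (ℝ × ℝ) × (ℝ × ℝ) => ‖w q.1 - w (q.1 + q.2)‖ₑ := by fun_prop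
  exact this.lintegral_prod_right'

theorem lintegral_cellOsc_le {w : ℝ × ℝ → ℝ} (hw : Measurable w) {ε V : ℝ} (hε : 0 ≤ ε)
    (hV : ∀ τ ∈ Icc (0 : ℝ) ε ×ˢ Icc (0 : ℝ) ε,
      ∫⁻ p in innerSquare, ‖w p - w (p + τ)‖ₑ ≤ ENNReal.ofReal V) :
    ∫⁻ p in innerSquare, cellOsc w ε p ≤ ENNReal.ofReal (ε ^ 2) * ENNReal.ofReal V := by
  have hm : Measurable fun q : (ℝ × ℝ) × (ℝ × ℝ) => ‖w q.1 - w (q.1 + q.2)‖ₑ := by fun_prop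
  simp only [cellOsc]
  rw [lintegral_lintegral_swap (by exact hm.aemeasurable)]
  refine (setLIntegral_mono' (measurableSet_Icc.prod measurableSet_Icc) hV).trans ?_
  rw [setLIntegral_const, mul_comm, Measure.volume_eq_prod, Measure.prod_prod, Real.volume_Icc,
    sub_zero, ← ENNReal.ofReal_mul hε, sq]

/-- The average of `w` at scale `ε` against the derivatives of two ramps. -/
noncomputable def rampAverage (w : ℝ × ℝ → ℝ) (ε x y : ℝ) : ℝ :=
  ∫ z in square, w z * (deriv (ramp ε x) z.1 * deriv (ramp ε y) z.2)

theorem integrable_mul_deriv_ramp {w : ℝ × ℝ → ℝ} (hw : Measurable w) {C : ℝ}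
    (hb : ∀ p, |w p| ≤ C) (ε x y : ℝ) :
    Integrable (fun z : ℝ × ℝ => w z * (deriv (ramp ε x) z.1 * deriv (ramp ε y) z.2))
      (volume.restrict square) := by
  have hc : ∀ x, Continuous (deriv (ramp ε x)) := fun x =>
    (contDiff_ramp ε x).continuous_deriv (by simp)
  have hcc : Continuous fun z : ℝ × ℝ => deriv (ramp ε x) z.1 * deriv (ramp ε y) z.2 :=
    ((hc x).comp continuous_fst).mul ((hc y).comp continuous_snd)
  refine Integrable.bdd_mul (c := C) ?_ hw.aestronglyMeasurable (Eventually.of_forall hb)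
  exact hcc.continuousOn.integrableOn_compact isCompact_square

theorem integral_mixed_eq {w : ℝ × ℝ → ℝ} (hw : Measurable w) {C : ℝ}
    (hb : ∀ p, |w p| ≤ C) (ε : ℝ) (p q : ℝ × ℝ) :
    ∫ z in square, w z * (deriv (rampDiff ε p.1 q.1) z.1 * deriv (rampDiff ε p.2 q.2) z.2)
      = rampAverage w ε p.1 p.2 - rampAverage w ε q.1 p.2 - rampAverage w ε p.1 q.2
        + rampAverage w ε q.1 q.2 := by
  have hi := integrable_mul_deriv_ramp hw hb ε
  simp only [rampAverage]
  have hi3 := ((hi p.1 p.2).sub (hi q.1 p.2)).sub (hi p.1 q.2)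
  rw [← integral_sub (hi p.1 p.2) (hi q.1 p.2),
    ← integral_sub (by exact (hi p.1 p.2).sub (hi q.1 p.2)) (hi p.1 q.2),
    ← integral_add (by exact hi3) (hi q.1 q.2)]
  congr 1; ext z
  rw [deriv_rampDiff, deriv_rampDiff]
  ring

theorem enorm_sub_rampAverage_le {w : ℝ × ℝ → ℝ} (hw : Measurable w) {C : ℝ}
    (hb : ∀ p, |w p| ≤ C) (hc : 0 ≤ c) (hramp : ∀ x z : ℝ,
      |deriv (ramp ε x) z| ≤ (Icc x (x + ε)).indicator (fun _ => c / ε) z)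
    (hε : 0 < ε) (hε' : ε ≤ 1 / 8) {p : ℝ × ℝ} (hp : p ∈ innerSquare) :
    ‖w p - rampAverage w ε p.1 p.2‖ₑ ≤ ENNReal.ofReal (c ^ 2 / ε ^ 2) * cellOsc w ε p := by
  obtain ⟨⟨h1, h2⟩, h3, h4⟩ := hp
  have hone : ∫ z in square, deriv (ramp ε p.1) z.1 * deriv (ramp ε p.2) z.2 = 1 := by
    rw [volume_restrict_square, integral_prod_mul (fun z => deriv (ramp ε p.1) z)
      (fun z => deriv (ramp ε p.2) z), integral_deriv_ramp hε (by linarith) (by linarith),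
      integral_deriv_ramp hε (by linarith) (by linarith), one_mul]
  have hi := integrable_mul_deriv_ramp hw hb ε p.1 p.2
  have hi1 := integrable_mul_deriv_ramp (w := fun _ => w p) measurable_const (C := C)
    (fun _ => hb p) ε p.1 p.2
  have e1 : w p - rampAverage w ε p.1 p.2
      = ∫ z in square, (w p - w z) * (deriv (ramp ε p.1) z.1 * deriv (ramp ε p.2) z.2) := by
    simp only [sub_mul]
    rw [integral_sub hi1 hi, integral_const_mul, hone, mul_one]
    rfl
  set R : Set (ℝ × ℝ) := Icc p.1 (p.1 + ε) ×ˢ Icc p.2 (p.2 + ε) with hR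
  have hRm : MeasurableSet R := measurableSet_Icc.prod measurableSet_Icc
  rw [e1]
  calc _ ≤ ∫⁻ z in square, ‖(w p - w z) * (deriv (ramp ε p.1) z.1 * deriv (ramp ε p.2) z.2)‖ₑ :=
        enorm_integral_le_lintegral_enorm _
    _ ≤ ∫⁻ z in square, ENNReal.ofReal (c ^ 2 / ε ^ 2) * R.indicator (fun z => ‖w p - w z‖ₑ) z := by
        refine lintegral_mono fun z => ?_
        rw [enorm_mul, mul_comm]
        have hk : |deriv (ramp ε p.1) z.1 * deriv (ramp ε p.2) z.2|
            ≤ (Icc p.1 (p.1 + ε)).indicator (fun _ => c / ε) z.1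
              * (Icc p.2 (p.2 + ε)).indicator (fun _ => c / ε) z.2 := by
          rw [abs_mul]
          exact mul_le_mul (hramp _ _) (hramp _ _) (abs_nonneg _)
            (indicator_nonneg (fun _ _ => by positivity) _)
        by_cases hz : z ∈ R
        · rw [indicator_of_mem hz]
          gcongr
          rw [indicator_of_mem hz.1, indicator_of_mem hz.2] at hk
          rw [Real.enorm_eq_ofReal_abs]
          refine ENNReal.ofReal_le_ofReal (hk.trans (le_of_eq ?_))
          field_simp
        · have : deriv (ramp ε p.1) z.1 * deriv (ramp ε p.2) z.2 = 0 := by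
            refine abs_nonpos_iff.1 (hk.trans (le_of_eq ?_))
            by_cases hz1 : z.1 ∈ Icc p.1 (p.1 + ε)
            · rw [indicator_of_notMem (fun h => hz ⟨hz1, h⟩), mul_zero]
            · rw [indicator_of_notMem hz1, zero_mul]
          rw [this]; simp
    _ = ENNReal.ofReal (c ^ 2 / ε ^ 2) * ∫⁻ z in square, R.indicator (fun z => ‖w p - w z‖ₑ) z :=
        lintegral_const_mul _ ((by fun_prop : Measurable fun z => ‖w p - w z‖ₑ).indicator hRm)
    _ ≤ ENNReal.ofReal (c ^ 2 / ε ^ 2) * ∫⁻ z in R, ‖w p - w z‖ₑ := by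
        refine mul_le_mul' le_rfl ?_
        rw [← lintegral_indicator hRm]
        exact setLIntegral_le_lintegral _ _
    _ = _ := by
        congr 1
        rw [cellOsc, ← (measurePreserving_add_left volume p).setLIntegral_comp_preimage_emb
          (MeasurableEquiv.addLeft p).measurableEmbedding _ R]
        congr 2
        ext τ
        simp only [hR, mem_preimage, mem_prod, mem_Icc, Prod.fst_add,
          Prod.snd_add, le_add_iff_nonneg_right, add_le_add_iff_left]

/-- Functions with values `1` and `-1` for which the compatibility condition has a small
right-hand side and whose variation is controlled are close to functions of one variable. -/
theorem exists_isSign_of_compat : ∃ C : ℝ, 1 ≤ C ∧ ∀ (w r0 r1 r2 : ℝ × ℝ → ℝ)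
    (ρ : ℝ × ℝ → ℝ≥0∞) (ε V A B : ℝ), Measurable w → (∀ p, w p = 1 ∨ w p = -1) →
    Measurable ρ → (∀ p, ‖r0 p‖ₑ ≤ ρ p) → (∀ p, ‖r1 p‖ₑ ≤ ρ p) → (∀ p, ‖r2 p‖ₑ ≤ ρ p) →
    (∀ ψ : ℝ × ℝ → ℝ, ContDiff ℝ ∞ ψ → (∀ p ∉ square, ψ p = 0) →
      (∫ p in square, r1 p * pdTwo (pdTwo ψ) p) + (∫ p in square, r2 p * pdOne (pdOne ψ) p)
        = 2 * (∫ p in square, r0 p * pdOne (pdTwo ψ) p)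
          + 2 * ∫ p in square, w p * pdOne (pdTwo ψ) p) →
    0 < ε → ε ≤ 1 / 8 → 0 ≤ V → 0 ≤ A →
    (∀ τ ∈ Icc (0 : ℝ) ε ×ˢ Icc (0 : ℝ) ε,
      ∫⁻ p in innerSquare, ‖w p - w (p + τ)‖ₑ ≤ ENNReal.ofReal V) →
    ∫⁻ p in square, ρ p ^ 2 ≤ ENNReal.ofReal A → C * (V + A / ε ^ 2) ≤ B →
    ∃ f : ℝ → ℝ, IsSign f ∧
      ((∫⁻ p in innerSquare, ‖w p - f p.1‖ₑ ≤ ENNReal.ofReal (2 * (16 * B + √(16 * B)))) ∨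
       (∫⁻ p in innerSquare, ‖w p - f p.2‖ₑ ≤ ENNReal.ofReal (2 * (16 * B + √(16 * B))))) := by
  obtain ⟨c, hc, hramp⟩ := exists_ramp_bound
  refine ⟨72 * c ^ 4, by nlinarith [one_le_pow₀ hc (n := 4)], ?_⟩
  intro w r0 r1 r2 ρ ε V A B hw hw1 hρ h0 h1 h2 hid hε hε' hV0 hA0 hV hA hB
  have hb : ∀ p, |w p| ≤ 1 := fun p => by rcases hw1 p with h | h <;> simp [h]
  set k : ℝ := 3 * c ^ 2 / ε ^ 2 with hk
  set g : ℝ × ℝ → ℝ≥0∞ := fun p => ENNReal.ofReal (c ^ 2 / ε ^ 2) * cellOsc w ε p with hg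
  set S1 := stripMass ρ Prod.fst ε with hS1
  set S2 := stripMass ρ Prod.snd ε with hS2
  have mS1 : Measurable S1 := measurable_stripMass hρ measurable_fst ε
  have mS2 : Measurable S2 := measurable_stripMass hρ measurable_snd ε
  have mg : Measurable g := (measurable_cellOsc hw ε).const_mul _
  set D : ℝ × ℝ → ℝ≥0∞ := fun p => g p
    + (4 * ENNReal.ofReal (k ^ 2) * S1 p.1 ^ 2 + 4 * ENNReal.ofReal (k ^ 2) * S2 p.2 ^ 2) with hD
  have mS1' : Measurable fun p : ℝ × ℝ => S1 p.1 ^ 2 := (mS1.comp measurable_fst).pow_const 2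
  have mS2' : Measurable fun p : ℝ × ℝ => S2 p.2 ^ 2 := (mS2.comp measurable_snd).pow_const 2
  have mD1 : Measurable fun p : ℝ × ℝ => 4 * ENNReal.ofReal (k ^ 2) * S1 p.1 ^ 2 :=
    mS1'.const_mul _
  have mD2 : Measurable fun p : ℝ × ℝ => 4 * ENNReal.ofReal (k ^ 2) * S2 p.2 ^ 2 :=
    mS2'.const_mul _
  have hB0 : 0 ≤ B := le_trans (by positivity) hB
  refine exists_isSign_of_mixed_difference hw hw1 (D := D) (mg.add (mD1.add mD2)) hB0 ?_ ?_
  · intro p hp q hq hne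
    have hp1 : (q.1, p.2) ∈ innerSquare := ⟨hq.1, hp.2⟩
    have hp2 : (p.1, q.2) ∈ innerSquare := ⟨hp.1, hq.2⟩
    have hav : ∀ z ∈ innerSquare, ‖w z - rampAverage w ε z.1 z.2‖ₑ ≤ g z := fun z hz =>
      enorm_sub_rampAverage_le hw hb (by linarith) (fun x t => (hramp ε hε x t).1) hε hε' hz
    have hmix := enorm_mixed_le hρ h0 h1 h2 hid hc (hramp ε hε) hε hε' hp hq
    rw [integral_mixed_eq hw hb] at hmix
    set M := rampAverage w ε p.1 p.2 - rampAverage w ε q.1 p.2 - rampAverage w ε p.1 q.2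
        + rampAverage w ε q.1 q.2 with hM
    -- a nonzero mixed difference is at least two, so it or its distance to the average is large
    have habs : 2 ≤ |w p - w (q.1, p.2) - w (p.1, q.2) + w q| := by
      rcases hw1 p with e1 | e1 <;> rcases hw1 (q.1, p.2) with e2 | e2 <;>
        rcases hw1 (p.1, q.2) with e3 | e3 <;> rcases hw1 q with e4 | e4 <;>
        rw [e1, e2, e3, e4] at hne ⊢ <;> revert hne <;> norm_num
    by_cases hM1 : 1 ≤ |M|
    · have h5 : (1 : ℝ≥0∞) ≤ ‖M‖ₑ := by
        rw [Real.enorm_eq_ofReal_abs, ← ENNReal.ofReal_one]; exact ENNReal.ofReal_le_ofReal hM1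
      calc (1 : ℝ≥0∞) = 1 ^ 2 := by simp
        _ ≤ (ENNReal.ofReal k * ((S1 p.1 + S1 q.1) + (S2 p.2 + S2 q.2))) ^ 2 := by
            gcongr; exact h5.trans hmix
        _ ≤ ENNReal.ofReal k ^ 2 * (2 * (2 * (S1 p.1 ^ 2 + S1 q.1 ^ 2)
              + 2 * (S2 p.2 ^ 2 + S2 q.2 ^ 2))) := by
            rw [mul_pow]
            gcongr
            exact (ennreal_add_sq_le _ _).trans (by gcongr <;> exact ennreal_add_sq_le _ _)
        _ = 4 * ENNReal.ofReal (k ^ 2) * S1 p.1 ^ 2 + 4 * ENNReal.ofReal (k ^ 2) * S2 p.2 ^ 2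
            + (4 * ENNReal.ofReal (k ^ 2) * S1 q.1 ^ 2
              + 4 * ENNReal.ofReal (k ^ 2) * S2 q.2 ^ 2) := by
            rw [← ENNReal.ofReal_pow (by positivity)]; ring
        _ ≤ D p + D q := by simp only [hD]; exact add_le_add le_add_self le_add_self
        _ ≤ _ := by
            rw [add_assoc (D p), add_assoc (D p)]
            exact add_le_add le_rfl le_add_self
    · push Not at hM1
      have e : w p - w (q.1, p.2) - w (p.1, q.2) + w q = M + ((w p - rampAverage w ε p.1 p.2)
          - (w (q.1, p.2) - rampAverage w ε q.1 p.2) - (w (p.1, q.2) - rampAverage w ε p.1 q.2)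
          + (w q - rampAverage w ε q.1 q.2)) := by rw [hM]; ring
      have h6 : 1 ≤ |w p - rampAverage w ε p.1 p.2| + |w (q.1, p.2) - rampAverage w ε q.1 p.2|
          + |w (p.1, q.2) - rampAverage w ε p.1 q.2| + |w q - rampAverage w ε q.1 q.2| := by
        rw [e] at habs
        have t1 := habs.trans (abs_add_le _ _)
        have t2 := (abs_add_le (w p - rampAverage w ε p.1 p.2
          - (w (q.1, p.2) - rampAverage w ε q.1 p.2) - (w (p.1, q.2) - rampAverage w ε p.1 q.2))
          (w q - rampAverage w ε q.1 q.2))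
        have t3 := abs_sub (w p - rampAverage w ε p.1 p.2
          - (w (q.1, p.2) - rampAverage w ε q.1 p.2)) (w (p.1, q.2) - rampAverage w ε p.1 q.2)
        have t4 := abs_sub (w p - rampAverage w ε p.1 p.2)
          (w (q.1, p.2) - rampAverage w ε q.1 p.2)
        linarith
      have h7 := ENNReal.ofReal_le_ofReal h6
      rw [ENNReal.ofReal_one, ENNReal.ofReal_add (by positivity) (abs_nonneg _),
        ENNReal.ofReal_add (by positivity) (abs_nonneg _),
        ENNReal.ofReal_add (by positivity) (abs_nonneg _)] at h7
      simp only [← Real.enorm_eq_ofReal_abs] at h7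
      refine h7.trans ?_
      gcongr
      · exact (hav p hp).trans le_self_add
      · exact (hav _ hp1).trans le_self_add
      · exact (hav _ hp2).trans le_self_add
      · exact (hav q hq).trans le_self_add
  · have i1 : ∫⁻ p in innerSquare, g p ≤ ENNReal.ofReal (c ^ 2 * V) := by
      rw [hg, lintegral_const_mul _ (measurable_cellOsc hw ε)]
      refine (mul_le_mul' le_rfl (lintegral_cellOsc_le hw hε.le hV)).trans (le_of_eq ?_)
      rw [← ENNReal.ofReal_mul (by positivity), ← ENNReal.ofReal_mul (by positivity)]
      congr 1; field_simp
    have hk4 : 4 * ENNReal.ofReal (k ^ 2) * (ENNReal.ofReal (ε ^ 2) * ENNReal.ofReal A)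
        = ENNReal.ofReal (36 * c ^ 4 / ε ^ 2 * A) := by
      rw [← ENNReal.ofReal_ofNat 4, ← ENNReal.ofReal_mul (by norm_num),
        ← ENNReal.ofReal_mul (by positivity), ← ENNReal.ofReal_mul (by positivity)]
      congr 1; rw [hk]; field_simp; ring
    have i2 : ∫⁻ p in innerSquare, 4 * ENNReal.ofReal (k ^ 2) * S1 p.1 ^ 2
        ≤ ENNReal.ofReal (36 * c ^ 4 / ε ^ 2 * A) := by
      rw [lintegral_const_mul _ mS1', ← hk4]
      refine mul_le_mul' le_rfl (le_trans ?_ ((lintegral_stripMass_sq_le hρ measurable_fst hε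
        volume_strip_fst_le).trans (mul_le_mul' le_rfl hA)))
      rw [volume_restrict_innerSquare, lintegral_prod _ mS1'.aemeasurable]
      exact (lintegral_mono fun x => lintegral_const_innerMeasure_le _).trans
        (setLIntegral_le_lintegral _ _)
    have i3 : ∫⁻ p in innerSquare, 4 * ENNReal.ofReal (k ^ 2) * S2 p.2 ^ 2
        ≤ ENNReal.ofReal (36 * c ^ 4 / ε ^ 2 * A) := by
      rw [lintegral_const_mul _ mS2', ← hk4]
      refine mul_le_mul' le_rfl (le_trans ?_ ((lintegral_stripMass_sq_le hρ measurable_snd hε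
        volume_strip_snd_le).trans (mul_le_mul' le_rfl hA)))
      rw [volume_restrict_innerSquare, lintegral_prod _ mS2'.aemeasurable]
      exact (lintegral_const_innerMeasure_le _).trans (setLIntegral_le_lintegral _ _)
    simp only [hD]
    rw [lintegral_add_left mg, lintegral_add_left mD1]
    refine (add_le_add i1 (add_le_add i2 i3)).trans ?_
    rw [← ENNReal.ofReal_add (by positivity) (by positivity),
      ← ENNReal.ofReal_add (by positivity) (by positivity)]
    refine ENNReal.ofReal_le_ofReal (le_trans ?_ hB)
    have hc4 : c ^ 2 ≤ c ^ 4 := pow_le_pow_right₀ hc (by norm_num)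
    have : c ^ 2 * V ≤ c ^ 4 * V := mul_le_mul_of_nonneg_right hc4 hV0
    have : 0 ≤ c ^ 4 * V := by positivity
    have e : 36 * c ^ 4 / ε ^ 2 * A = 36 * c ^ 4 * (A / ε ^ 2) := by ring
    rw [e]; linarith

end MixedDifference

/-! ### The estimate on the ball -/

theorem integral_fderiv_apply_eq_zero {ψ : ℝ × ℝ → ℝ} (hψ : ContDiff ℝ 1 ψ)
    (hc : HasCompactSupport ψ) (v : ℝ × ℝ) : ∫ p, fderiv ℝ ψ p v = 0 := by
  have h1 : Integrable (fun p => fderiv ℝ ψ p v) :=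
    ((hψ.continuous_fderiv one_ne_zero).clm_apply continuous_const).integrable_of_hasCompactSupport
      ((hc.fderiv (𝕜 := ℝ)).comp_left (g := fun L : ℝ × ℝ →L[ℝ] ℝ => L v) (by simp))
  have h2 : Integrable ψ := hψ.continuous.integrable_of_hasCompactSupport hc
  have h := integral_mul_fderiv_eq_neg_fderiv_mul_of_integrable (𝕜 := ℝ) (μ := volume)
    (f := fun _ : ℝ × ℝ => (1 : ℝ)) (g := ψ) (v := v) (by simp) (by simpa using h1)
    (by simpa using h2) (fun _ _ => by fun_prop)
    (fun x _ => hψ.differentiable one_ne_zero x)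
  simpa using h

theorem pdOne_eq_zero {ψ : ℝ × ℝ → ℝ} (h0 : ∀ p ∉ square, ψ p = 0) : ∀ p ∉ square, pdOne ψ p = 0 :=
  fun p hp => by rw [pdOne, fderiv_eq_zero_of_notMem_square h0 hp]; rfl

theorem pdTwo_eq_zero {ψ : ℝ × ℝ → ℝ} (h0 : ∀ p ∉ square, ψ p = 0) : ∀ p ∉ square, pdTwo ψ p = 0 :=
  fun p hp => by rw [pdTwo, fderiv_eq_zero_of_notMem_square h0 hp]; rfl

theorem contDiff_cutoff_normed : ContDiff ℝ ∞ (cutoff.normed volume) := cutoff.contDiff_normed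

theorem cutoff_normed_eq_zero {z : ℝ} (hz : z ∉ Icc (-1 / 2 : ℝ) (1 / 2)) :
    cutoff.normed volume z = 0 := by
  rw [ContDiffBump.normed_def, cutoff_eq_zero hz, zero_div]

theorem isTest_tensor_cutoff (σ : Equiv.Perm (Fin 3)) {ψ : ℝ × ℝ → ℝ} (hψ : ContDiff ℝ ∞ ψ)
    (h0 : ∀ p ∉ square, ψ p = 0) :
    IsTest (Metric.ball 0 1) (tensor σ ψ (cutoff.normed volume)) where
  contDiff := contDiff_tensor hψ contDiff_cutoff_normed
  compact := hasCompactSupport_tensor σ (hasCompactSupport_of_square h0)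
    cutoff.hasCompactSupport_normed
  subset := tsupport_tensor_subset σ h0 fun _ hz => cutoff_normed_eq_zero hz

/-- The norm of the difference between a strain and the strain of the phases. -/
noncomputable def strainDefect (δ : ℝ) (e : ℝ × ℝ → Matrix (Fin 3) (Fin 3) ℝ)
    (χ : Fin 4 → ℝ × ℝ → ℝ) (p : ℝ × ℝ) : ℝ≥0∞ :=
  ENNReal.ofReal √(normSqMat (e p - phaseStrain δ χ p))

theorem IsPhase.measurable_phaseStrain {χ : Fin 4 → ℝ × ℝ → ℝ} (h : IsPhase χ) (δ : ℝ)
    (i j : Fin 3) : Measurable fun p => phaseStrain δ χ p i j := by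
  have := h.measurable_modChar
  fin_cases i <;> fin_cases j <;> simp [phaseStrain] <;> fun_prop

theorem measurable_normSqMat {δ : ℝ} {e : ℝ × ℝ → Matrix (Fin 3) (Fin 3) ℝ}
    {χ : Fin 4 → ℝ × ℝ → ℝ} (hχ : IsPhase χ) (he : ∀ i j, Measurable fun p => e p i j) :
    Measurable fun p => normSqMat (e p - phaseStrain δ χ p) := by
  have := hχ.measurable_phaseStrain δ
  simp only [normSqMat, Matrix.sub_apply]
  fun_prop

theorem measurable_strainDefect {δ : ℝ} {e : ℝ × ℝ → Matrix (Fin 3) (Fin 3) ℝ}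
    {χ : Fin 4 → ℝ × ℝ → ℝ} (hχ : IsPhase χ) (he : ∀ i j, Measurable fun p => e p i j) :
    Measurable (strainDefect δ e χ) :=
  (measurable_normSqMat hχ he).sqrt.ennreal_ofReal

theorem strainDefect_sq (δ : ℝ) (e : ℝ × ℝ → Matrix (Fin 3) (Fin 3) ℝ)
    (χ : Fin 4 → ℝ × ℝ → ℝ) (p : ℝ × ℝ) :
    strainDefect δ e χ p ^ 2 = ENNReal.ofReal (normSqMat (e p - phaseStrain δ χ p)) := by
  rw [strainDefect, ← ENNReal.ofReal_pow (Real.sqrt_nonneg _), Real.sq_sqrt]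
  exact Finset.sum_nonneg fun i _ => Finset.sum_nonneg fun j _ => sq_nonneg _

theorem enorm_entry_le_strainDefect (δ : ℝ) (e : ℝ × ℝ → Matrix (Fin 3) (Fin 3) ℝ)
    (χ : Fin 4 → ℝ × ℝ → ℝ) (p : ℝ × ℝ) (i j : Fin 3) :
    ‖e p i j - phaseStrain δ χ p i j‖ₑ ≤ strainDefect δ e χ p := by
  rw [Real.enorm_eq_ofReal_abs, strainDefect]
  apply ENNReal.ofReal_le_ofReal
  apply Real.abs_le_sqrt
  exact sq_entry_le_normSqMat (e p - phaseStrain δ χ p) i j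

theorem integrableOn_entry_sub {δ : ℝ} {e : ℝ × ℝ → Matrix (Fin 3) (Fin 3) ℝ}
    {χ : Fin 4 → ℝ × ℝ → ℝ} (hχ : IsPhase χ) (he : ∀ i j, Measurable fun p => e p i j)
    (hfin : ∫⁻ p in square, strainDefect δ e χ p ^ 2 ≠ ⊤) (i j : Fin 3) :
    IntegrableOn (fun p => e p i j - phaseStrain δ χ p i j) square := by
  refine ⟨((he i j).sub (hχ.measurable_phaseStrain δ i j)).aestronglyMeasurable, ?_⟩
  rw [HasFiniteIntegral]
  refine lt_of_le_of_lt (lintegral_mono fun p => enorm_entry_le_strainDefect δ e χ p i j) ?_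
  have h := sq_lintegral_le (volume.restrict square)
    (measurable_strainDefect (δ := δ) hχ he).aemeasurable
  rw [measure_univ, one_mul] at h
  exact (ENNReal.pow_lt_top_iff.1 (h.trans_lt hfin.lt_top)).resolve_right (by norm_num)

/-- The compatibility condition for the defects of the strain: the preferred diagonal entries are
constant and drop out. -/
theorem IsPlanarStrain.defect_compat {σ : Equiv.Perm (Fin 3)} {δ : ℝ}
    {e : ℝ × ℝ → Matrix (Fin 3) (Fin 3) ℝ} {χ : Fin 4 → ℝ × ℝ → ℝ} (hχ : IsPhase χ)
    (he : IsPlanarStrain σ (Metric.ball 0 1) e)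
    (hfin : ∫⁻ p in square, strainDefect δ e χ p ^ 2 ≠ ⊤) {ψ : ℝ × ℝ → ℝ} (hψ : ContDiff ℝ ∞ ψ)
    (h0 : ∀ p ∉ square, ψ p = 0) :
    (∫ p in square, (e p (σ 0) (σ 0) - phaseStrain δ χ p (σ 0) (σ 0)) * pdTwo (pdTwo ψ) p)
      + (∫ p in square, (e p (σ 1) (σ 1) - phaseStrain δ χ p (σ 1) (σ 1)) * pdOne (pdOne ψ) p)
      = 2 * (∫ p in square, (e p (σ 0) (σ 1) - phaseStrain δ χ p (σ 0) (σ 1))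
          * pdOne (pdTwo ψ) p)
        + 2 * ∫ p in square, modChar χ (σ 2) p * pdOne (pdTwo ψ) p := by
  have h := he.planar_compat hψ contDiff_cutoff_normed (isTest_tensor_cutoff σ hψ h0)
    cutoff.integral_normed
  have c1 := contDiff_pdOne hψ
  have c2 := contDiff_pdTwo hψ
  have z1 := pdOne_eq_zero h0
  have z2 := pdTwo_eq_zero h0
  have hset : ∀ (g φ : ℝ × ℝ → ℝ), (∀ p ∉ square, φ p = 0) →
      ∫ p, g p * φ p = ∫ p in square, g p * φ p := fun g φ hφ =>
    (setIntegral_eq_integral_of_forall_compl_eq_zero fun p hp => by rw [hφ p hp, mul_zero]).symm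
  rw [hset _ _ (pdTwo_eq_zero z2), hset _ _ (pdOne_eq_zero z1), hset _ _ (pdOne_eq_zero z2)] at h
  have hint : ∀ (i j : Fin 3) (φ : ℝ × ℝ → ℝ), ContDiff ℝ ∞ φ →
      IntegrableOn (fun p => (e p i j - phaseStrain δ χ p i j) * φ p) square := fun i j φ hφ =>
    (integrableOn_entry_sub hχ he.1 hfin i j).mul_continuousOn hφ.continuous.continuousOn
      isCompact_square
  have hint' : ∀ (g φ : ℝ × ℝ → ℝ) (C : ℝ), Measurable g → (∀ p, |g p| ≤ C) → ContDiff ℝ ∞ φ →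
      IntegrableOn (fun p => g p * φ p) square := fun g φ C hg hC hφ =>
    IntegrableOn.mul_continuousOn (g := g)
      (Integrable.of_bound (C := C) hg.aestronglyMeasurable (Eventually.of_forall hC))
      hφ.continuous.continuousOn isCompact_square
  have hsplit : ∀ (i j : Fin 3) (φ m : ℝ × ℝ → ℝ) (C : ℝ), ContDiff ℝ ∞ φ → Measurable m →
      (∀ p, |m p| ≤ C) → (∀ p, phaseStrain δ χ p i j = m p) → ∫ p in square, e p i j * φ p
        = (∫ p in square, (e p i j - phaseStrain δ χ p i j) * φ p)
          + ∫ p in square, m p * φ p := by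
    intro i j φ m C hφ hm hC hmm
    rw [← integral_add (hint i j φ hφ) (hint' m φ C hm hC hφ)]
    congr 1; ext p
    rw [hmm]; ring
  obtain ⟨d0, hd0⟩ := phaseStrain_diag δ χ (σ 0)
  obtain ⟨d1, hd1⟩ := phaseStrain_diag δ χ (σ 1)
  have cz : ∀ (φ : ℝ × ℝ → ℝ) (v : ℝ × ℝ), ContDiff ℝ ∞ φ → (∀ p ∉ square, φ p = 0) → ∀ d : ℝ,
      ∫ p in square, d * fderiv ℝ φ p v = 0 := by
    intro φ v hφ hφ0 d
    rw [integral_const_mul, setIntegral_eq_integral_of_forall_compl_eq_zero fun p hp => by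
      rw [fderiv_eq_zero_of_notMem_square hφ0 hp]; rfl,
      integral_fderiv_apply_eq_zero (hφ.of_le (by simp)) (hasCompactSupport_of_square hφ0),
      mul_zero]
  have hw1 : ∀ p, |modChar χ (σ 2) p| ≤ 1 := fun p => by
    rcases hχ.modChar_eq (σ 2) p with h | h <;> simp [h]
  rw [hsplit (σ 0) (σ 0) _ (fun _ => d0) |d0| (contDiff_pdTwo c2) measurable_const
      (fun _ => le_rfl) hd0,
    hsplit (σ 1) (σ 1) _ (fun _ => d1) |d1| (contDiff_pdOne c1) measurable_const
      (fun _ => le_rfl) hd1,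
    hsplit (σ 0) (σ 1) _ (modChar χ (σ 2)) 1 (contDiff_pdOne c2) (hχ.measurable_modChar _)
      hw1 (phaseStrain_offDiag δ χ σ)] at h
  have k1 : ∫ p in square, d0 * pdTwo (pdTwo ψ) p = 0 := cz _ _ c2 z2 d0
  have k2 : ∫ p in square, d1 * pdOne (pdOne ψ) p = 0 := cz _ _ c1 z1 d1
  rw [k1, k2] at h
  linarith

theorem lintegral_enorm_le_of_integral_abs {g : ℝ × ℝ → ℝ} {S : Set (ℝ × ℝ)} {C V : ℝ}
    (hS : volume S ≠ ⊤) (hg : Measurable g) (hb : ∀ p, |g p| ≤ C) (h : ∫ p in S, |g p| ≤ V) :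
    ∫⁻ p in S, ‖g p‖ₑ ≤ ENNReal.ofReal V := by
  have : IsFiniteMeasure (volume.restrict S) :=
    ⟨by rw [Measure.restrict_apply_univ]; exact hS.lt_top⟩
  have hi : Integrable g (volume.restrict S) :=
    Integrable.of_bound (C := C) hg.aestronglyMeasurable (Eventually.of_forall hb)
  rw [← ofReal_integral_norm_eq_lintegral_enorm hi]
  exact ENNReal.ofReal_le_ofReal h

theorem IsPhase.abs_modChar_sub_le_two {χ : Fin 4 → ℝ × ℝ → ℝ} (h : IsPhase χ) (k : Fin 3)
    (p q : ℝ × ℝ) : |modChar χ k p - modChar χ k q| ≤ 2 := by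
  rcases h.modChar_eq k p with e1 | e1 <;> rcases h.modChar_eq k q with e2 | e2 <;>
    rw [e1, e2] <;> norm_num

/-- Translations by small vectors, on the inner square. -/
theorem IsPhase.lintegral_innerSquare_le {χ : Fin 4 → ℝ × ℝ → ℝ} (h : IsPhase χ)
    {σ : Equiv.Perm (Fin 3)} (hS : surfEnergy σ χ ≠ ⊤) (k : Fin 3) {ε : ℝ} (hε : ε ≤ 1 / 8)
    {τ : ℝ × ℝ} (hτ : τ ∈ Icc (0 : ℝ) ε ×ˢ Icc (0 : ℝ) ε) :
    ∫⁻ p in innerSquare, ‖modChar χ k p - modChar χ k (p + τ)‖ₑ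
      ≤ ENNReal.ofReal (8 * ε * (surfEnergy σ χ).toReal) := by
  obtain ⟨⟨t1, t2⟩, t3, t4⟩ := hτ
  set w := modChar χ k
  have hw : Measurable w := h.measurable_modChar k
  set S := (surfEnergy σ χ).toReal
  have hS0 : 0 ≤ S := ENNReal.toReal_nonneg
  set a : ℝ × ℝ := τ.1 • (1, 0) with ha
  set b : ℝ × ℝ := τ.2 • (0, 1) with hb
  have hτab : τ = a + b := by ext <;> simp [ha, hb]
  set K : Set (ℝ × ℝ) := Icc (-1 / 4 + τ.1) (1 / 4 + τ.1) ×ˢ Icc (-1 / 4) (1 / 4) with hK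
  have hKm : MeasurableSet K := measurableSet_Icc.prod measurableSet_Icc
  have hv1 : volume innerSquare ≠ ⊤ := (isCompact_Icc.prod isCompact_Icc).measure_lt_top.ne
  have hv2 : volume K ≠ ⊤ := (isCompact_Icc.prod isCompact_Icc).measure_lt_top.ne
  have e1 := h.setIntegral_modChar_le hS k (v := (1, 0)) (Or.inl rfl) t1
    (d := 1 / 8) (by norm_num) measurableSet_innerSquare (by
      rintro ⟨x1, x2⟩ ⟨⟨a1, a2⟩, a3, a4⟩ s ⟨s1, s2⟩ ⟨y1, y2⟩ hy
      rw [Prod.dist_eq, max_le_iff] at hy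
      simp only [Prod.smul_mk, Prod.mk_add_mk, Real.dist_eq, abs_le, smul_eq_mul] at hy a1 a2 a3 a4
      refine ⟨⟨?_, ?_⟩, ?_, ?_⟩ <;> simp only <;> linarith [hy.1.1, hy.1.2, hy.2.1, hy.2.2])
  have e2 := h.setIntegral_modChar_le hS k (v := (0, 1)) (Or.inr rfl) t3
    (d := 1 / 8) (by norm_num) hKm (by
      rintro ⟨x1, x2⟩ ⟨⟨a1, a2⟩, a3, a4⟩ s ⟨s1, s2⟩ ⟨y1, y2⟩ hy
      rw [Prod.dist_eq, max_le_iff] at hy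
      simp only [Prod.smul_mk, Prod.mk_add_mk, Real.dist_eq, abs_le, smul_eq_mul] at hy a1 a2 a3 a4
      refine ⟨⟨?_, ?_⟩, ?_, ?_⟩ <;> simp only <;> linarith [hy.1.1, hy.1.2, hy.2.1, hy.2.2])
  have l1 := lintegral_enorm_le_of_integral_abs hv1
    (hw.sub (hw.comp (measurable_id.add_const a)))
    (fun p => h.abs_modChar_sub_le_two k _ _) e1
  have l2 := lintegral_enorm_le_of_integral_abs hv2
    (hw.sub (hw.comp (measurable_id.add_const b)))
    (fun p => h.abs_modChar_sub_le_two k _ _) e2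
  have l3 : ∫⁻ p in innerSquare, ‖w (p + a) - w (p + a + b)‖ₑ = ∫⁻ p in K, ‖w p - w (p + b)‖ₑ := by
    rw [← (measurePreserving_add_right volume a).setLIntegral_comp_preimage_emb
      (MeasurableEquiv.addRight a).measurableEmbedding _ K]
    congr 2
    ext p
    simp [hK, ha, innerSquare, mem_Icc]
  calc ∫⁻ p in innerSquare, ‖w p - w (p + τ)‖ₑ
      ≤ ∫⁻ p in innerSquare, (‖w p - w (p + a)‖ₑ + ‖w (p + a) - w (p + a + b)‖ₑ) := by
        refine lintegral_mono fun p => ?_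
        rw [hτab, ← add_assoc, ← sub_add_sub_cancel (w p) (w (p + a))]
        exact enorm_add_le _ _
    _ = (∫⁻ p in innerSquare, ‖w p - w (p + a)‖ₑ)
        + ∫⁻ p in innerSquare, ‖w (p + a) - w (p + a + b)‖ₑ :=
        lintegral_add_left (by fun_prop) _
    _ ≤ ENNReal.ofReal (τ.1 * (4 * S)) + ENNReal.ofReal (τ.2 * (4 * S)) := by
        rw [l3]; exact add_le_add l1 l2
    _ ≤ _ := by
        rw [← ENNReal.ofReal_add (by positivity) (by positivity)]
        apply ENNReal.ofReal_le_ofReal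
        nlinarith

/-- The relation between an energy and its two parts. -/
theorem energy_parts {η : ℝ} (hη : 0 < η) {s a : ℝ≥0∞}
    (h : ENNReal.ofReal (η ^ (1 / 3 : ℝ)) * s + ENNReal.ofReal (η ^ (-2 / 3 : ℝ)) * a ≤ 1) :
    s ≠ ⊤ ∧ a ≠ ⊤ ∧
    (ENNReal.ofReal (η ^ (1 / 3 : ℝ)) * s + ENNReal.ofReal (η ^ (-2 / 3 : ℝ)) * a).toReal
      = η ^ (1 / 3 : ℝ) * s.toReal + η ^ (-2 / 3 : ℝ) * a.toReal := by
  have h1 : ENNReal.ofReal (η ^ (1 / 3 : ℝ)) ≠ 0 := by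
    simpa using Real.rpow_pos_of_pos hη _
  have h2 : ENNReal.ofReal (η ^ (-2 / 3 : ℝ)) ≠ 0 := by
    simpa using Real.rpow_pos_of_pos hη _
  have hs : s ≠ ⊤ := by
    rintro rfl
    rw [ENNReal.mul_top h1, top_add] at h
    exact absurd h (by simp)
  have ha : a ≠ ⊤ := by
    rintro rfl
    rw [ENNReal.mul_top h2, add_top] at h
    exact absurd h (by simp)
  refine ⟨hs, ha, ?_⟩
  rw [ENNReal.toReal_add (ENNReal.mul_ne_top ENNReal.ofReal_ne_top hs)
    (ENNReal.mul_ne_top ENNReal.ofReal_ne_top ha), ENNReal.toReal_mul, ENNReal.toReal_mul,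
    ENNReal.toReal_ofReal (by positivity), ENNReal.toReal_ofReal (by positivity)]

/-- On a smaller ball, one of the modified characteristic functions is close to a function of one
variable. -/
theorem exists_isSign_ball : ∃ C : ℝ, 0 < C ∧
    ∀ (σ : Equiv.Perm (Fin 3)) (δ η : ℝ) (χ : Fin 4 → ℝ × ℝ → ℝ)
      (e : ℝ × ℝ → Matrix (Fin 3) (Fin 3) ℝ),
      0 < η → η ≤ 1 → IsPhase χ → IsPlanarStrain σ (Metric.ball 0 1) e →
      energy σ δ η e χ ≤ 1 →
      ∃ f : ℝ → ℝ, IsSign f ∧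
        ((∫ y in Metric.ball (0 : E3) (1 / 4), |modChar χ (σ 2) (planar σ y) - f (y (σ 0))|
            ≤ C * (energy σ δ η e χ).toReal ^ (1 / 2 : ℝ)) ∨
         (∫ y in Metric.ball (0 : E3) (1 / 4), |modChar χ (σ 2) (planar σ y) - f (y (σ 1))|
            ≤ C * (energy σ δ η e χ).toReal ^ (1 / 2 : ℝ))) := by
  obtain ⟨C, hC, hmain⟩ := exists_isSign_of_compat
  refine ⟨2112 * C, by linarith, ?_⟩
  intro σ δ η χ e hη hη1 hχ he hE
  obtain ⟨hs, ha, hEeq⟩ := energy_parts hη hE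
  change (energy σ δ η e χ).toReal = _ at hEeq
  set E := (energy σ δ η e χ).toReal with hEdef
  have hE0 : 0 ≤ E := ENNReal.toReal_nonneg
  have hE1 : E ≤ 1 := by
    rw [hEdef]; exact ENNReal.toReal_le_of_le_ofReal zero_le_one (by simpa using hE)
  set S := (surfEnergy σ χ).toReal
  set A := (elastEnergy σ δ e χ).toReal
  have hS0 : 0 ≤ S := ENNReal.toReal_nonneg
  have hA0 : 0 ≤ A := ENNReal.toReal_nonneg
  set κ := η ^ (1 / 3 : ℝ) with hκ
  have hκ0 : 0 < κ := Real.rpow_pos_of_pos hη _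
  have hκ1 : κ ≤ 1 := Real.rpow_le_one hη.le hη1 (by norm_num)
  have hκ2 : η ^ (-2 / 3 : ℝ) = 1 / κ ^ 2 := by
    rw [hκ, ← Real.rpow_natCast, ← Real.rpow_mul hη.le, one_div, ← Real.rpow_neg hη.le]
    norm_num
  have hmeas := measurable_normSqMat (δ := δ) hχ he.1
  have hsq : ∫⁻ p in square, strainDefect δ e χ p ^ 2 ≤ ENNReal.ofReal A := by
    simp only [strainDefect_sq]
    rw [ENNReal.ofReal_toReal ha]
    exact lintegral_square_le_ball σ hmeas.ennreal_ofReal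
  have hw := hχ.measurable_modChar (σ 2)
  have hw1 := hχ.modChar_eq (σ 2)
  obtain ⟨f, hf, hor⟩ := hmain (modChar χ (σ 2))
    (fun p => e p (σ 0) (σ 1) - phaseStrain δ χ p (σ 0) (σ 1))
    (fun p => e p (σ 0) (σ 0) - phaseStrain δ χ p (σ 0) (σ 0))
    (fun p => e p (σ 1) (σ 1) - phaseStrain δ χ p (σ 1) (σ 1))
    -- the averaging scale is `η ^ (1 / 3) / 8`
    (strainDefect δ e χ) (κ / 8) (κ * S) A (64 * C * E) hw hw1
    (measurable_strainDefect hχ he.1) (fun p => enorm_entry_le_strainDefect δ e χ p _ _)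
    (fun p => enorm_entry_le_strainDefect δ e χ p _ _)
    (fun p => enorm_entry_le_strainDefect δ e χ p _ _)
    (fun ψ hψ h0 => he.defect_compat hχ (hsq.trans_lt ENNReal.ofReal_lt_top).ne hψ h0)
    (by positivity) (by linarith) (by positivity) hA0
    (fun τ hτ => (hχ.lintegral_innerSquare_le hs (σ 2) (by linarith) hτ).trans_eq
      (by congr 1; ring)) hsq (by
      rw [hEeq, hκ2, div_pow, mul_assoc, mul_comm 64, mul_assoc]
      refine mul_le_mul_of_nonneg_left ?_ (by linarith)
      have : A / (κ ^ 2 / 8 ^ 2) = 64 * (1 / κ ^ 2 * A) := by field_simp; norm_num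
      rw [this]
      nlinarith [mul_nonneg hκ0.le hS0])
  have hbound : 2 * (16 * (64 * C * E) + √(16 * (64 * C * E)))
      ≤ 2112 * C * E ^ (1 / 2 : ℝ) := by
    rw [← Real.sqrt_eq_rpow]
    have h1 : E ≤ √E := Real.le_sqrt_of_sq_le (by nlinarith)
    have h2 : √(16 * (64 * C * E)) ≤ 32 * C * √E := by
      rw [show 16 * (64 * C * E) = (32 ^ 2 * C) * E by ring, Real.sqrt_mul (by positivity)]
      refine mul_le_mul_of_nonneg_right ?_ (Real.sqrt_nonneg _)
      rw [Real.sqrt_le_left (by positivity)]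
      nlinarith
    nlinarith
  have hfinal : ∀ f' : ℝ × ℝ → ℝ, Measurable f' →
      ∫⁻ p in innerSquare, ‖modChar χ (σ 2) p - f' p‖ₑ
        ≤ ENNReal.ofReal (2 * (16 * (64 * C * E) + √(16 * (64 * C * E)))) →
      ∫ y in Metric.ball (0 : E3) (1 / 4), |modChar χ (σ 2) (planar σ y) - f' (planar σ y)|
        ≤ 2112 * C * E ^ (1 / 2 : ℝ) := by
    intro f' hf' hle
    have hmp : Measurable (planar σ) := (planarL σ).continuous.measurable
    have hm : Measurable fun y => modChar χ (σ 2) (planar σ y) - f' (planar σ y) :=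
      (hw.comp hmp).sub (hf'.comp hmp)
    refine (integral_norm_eq_lintegral_enorm hm.aestronglyMeasurable).trans_le ?_
    refine ENNReal.toReal_le_of_le_ofReal (by positivity) ?_
    refine (lintegral_ball_le_square σ (g := fun p => ‖modChar χ (σ 2) p - f' p‖ₑ)
      (by fun_prop)).trans (hle.trans (ENNReal.ofReal_le_ofReal hbound))
  refine ⟨f, hf, hor.imp (hfinal (fun p => f p.1) (hf.1.comp measurable_fst))
    (hfinal (fun p => f p.2) (hf.1.comp measurable_snd))⟩

/-! ### Bounded curl-free fields from planar strains -/

/-- A periodic property that holds almost everywhere on one period holds almost everywhere. -/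
theorem Periodic2.ae_of_ae_square {P : ℝ × ℝ → Prop} (hp : Periodic2 P)
    (h : ∀ᵐ x ∂(volume.restrict square), P x) : ∀ᵐ x, P x := by
  rw [ae_restrict_iff' measurableSet_square] at h
  have h1 : ∀ᵐ x : ℝ × ℝ, ∀ v : ℤ × ℤ, x + ((v.1 : ℝ), (v.2 : ℝ)) ∈ square →
      P (x + ((v.1 : ℝ), (v.2 : ℝ))) := ae_all_iff.2 fun v =>
    (measurePreserving_add_right volume ((v.1 : ℝ), (v.2 : ℝ))).quasiMeasurePreserving.ae h
  filter_upwards [h1] with x hx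
  have h2 := hx (-round x.1, -round x.2) ?_
  · have e1 := (hp.fst (x.2 + ((-round x.2 : ℤ) : ℝ))).int_mul (-round x.1) x.1
    have e2 := (hp.snd x.1).int_mul (-round x.2) x.2
    rw [mul_one] at e1 e2
    rw [← e2]
    rw [← e1]
    exact h2
  · have a := abs_le.1 (abs_sub_round x.1)
    have b := abs_le.1 (abs_sub_round x.2)
    refine ⟨⟨?_, ?_⟩, ⟨?_, ?_⟩⟩ <;> simp <;> linarith

theorem ae_square_of_ae_ball (σ : Equiv.Perm (Fin 3)) {N : Set (ℝ × ℝ)} (hN : MeasurableSet N)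
    (h : ∀ᵐ y ∂(volume.restrict (Metric.ball (0 : E3) 1)), planar σ y ∉ N) :
    ∀ᵐ x ∂(volume.restrict square), x ∉ N := by
  have h1 := lintegral_square_le_ball σ ((measurable_const (a := (1 : ℝ≥0∞))).indicator hN)
  have h2 : ∫⁻ y in Metric.ball (0 : E3) 1, N.indicator (fun _ => (1 : ℝ≥0∞)) (planar σ y) = 0 := by
    rw [lintegral_congr_ae (g := fun _ => 0), lintegral_zero]
    filter_upwards [h] with y hy
    exact indicator_of_notMem hy _
  rw [h2, nonpos_iff_eq_zero, lintegral_indicator_const hN, one_mul] at h1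
  exact measure_eq_zero_iff_ae_notMem.1 h1

/-- The entries of a periodic strain are symmetric and essentially bounded. -/
theorem IsPlanarStrain.ae_bounded {σ : Equiv.Perm (Fin 3)}
    {e : ℝ × ℝ → Matrix (Fin 3) (Fin 3) ℝ} (h : IsPlanarStrain σ univ e) (hp : Periodic2 e)
    (i j : Fin 3) : ∃ C : ℝ, 0 ≤ C ∧ ∀ᵐ x, |e x i j| ≤ C ∧ e x i j = e x j i := by
  have hs := ae_restrict_of_ae (s := Metric.ball (0 : E3) 1)
      (by simpa only [Measure.restrict_univ] using h.eq_symm)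
  obtain ⟨hm, u, G, hG, he⟩ := h
  have hb : ∀ i j, ∃ C : ℝ, 0 ≤ C ∧ ∀ᵐ y ∂(volume.restrict (Metric.ball (0 : E3) 1)),
      |G y i j| ≤ C := by
    intro i j
    have h1 := hG.memLp_grad 1 i j
    rw [univ_inter] at h1
    have h2 := ae_le_eLpNormEssSup (f := fun y => G y i j)
      (μ := volume.restrict (Metric.ball (0 : E3) 1))
    rw [← eLpNorm_exponent_top] at h2
    refine ⟨(eLpNorm (fun y => G y i j) ⊤ (volume.restrict (Metric.ball (0 : E3) 1))).toReal,
      ENNReal.toReal_nonneg, h2.mono fun y hy => ?_⟩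
    simpa using ENNReal.toReal_mono h1.2.ne hy
  obtain ⟨C₁, hC₁, h1⟩ := hb i j
  obtain ⟨C₂, hC₂, h2⟩ := hb j i
  refine ⟨C₁ + C₂, by positivity, Periodic2.ae_of_ae_square ?_ ?_⟩
  · intro s t
    simp only [(hp s t).1, (hp s t).2, and_self]
  · have hN : MeasurableSet {x | ¬ (|e x i j| ≤ C₁ + C₂ ∧ e x i j = e x j i)} :=
      ((measurableSet_le (hm i j).abs measurable_const).inter
        (measurableSet_eq_fun (hm i j) (hm j i))).compl
    refine (ae_square_of_ae_ball σ hN ?_).mono fun x hx => not_not.1 hx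
    have he' := ae_restrict_of_ae (s := Metric.ball (0 : E3) 1)
      (by simpa only [Measure.restrict_univ] using he)
    filter_upwards [hs, he', h1, h2] with y hs he h1 h2 hn
    refine hn ⟨?_, hs i j⟩
    rw [← he i j, abs_div, abs_two]
    have := abs_add_le (G y i j) (G y j i)
    linarith

/-- `(p, q)` is a bounded periodic field on the plane whose curl has vanishing gradient, in the
weak sense. -/
structure IsCurlCompat (p q : ℝ × ℝ → ℝ) (C : ℝ) : Prop where
  measurable_fst : Measurable p
  measurable_snd : Measurable q
  bound_fst : ∀ x, |p x| ≤ C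
  bound_snd : ∀ x, |q x| ≤ C
  periodic_fst : Periodic2 p
  periodic_snd : Periodic2 q
  weak_one : ∀ ψ : ℝ × ℝ → ℝ, ContDiff ℝ ∞ ψ → HasCompactSupport ψ →
    ∫ x, q x * pdOne (pdOne ψ) x = ∫ x, p x * pdTwo (pdOne ψ) x
  weak_two : ∀ ψ : ℝ × ℝ → ℝ, ContDiff ℝ ∞ ψ → HasCompactSupport ψ →
    ∫ x, q x * pdOne (pdTwo ψ) x = ∫ x, p x * pdTwo (pdTwo ψ) x

theorem clamp_eq {C x : ℝ} (h : |x| ≤ C) : max (-C) (min C x) = x := by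
  rw [min_eq_right (abs_le.1 h).2, max_eq_right (abs_le.1 h).1]

theorem abs_clamp_le {C : ℝ} (h : 0 ≤ C) (x : ℝ) : |max (-C) (min C x)| ≤ C :=
  abs_le.2 ⟨le_max_left _ _, max_le (by linarith) (min_le_left _ _)⟩

/-- The shear components of a periodic planar strain that involve the third direction form,
up to null sets, a bounded periodic field whose curl has vanishing gradient. -/
theorem IsPlanarStrain.exists_isCurlCompat {σ : Equiv.Perm (Fin 3)}
    {e : ℝ × ℝ → Matrix (Fin 3) (Fin 3) ℝ} (h : IsPlanarStrain σ univ e) (hp : Periodic2 e) :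
    ∃ (p q : ℝ × ℝ → ℝ) (C : ℝ), IsCurlCompat p q C ∧
      (∀ᵐ x, p x = e x (σ 0) (σ 2)) ∧ ∀ᵐ x, q x = e x (σ 1) (σ 2) := by
  obtain ⟨C₁, hC₁, h1⟩ := h.ae_bounded hp (σ 0) (σ 2)
  obtain ⟨C₂, hC₂, h2⟩ := h.ae_bounded hp (σ 1) (σ 2)
  set C := max C₁ C₂
  have hC : 0 ≤ C := hC₁.trans (le_max_left _ _)
  set p : ℝ × ℝ → ℝ := fun x => max (-C) (min C (e x (σ 0) (σ 2))) with hpdef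
  set q : ℝ × ℝ → ℝ := fun x => max (-C) (min C (e x (σ 1) (σ 2))) with hqdef
  have hpe : ∀ᵐ x, p x = e x (σ 0) (σ 2) ∧ p x = e x (σ 2) (σ 0) := by
    filter_upwards [h1] with x hx
    have := clamp_eq (hx.1.trans (le_max_left C₁ C₂))
    exact ⟨this, this.trans hx.2⟩
  have hqe : ∀ᵐ x, q x = e x (σ 1) (σ 2) ∧ q x = e x (σ 2) (σ 1) := by
    filter_upwards [h2] with x hx
    have := clamp_eq (hx.1.trans (le_max_right C₁ C₂))
    exact ⟨this, this.trans hx.2⟩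
  have hT : ∀ ψ : ℝ × ℝ → ℝ, ContDiff ℝ ∞ ψ → HasCompactSupport ψ →
      IsTest univ (tensor σ ψ (cutoff.normed volume)) := fun ψ hψ hc =>
    ⟨contDiff_tensor hψ contDiff_cutoff_normed,
      hasCompactSupport_tensor σ hc cutoff.hasCompactSupport_normed, subset_univ _⟩
  refine ⟨p, q, C, ⟨?_, ?_, fun x => abs_clamp_le hC _, fun x => abs_clamp_le hC _, ?_, ?_, ?_, ?_⟩,
    hpe.mono fun _ h => h.1, hqe.mono fun _ h => h.1⟩
  · exact measurable_const.max (measurable_const.min (h.1 _ _))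
  · exact measurable_const.max (measurable_const.min (h.1 _ _))
  · exact fun s t => ⟨by simp only [hpdef, (hp s t).1], by simp only [hpdef, (hp s t).2]⟩
  · exact fun s t => ⟨by simp only [hqdef, (hp s t).1], by simp only [hqdef, (hp s t).2]⟩
  · intro ψ hψ hc
    have := h.curl_compat_fst hψ contDiff_cutoff_normed cutoff.hasCompactSupport_normed
      (hT ψ hψ hc) (cutoff.integral_normed)
    rw [integral_congr_ae (hqe.mono fun x hx => by rw [hx.1]), this]
    exact integral_congr_ae (hpe.mono fun x hx => by beta_reduce; rw [hx.2])
  · intro ψ hψ hc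
    have := h.curl_compat_snd hψ contDiff_cutoff_normed cutoff.hasCompactSupport_normed
      (hT ψ hψ hc) (cutoff.integral_normed)
    rw [integral_congr_ae (hqe.mono fun x hx => by rw [hx.2]), this]
    exact integral_congr_ae (hpe.mono fun x hx => by beta_reduce; rw [hx.1])

/-! ### Mollified fields are curl-free -/

theorem fderiv_convolution_apply {ρ k : ℝ × ℝ → ℝ} {C : ℝ} (hρ : ContDiff ℝ ∞ ρ)
    (hc : HasCompactSupport ρ) (hk : Measurable k) (hb : ∀ x, |k x| ≤ C) (x v : ℝ × ℝ) :
    fderiv ℝ (fun x => ∫ t, ρ t * k (x - t)) x v = ∫ t, fderiv ℝ ρ t v * k (x - t) := by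
  have h1 := hc.hasFDerivAt_convolution_left (𝕜 := ℝ) (ContinuousLinearMap.lsmul ℝ ℝ)
    (hρ.of_le (by simp)) (locallyIntegrable_of_bounded hk hb) x (μ := volume)
  have h2 : fderiv ℝ (fun x => ∫ t, ρ t * k (x - t)) x = _ := h1.fderiv
  have h3 := (hc.fderiv (𝕜 := ℝ)).convolutionExists_left
    ((ContinuousLinearMap.lsmul ℝ ℝ).precompL (ℝ × ℝ)) (hρ.continuous_fderiv (by simp))
    (locallyIntegrable_of_bounded hk hb) x (μ := volume)
  rw [h2, convolution_def, ContinuousLinearMap.integral_apply h3]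
  rfl

theorem pdOne_comp_sub {ρ : ℝ × ℝ → ℝ} (hρ : ContDiff ℝ ∞ ρ) (x : ℝ × ℝ) :
    pdOne (fun y => ρ (x - y)) = fun y => pdOne (fun z => - ρ z) (x - y) := by
  ext y
  have h := ((hρ.differentiable (by simp)) (x - y)).hasFDerivAt.comp y
    ((hasFDerivAt_id y).const_sub x)
  change fderiv ℝ (ρ ∘ fun y => x - y) y (1, 0) = fderiv ℝ (fun z => - ρ z) (x - y) (1, 0)
  rw [fderiv_fun_neg]
  erw [h.fderiv]
  simp

theorem pdTwo_comp_sub {ρ : ℝ × ℝ → ℝ} (hρ : ContDiff ℝ ∞ ρ) (x : ℝ × ℝ) :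
    pdTwo (fun y => ρ (x - y)) = fun y => pdTwo (fun z => - ρ z) (x - y) := by
  ext y
  have h := ((hρ.differentiable (by simp)) (x - y)).hasFDerivAt.comp y
    ((hasFDerivAt_id y).const_sub x)
  change fderiv ℝ (ρ ∘ fun y => x - y) y (0, 1) = fderiv ℝ (fun z => - ρ z) (x - y) (0, 1)
  rw [fderiv_fun_neg]
  erw [h.fderiv]
  simp

theorem pdOne_neg (ρ : ℝ × ℝ → ℝ) : pdOne (fun z => - ρ z) = fun z => - pdOne ρ z := by
  ext z; simp [pdOne]

theorem pdTwo_neg (ρ : ℝ × ℝ → ℝ) : pdTwo (fun z => - ρ z) = fun z => - pdTwo ρ z := by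
  ext z; simp [pdTwo]

theorem pdOne_pdTwo_comm {ψ : ℝ × ℝ → ℝ} (h : ContDiff ℝ ∞ ψ) :
    pdOne (pdTwo ψ) = pdTwo (pdOne ψ) := by
  ext y
  have hd : DifferentiableAt ℝ (fderiv ℝ ψ) y :=
    (h.fderiv_right (m := 1) (WithTop.coe_le_coe.2 le_top)).differentiable one_ne_zero y
  have h1 : ∀ v w : ℝ × ℝ, fderiv ℝ (fun z => fderiv ℝ ψ z v) y w
      = fderiv ℝ (fderiv ℝ ψ) y w v := by
    intro v w
    rw [fderiv_clm_apply hd (differentiableAt_const v)]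
    simp
  have h2 := (h.contDiffAt (x := y)).isSymmSndFDerivAt (by
    simp only [minSmoothness_of_isRCLikeNormedField]; exact WithTop.coe_le_coe.2 le_top)
  change fderiv ℝ (fun z => fderiv ℝ ψ z _) y _ = fderiv ℝ (fun z => fderiv ℝ ψ z _) y _
  rw [h1, h1]
  exact h2 _ _

theorem integral_mul_comp_sub (ρ k : ℝ × ℝ → ℝ) (x : ℝ × ℝ) :
    ∫ y, k y * ρ (x - y) = ∫ t, ρ t * k (x - t) := by
  rw [← integral_sub_left_eq_self _ volume x]
  simp only [sub_sub_cancel, mul_comm]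

section Compat
variable {p q ρ : ℝ × ℝ → ℝ} {C : ℝ}

theorem hasCompactSupport_pdOne (hc : HasCompactSupport ρ) : HasCompactSupport (pdOne ρ) :=
  (hc.fderiv (𝕜 := ℝ)).comp_left (g := fun L : ℝ × ℝ →L[ℝ] ℝ => L (1, 0)) (by simp)

theorem hasCompactSupport_pdTwo (hc : HasCompactSupport ρ) : HasCompactSupport (pdTwo ρ) :=
  (hc.fderiv (𝕜 := ℝ)).comp_left (g := fun L : ℝ × ℝ →L[ℝ] ℝ => L (0, 1)) (by simp)

/-- The weak conditions on the curl, tested with translates of a mollifier, in the form needed for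
the first derivative of the mollified curl. -/
theorem IsCurlCompat.convolution_one (h : IsCurlCompat p q C) (hρ : ContDiff ℝ ∞ ρ)
    (hc : HasCompactSupport ρ) (x : ℝ × ℝ) :
    ∫ t, pdOne (pdOne ρ) t * q (x - t) = ∫ t, pdTwo (pdOne ρ) t * p (x - t) := by
  have h1 := h.weak_one (fun y => ρ (x - y)) (hρ.comp (contDiff_const.sub contDiff_id))
    (hc.comp_homeomorph (Homeomorph.subLeft x))
  have hd := (contDiff_pdOne hρ).neg
  rw [pdOne_comp_sub hρ, pdOne_neg, pdOne_comp_sub hd, pdTwo_comp_sub hd] at h1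
  simp only [neg_neg] at h1
  exact (integral_mul_comp_sub (pdOne (pdOne ρ)) q x).symm.trans
    (h1.trans (integral_mul_comp_sub (pdTwo (pdOne ρ)) p x))

theorem IsCurlCompat.convolution_two (h : IsCurlCompat p q C) (hρ : ContDiff ℝ ∞ ρ)
    (hc : HasCompactSupport ρ) (x : ℝ × ℝ) :
    ∫ t, pdOne (pdTwo ρ) t * q (x - t) = ∫ t, pdTwo (pdTwo ρ) t * p (x - t) := by
  have h1 := h.weak_two (fun y => ρ (x - y)) (hρ.comp (contDiff_const.sub contDiff_id))
    (hc.comp_homeomorph (Homeomorph.subLeft x))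
  have hd := (contDiff_pdTwo hρ).neg
  rw [pdTwo_comp_sub hρ, pdTwo_neg, pdOne_comp_sub hd, pdTwo_comp_sub hd] at h1
  simp only [neg_neg] at h1
  exact (integral_mul_comp_sub (pdOne (pdTwo ρ)) q x).symm.trans
    (h1.trans (integral_mul_comp_sub (pdTwo (pdTwo ρ)) p x))

theorem integral_square_pdOne {k : ℝ × ℝ → ℝ} (hk : ContDiff ℝ ∞ k) (hp : Periodic2 k) :
    ∫ x in square, pdOne k x = 0 := by
  have hc : Continuous (pdOne k) := (contDiff_pdOne hk).continuous
  have hi : Integrable (pdOne k) (periodMeasure.prod periodMeasure) := by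
    rw [← volume_restrict_square]; exact hc.continuousOn.integrableOn_compact isCompact_square
  rw [volume_restrict_square, integral_prod_symm _ hi]
  refine integral_eq_zero_of_ae (Eventually.of_forall fun t => ?_)
  change ∫ s, pdOne k (s, t) ∂periodMeasure = 0
  rw [periodMeasure_eq_Ioc _ rfl, ← intervalIntegral.integral_of_le (by norm_num),
    intervalIntegral.integral_eq_sub_of_hasDerivAt (f := fun s => k (s, t))]
  · simp only [(hp _ _).1, sub_self]
  · intro s _
    exact ((hk.differentiable (by simp) (s, t)).hasFDerivAt).comp_hasDerivAt s
      ((hasDerivAt_id s).prodMk (hasDerivAt_const s t))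
  · exact (hc.comp (by fun_prop : Continuous fun s : ℝ => (s, t))).intervalIntegrable _ _

theorem integral_square_pdTwo {k : ℝ × ℝ → ℝ} (hk : ContDiff ℝ ∞ k) (hp : Periodic2 k) :
    ∫ x in square, pdTwo k x = 0 := by
  have hc : Continuous (pdTwo k) := (contDiff_pdTwo hk).continuous
  have hi : Integrable (pdTwo k) (periodMeasure.prod periodMeasure) := by
    rw [← volume_restrict_square]; exact hc.continuousOn.integrableOn_compact isCompact_square
  rw [volume_restrict_square, integral_prod _ hi]
  refine integral_eq_zero_of_ae (Eventually.of_forall fun s => ?_)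
  change ∫ t, pdTwo k (s, t) ∂periodMeasure = 0
  rw [periodMeasure_eq_Ioc _ rfl, ← intervalIntegral.integral_of_le (by norm_num),
    intervalIntegral.integral_eq_sub_of_hasDerivAt (f := fun t => k (s, t))]
  · simp only [(hp _ _).2, sub_self]
  · intro t _
    exact ((hk.differentiable (by simp) (s, t)).hasFDerivAt).comp_hasDerivAt t
      ((hasDerivAt_const t s).prodMk (hasDerivAt_id t))
  · exact (hc.comp (by fun_prop : Continuous fun t : ℝ => (s, t))).intervalIntegrable _ _

theorem pdOne_mollify {k : ℝ × ℝ → ℝ} (hk : Measurable k) (hb : ∀ x, |k x| ≤ C) (n : ℕ) :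
    pdOne (mollify n k) = fun x => ∫ t, pdOne ((planeBump n).normed volume) t * k (x - t) := by
  ext x
  exact fderiv_convolution_apply (planeBump n).contDiff_normed
    (planeBump n).hasCompactSupport_normed hk hb x _

theorem pdTwo_mollify {k : ℝ × ℝ → ℝ} (hk : Measurable k) (hb : ∀ x, |k x| ≤ C) (n : ℕ) :
    pdTwo (mollify n k) = fun x => ∫ t, pdTwo ((planeBump n).normed volume) t * k (x - t) := by
  ext x
  exact fderiv_convolution_apply (planeBump n).contDiff_normed
    (planeBump n).hasCompactSupport_normed hk hb x _

theorem clm_plane_eq (L : ℝ × ℝ →L[ℝ] ℝ) (v : ℝ × ℝ) : L v = v.1 * L (1, 0) + v.2 * L (0, 1) := by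
  rw [← smul_eq_mul, ← smul_eq_mul, ← map_smul, ← map_smul, ← map_add]
  simp

/-- The mollified field is curl-free: its curl is constant because its gradient vanishes, and
the constant is zero because the integral over a period vanishes. -/
theorem IsCurlCompat.mollify_curl (h : IsCurlCompat p q C) (n : ℕ) (x : ℝ × ℝ) :
    pdOne (mollify n q) x = pdTwo (mollify n p) x := by
  have hρ : ContDiff ℝ ∞ ((planeBump n).normed volume) := (planeBump n).contDiff_normed
  have hc := (planeBump n).hasCompactSupport_normed (μ := volume)
  have hq := contDiff_mollify h.measurable_snd h.bound_snd n
  have hp := contDiff_mollify h.measurable_fst h.bound_fst n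
  have hZ : ContDiff ℝ ∞ fun x => pdOne (mollify n q) x - pdTwo (mollify n p) x :=
    (contDiff_pdOne hq).sub (contDiff_pdTwo hp)
  have d1 := (contDiff_pdOne hq).differentiable (by simp)
  have d2 := (contDiff_pdTwo hp).differentiable (by simp)
  have hf : ∀ x, fderiv ℝ (fun x => pdOne (mollify n q) x - pdTwo (mollify n p) x) x = 0 := by
    intro x
    have c1 := fun x v => fderiv_convolution_apply (contDiff_pdOne hρ) (hasCompactSupport_pdOne hc)
      h.measurable_snd h.bound_snd x v
    have c2 := fun x v => fderiv_convolution_apply (contDiff_pdTwo hρ) (hasCompactSupport_pdTwo hc)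
      h.measurable_fst h.bound_fst x v
    refine ContinuousLinearMap.ext fun v => ?_
    rw [clm_plane_eq, fderiv_fun_sub (d1 x) (d2 x), pdOne_mollify h.measurable_snd h.bound_snd,
      pdTwo_mollify h.measurable_fst h.bound_fst]
    simp only [sub_apply, c1, c2]
    have e1 := h.convolution_one hρ hc x
    have e2 := h.convolution_two hρ hc x
    rw [← pdOne_pdTwo_comm hρ] at e1
    rw [pdOne_pdTwo_comm hρ] at e2
    simp only [pdOne, pdTwo] at e1 e2 ⊢
    rw [e1, e2]
    simp
  have hconst := is_const_of_fderiv_eq_zero (hZ.differentiable (by simp)) hf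
  have h0 : ∫ y in square, (pdOne (mollify n q) y - pdTwo (mollify n p) y) = 0 := by
    rw [integral_sub, integral_square_pdOne hq (h.periodic_snd.mollify n),
      integral_square_pdTwo hp (h.periodic_fst.mollify n), sub_zero]
    · exact d1.continuous.continuousOn.integrableOn_compact isCompact_square
    · exact d2.continuous.continuousOn.integrableOn_compact isCompact_square
  rw [integral_congr_ae (Eventually.of_forall fun y => hconst y x)] at h0
  simpa [sub_eq_zero] using h0

end Compat

/-! ### The shear and the potential of a curl-free field -/

/-- The mollifications of a curl-free field have potentials. -/
theorem IsCurlCompat.exists_potential {p q : ℝ × ℝ → ℝ} {C : ℝ} (h : IsCurlCompat p q C)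
    (n : ℕ) : ∃ P : ℝ × ℝ → ℝ, ∀ x, HasFDerivAt P
      (mollify n p x • ContinuousLinearMap.fst ℝ ℝ ℝ
        + mollify n q x • ContinuousLinearMap.snd ℝ ℝ ℝ) x := by
  have hq := contDiff_mollify h.measurable_snd h.bound_snd n
  have hp := contDiff_mollify h.measurable_fst h.bound_fst n
  have hω : ∀ a, HasFDerivAt (fun x => mollify n p x • ContinuousLinearMap.fst ℝ ℝ ℝ
        + mollify n q x • ContinuousLinearMap.snd ℝ ℝ ℝ) _ a := fun a =>
    ((hp.differentiable (by simp) a).hasFDerivAt.smul_const (ContinuousLinearMap.fst ℝ ℝ ℝ)).add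
      ((hq.differentiable (by simp) a).hasFDerivAt.smul_const (ContinuousLinearMap.snd ℝ ℝ ℝ))
  obtain ⟨P, hP⟩ := convex_univ.exists_forall_hasFDerivAt_of_fderiv_symmetric isOpen_univ
    (fun a _ => (hω a).differentiableAt.differentiableWithinAt) (fun a _ x y => by
      rw [(hω a).fderiv]
      have h1 : fderiv ℝ (mollify n q) a (1, 0) = fderiv ℝ (mollify n p) a (0, 1) :=
        h.mollify_curl n a
      simp only [add_apply, ContinuousLinearMap.smulRight_apply, smul_apply, smul_eq_mul,
        ContinuousLinearMap.coe_fst', ContinuousLinearMap.coe_snd']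
      rw [clm_plane_eq (fderiv ℝ (mollify n p) a) x, clm_plane_eq (fderiv ℝ (mollify n q) a) x,
        clm_plane_eq (fderiv ℝ (mollify n p) a) y, clm_plane_eq (fderiv ℝ (mollify n q) a) y, h1]
      ring)
  exact ⟨P, fun x => hP x (mem_univ x)⟩

section Shear
variable {f : ℝ → ℝ}

theorem IsSign.norm_le_one (hf : IsSign f) (s : ℝ) : ‖f s‖ ≤ 1 := by
  rcases hf.2 s with h | h <;> simp [h]

theorem IsSign.locallyIntegrable (hf : IsSign f) : LocallyIntegrable f volume :=
  (memLp_top_of_bound hf.1.aestronglyMeasurable 1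
    (Eventually.of_forall hf.norm_le_one)).locallyIntegrable le_top

theorem IsSign.intervalIntegrable (hf : IsSign f) (a b : ℝ) : IntervalIntegrable f volume a b :=
  (intervalIntegrable_const (c := (1 : ℝ))).mono_fun hf.1.aestronglyMeasurable
    (Eventually.of_forall fun s => by simpa using hf.norm_le_one s)

theorem IsSign.abs_primitive_sub_le (hf : IsSign f) (a b : ℝ) :
    |(∫ x in (0 : ℝ)..a, f x) - ∫ x in (0 : ℝ)..b, f x| ≤ |a - b| := by
  rw [intervalIntegral.integral_interval_sub_left (hf.intervalIntegrable _ _)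
    (hf.intervalIntegrable _ _)]
  simpa using intervalIntegral.norm_integral_le_of_norm_le_const (C := 1) (a := b) (b := a)
    (f := f) fun x _ => hf.norm_le_one x

theorem IsSign.continuous_primitive (hf : IsSign f) :
    Continuous fun s => ∫ x in (0 : ℝ)..s, f x :=
  intervalIntegral.continuous_primitive (hf.intervalIntegrable) 0

theorem IsSign.continuous_shear (hf : IsSign f) : Continuous (shear f) :=
  continuous_fst.prodMk (continuous_snd.sub (hf.continuous_primitive.comp continuous_fst))

theorem IsSign.measurePreserving_shear (hf : IsSign f) :
    MeasurePreserving (shear f) volume volume := by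
  rw [Measure.volume_eq_prod]
  refine (MeasurePreserving.id (volume : Measure ℝ)).skew_product
    (g := fun s t => t - ∫ x in (0 : ℝ)..s, f x) ?_ (Eventually.of_forall fun s => ?_)
  · exact (hf.continuous_shear.measurable).snd
  · exact (measurePreserving_sub_right volume _).map_eq

theorem shear_add (f : ℝ → ℝ) (s t τ : ℝ) : shear f (s, t + τ) = shear f (s, t) + (0, τ) := by
  simp [shear]; ring

/-- The integral of `q` along a vertical segment of length `ε`, in sheared coordinates. -/
noncomputable def rise (f : ℝ → ℝ) (q : ℝ × ℝ → ℝ) (ε : ℝ) (x : ℝ × ℝ) : ℝ :=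
  ∫ τ in (0 : ℝ)..ε, q (shear f x + (0, τ))

/-- The component of the field `(p, q)` along the sheared curves. -/
noncomputable def drift (f : ℝ → ℝ) (p q : ℝ × ℝ → ℝ) (x : ℝ × ℝ) : ℝ :=
  p (shear f x) - f x.1 * q (shear f x)

/-- The fundamental theorem of calculus for a potential along a sheared curve. -/
theorem IsSign.integral_drift (hf : IsSign f) {P a b : ℝ × ℝ → ℝ} {C : ℝ}
    (hP : ∀ x, HasFDerivAt P (a x • ContinuousLinearMap.fst ℝ ℝ ℝ
        + b x • ContinuousLinearMap.snd ℝ ℝ ℝ) x) (ha : ∀ x, |a x| ≤ C) (hb : ∀ x, |b x| ≤ C)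
    (s s' t : ℝ) :
    ∫ x in s'..s, drift f a b (x, t) = P (shear f (s, t)) - P (shear f (s', t)) := by
  have hC : 0 ≤ C := (abs_nonneg _).trans (ha 0)
  have hlip : LipschitzWith (C + C).toNNReal P := by
    refine lipschitzWith_of_nnnorm_fderiv_le (𝕜 := ℝ) (fun x => (hP x).differentiableAt) fun x => ?_
    rw [(hP x).fderiv, ← NNReal.coe_le_coe, Real.coe_toNNReal _ (by positivity), coe_nnnorm]
    refine (norm_add_le _ _).trans (add_le_add ?_ ?_)
    · rw [norm_smul]
      exact (mul_le_of_le_one_right (norm_nonneg _) (ContinuousLinearMap.norm_fst_le ..)).trans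
        (ha x)
    · rw [norm_smul]
      exact (mul_le_of_le_one_right (norm_nonneg _) (ContinuousLinearMap.norm_snd_le ..)).trans
        (hb x)
  have hsl : LipschitzWith 1 fun x => shear f (x, t) := by
    refine LipschitzWith.of_dist_le_mul fun x y => ?_
    rw [Prod.dist_eq, NNReal.coe_one, one_mul, max_le_iff]
    refine ⟨le_rfl, ?_⟩
    simp only [shear, Real.dist_eq]
    rw [sub_sub_sub_cancel_left, abs_sub_comm]
    exact hf.abs_primitive_sub_le x y
  have hac := ((hlip.comp hsl).lipschitzOnWith (s := uIcc s' s)).absolutelyContinuousOnInterval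
  have h1 := hac.integral_deriv_eq_sub
  simp only [Function.comp_apply] at h1
  rw [← h1]
  refine intervalIntegral.integral_congr_ae ?_
  filter_upwards [LocallyIntegrable.ae_hasDerivAt_integral hf.locallyIntegrable] with x hx _
  have h2 : HasDerivAt (fun x => shear f (x, t)) (1, -f x) x := by
    refine (hasDerivAt_id x).prodMk ?_
    simpa using (hx 0).const_sub t
  have h3 := (hP (shear f (x, t))).comp_hasDerivAt x h2
  rw [h3.deriv]
  simp [drift]
  ring

theorem integral_vertical {P a b : ℝ × ℝ → ℝ}
    (hP : ∀ x, HasFDerivAt P (a x • ContinuousLinearMap.fst ℝ ℝ ℝ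
        + b x • ContinuousLinearMap.snd ℝ ℝ ℝ) x) (hb : Continuous b) (x : ℝ × ℝ) (ε : ℝ) :
    ∫ τ in (0 : ℝ)..ε, b (x + (0, τ)) = P (x + (0, ε)) - P x := by
  have h := intervalIntegral.integral_eq_sub_of_hasDerivAt (f := fun τ => P (x + (0, τ)))
    (f' := fun τ => b (x + (0, τ))) (a := 0) (b := ε) ?_ ?_
  · rw [h, show ((0 : ℝ), (0 : ℝ)) = 0 from rfl, add_zero]
  · intro τ _
    have h2 : HasDerivAt (fun τ : ℝ => x + (0, τ)) (0, 1) τ :=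
      ((hasDerivAt_const τ (0 : ℝ)).prodMk (hasDerivAt_id τ)).const_add x
    have h3 := (hP (x + (0, τ))).comp_hasDerivAt τ h2
    simp only [add_apply, smul_apply, ContinuousLinearMap.coe_fst', ContinuousLinearMap.coe_snd',
      smul_eq_mul, mul_zero, zero_add, mul_one] at h3
    exact h3
  · exact (hb.comp (by fun_prop)).intervalIntegrable _ _

variable {p q : ℝ × ℝ → ℝ} {C : ℝ}

theorem IsCurlCompat.rise_mollify_sub (h : IsCurlCompat p q C) (hf : IsSign f) (n : ℕ)
    (ε s s' t : ℝ) :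
    rise f (mollify n q) ε (s, t) - rise f (mollify n q) ε (s', t)
      = (∫ x in s'..s, drift f (mollify n p) (mollify n q) (x, t + ε))
        - ∫ x in s'..s, drift f (mollify n p) (mollify n q) (x, t) := by
  obtain ⟨P, hP⟩ := h.exists_potential n
  have hc := (contDiff_mollify h.measurable_snd h.bound_snd n).continuous
  have h1 := hf.integral_drift hP (abs_mollify_le h.bound_fst n) (abs_mollify_le h.bound_snd n) s s'
  rw [h1, h1, rise, rise, integral_vertical hP hc, integral_vertical hP hc, shear_add, shear_add]
  ring

theorem tendsto_rise (f : ℝ → ℝ) (hq : Measurable q) (hb : ∀ x, |q x| ≤ C) (ε : ℝ) :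
    ∀ᵐ s, ∀ t, Tendsto (fun n => rise f (mollify n q) ε (s, t)) atTop
      (𝓝 (rise f q ε (s, t))) := by
  have h1 := Measure.ae_ae_of_ae_prod (tendsto_mollify hq hb)
  filter_upwards [h1] with s hs t
  refine intervalIntegral.tendsto_integral_filter_of_dominated_convergence (fun _ => C) ?_ ?_ ?_ ?_
  · refine Eventually.of_forall fun n => ?_
    exact (((contDiff_mollify hq hb n).continuous.comp (by fun_prop))).aestronglyMeasurable
  · exact Eventually.of_forall fun n => Eventually.of_forall fun τ _ => abs_mollify_le hb n _
  · exact intervalIntegrable_const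
  · have h2 := (measurePreserving_add_left volume (shear f (s, t)).2).quasiMeasurePreserving.ae hs
    filter_upwards [h2] with τ hτ _
    have e : shear f (s, t) + (0, τ) = (s, (shear f (s, t)).2 + τ) := by ext <;> simp [shear]
    rw [e]
    exact hτ

theorem IsSign.measurable_drift (hf : IsSign f) (hp : Measurable p) (hq : Measurable q) :
    Measurable (drift f p q) :=
  (hp.comp hf.continuous_shear.measurable).sub
    ((hf.1.comp measurable_fst).mul (hq.comp hf.continuous_shear.measurable))

theorem IsSign.abs_drift_le (hf : IsSign f) (hp : ∀ x, |p x| ≤ C) (hq : ∀ x, |q x| ≤ C)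
    (x : ℝ × ℝ) : |drift f p q x| ≤ C + C := by
  refine (abs_sub _ _).trans (add_le_add (hp _) ?_)
  rw [abs_mul]
  exact (mul_le_of_le_one_left (abs_nonneg _) (hf.norm_le_one _)).trans (hq _)

theorem IsCurlCompat.tendsto_drift (h : IsCurlCompat p q C) (hf : IsSign f) :
    ∀ᵐ t, ∀ s s', Tendsto (fun n => ∫ x in s'..s, drift f (mollify n p) (mollify n q) (x, t))
      atTop (𝓝 (∫ x in s'..s, drift f p q (x, t))) := by
  have h0 : ∀ᵐ x : ℝ × ℝ, Tendsto (fun n => drift f (mollify n p) (mollify n q) x) atTop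
      (𝓝 (drift f p q x)) := by
    filter_upwards [hf.measurePreserving_shear.quasiMeasurePreserving.ae
      (tendsto_mollify h.measurable_fst h.bound_fst),
      hf.measurePreserving_shear.quasiMeasurePreserving.ae
      (tendsto_mollify h.measurable_snd h.bound_snd)] with x h1 h2
    exact h1.sub (h2.const_mul _)
  have h1 := Measure.ae_ae_of_ae_prod
    ((Measure.measurePreserving_swap (μ := (volume : Measure ℝ))
      (ν := (volume : Measure ℝ))).quasiMeasurePreserving.ae h0)
  filter_upwards [h1] with t ht s s'
  refine intervalIntegral.tendsto_integral_filter_of_dominated_convergence (fun _ => C + C)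
    ?_ ?_ ?_ ?_
  · refine Eventually.of_forall fun n => ?_
    exact ((hf.measurable_drift
      (contDiff_mollify h.measurable_fst h.bound_fst n).continuous.measurable
      (contDiff_mollify h.measurable_snd h.bound_snd n).continuous.measurable).comp
      (by fun_prop)).aestronglyMeasurable
  · exact Eventually.of_forall fun n => Eventually.of_forall fun x _ =>
      hf.abs_drift_le (abs_mollify_le h.bound_fst n) (abs_mollify_le h.bound_snd n) _
  · exact intervalIntegrable_const
  · exact ht.mono fun x hx _ => hx

/-- The horizontal variation of the vertical integrals of `q` in sheared coordinates is
controlled by the component of the field along the sheared curves. -/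
theorem IsCurlCompat.rise_sub (h : IsCurlCompat p q C) (hf : IsSign f) (ε : ℝ) :
    ∀ᵐ s, ∀ᵐ s', ∀ᵐ t, rise f q ε (s, t) - rise f q ε (s', t)
      = (∫ x in s'..s, drift f p q (x, t + ε)) - ∫ x in s'..s, drift f p q (x, t) := by
  have h1 := tendsto_rise f h.measurable_snd h.bound_snd ε
  have h2 := h.tendsto_drift hf
  have h3 := (measurePreserving_add_right volume ε).quasiMeasurePreserving.ae h2
  filter_upwards [h1] with s hs
  filter_upwards [h1] with s' hs'
  filter_upwards [h2, h3] with t ht ht'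
  refine tendsto_nhds_unique ((hs t).sub (hs' t)) ?_
  simp only [h.rise_mollify_sub hf]
  exact (ht' s s').sub (ht s s')

theorem drift_add_one (f : ℝ → ℝ) (hp : Periodic2 p) (hq : Periodic2 q) (s t : ℝ) :
    drift f p q (s, t + 1) = drift f p q (s, t) := by
  simp only [drift, shear_add, hp.add_one_snd, hq.add_one_snd]

end Shear

/-! ### Estimates in sheared coordinates -/

theorem ennreal_add_add_sq_le (a b c : ℝ≥0∞) : (a + b + c) ^ 2 ≤ 3 * (a ^ 2 + b ^ 2 + c ^ 2) := by
  by_cases ha : a = ⊤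
  · simp [ha]
  by_cases hb : b = ⊤
  · simp [hb]
  by_cases hc : c = ⊤
  · simp [hc]
  lift a to NNReal using ha
  lift b to NNReal using hb
  lift c to NNReal using hc
  norm_cast
  rw [← NNReal.coe_le_coe]
  push_cast
  nlinarith [sq_nonneg ((a : ℝ) - b), sq_nonneg ((b : ℝ) - c), sq_nonneg ((a : ℝ) - c)]

theorem enorm_sub_sq_of_sign {a b : ℝ} (ha : a = 1 ∨ a = -1) (hb : b = 1 ∨ b = -1) :
    ‖a - b‖ₑ ^ 2 = 2 * ‖a - b‖ₑ := by
  rw [Real.enorm_eq_ofReal_abs, ← ENNReal.ofReal_ofNat 2, ← ENNReal.ofReal_mul zero_le_two,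
    ← ENNReal.ofReal_pow (abs_nonneg _)]
  congr 1
  rcases ha with rfl | rfl <;> rcases hb with rfl | rfl <;> norm_num

section Shear
variable {f : ℝ → ℝ} {p q h w : ℝ × ℝ → ℝ} {C : ℝ}

theorem lintegral_square_comp_shear (hf : IsSign f) {g : ℝ × ℝ → ℝ≥0∞} (hg : Measurable g)
    (hp : ∀ s, Function.Periodic (fun t => g (s, t)) 1) :
    ∫⁻ x in square, g (shear f x) = ∫⁻ x in square, g x :=
  lintegral_square_shear hg (F := fun s => -∫ x in (0 : ℝ)..s, f x)
    hf.continuous_primitive.neg.measurable hp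

/-- The sets `shear f ⁻¹' square` and `square` are both fundamental domains for functions that are
periodic in the second variable after the shear. -/
theorem lintegral_preimage_shear (hf : IsSign f) {g : ℝ × ℝ → ℝ≥0∞} (hg : Measurable g)
    (hp : ∀ s, Function.Periodic (fun t => g (s, t)) 1) :
    ∫⁻ x in shear f ⁻¹' square, g x = ∫⁻ x in square, g x := by
  have hF := hf.continuous_primitive.measurable
  rw [← lintegral_square_shear hg hF hp, ← hf.measurePreserving_shear.setLIntegral_comp_preimage
    measurableSet_square (by fun_prop)]
  simp [shear]

/-- The component of the field along the sheared curves is small if `(p, q)` is close to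
`(w * h, h)` and `w` is close to `f`. -/
theorem lintegral_drift_sq_le (hf : IsSign f)
    (hpm : Measurable p) (hqm : Measurable q) (hp : Periodic2 p) (hq : Periodic2 q)
    (hh : Measurable h) (hw : Measurable w) (hs : ∀ x, h x = 1 ∨ h x = -1)
    (ws : ∀ x, w x = 1 ∨ w x = -1) {A κ : ℝ≥0∞}
    (hqA : ∫⁻ x in square, ‖q x - h x‖ₑ ^ 2 ≤ A)
    (hpA : ∫⁻ x in square, ‖p x - w x * h x‖ₑ ^ 2 ≤ A)
    (hκ : ∫⁻ x in square, ‖w x - f x.1‖ₑ ≤ κ) :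
    ∫⁻ x in square, ‖drift f p q x‖ₑ ^ 2 ≤ 6 * (A + κ) := by
  have hfm := hf.1
  refine (lintegral_square_comp_shear hf (g := fun y => ‖p y - f y.1 * q y‖ₑ ^ 2) (by fun_prop)
    fun s t => by simp only [(hp s t).2, (hq s t).2]).trans_le ?_
  have key : ∀ x, ‖p x - f x.1 * q x‖ₑ ^ 2
      ≤ 3 * (‖p x - w x * h x‖ₑ ^ 2 + 2 * ‖w x - f x.1‖ₑ + ‖q x - h x‖ₑ ^ 2) := by
    intro x
    rw [← enorm_sub_sq_of_sign (ws x) (hf.2 x.1)]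
    refine le_trans ?_ (ennreal_add_add_sq_le _ _ _)
    gcongr
    have e1 : ‖h x‖ₑ = 1 := by rcases hs x with e | e <;> simp [e]
    have e2 : ‖f x.1‖ₑ = 1 := by rcases hf.2 x.1 with e | e <;> simp [e]
    calc ‖p x - f x.1 * q x‖ₑ
        = ‖(p x - w x * h x) + (w x - f x.1) * h x + -(f x.1 * (q x - h x))‖ₑ := by
          congr 1; ring
      _ ≤ ‖p x - w x * h x‖ₑ + ‖(w x - f x.1) * h x‖ₑ + ‖-(f x.1 * (q x - h x))‖ₑ :=
          (enorm_add_le _ _).trans (add_le_add_left (enorm_add_le _ _) _)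
      _ = _ := by rw [enorm_neg, enorm_mul, enorm_mul, e1, e2, mul_one, one_mul]
  have m1 : Measurable fun x => ‖q x - h x‖ₑ ^ 2 := by fun_prop
  have m2 : Measurable fun x : ℝ × ℝ => 2 * ‖w x - f x.1‖ₑ := by fun_prop
  have m3 : Measurable fun x : ℝ × ℝ => ‖w x - f x.1‖ₑ := by fun_prop
  refine (lintegral_mono key).trans ?_
  rw [lintegral_const_mul _ (by fun_prop), lintegral_add_right _ m1, lintegral_add_right _ m2,
    lintegral_const_mul _ m3]
  calc _ ≤ 3 * (A + 2 * κ + A) := by gcongr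
    _ = 6 * (A + κ) := by ring

/-- On average over the period, the horizontal variation of the vertical integrals is
controlled by the drift. -/
theorem IsCurlCompat.lintegral_rise_sub_sq_le (hc : IsCurlCompat p q C) (hf : IsSign f) (ε : ℝ) :
    ∀ᵐ s ∂periodMeasure, ∀ᵐ s' ∂periodMeasure,
      ∫⁻ t, ‖rise f q ε (s, t) - rise f q ε (s', t)‖ₑ ^ 2 ∂periodMeasure
        ≤ 4 * ∫⁻ x in square, ‖drift f p q x‖ₑ ^ 2 := by
  have hm : Measurable (drift f p q) := hf.measurable_drift hc.measurable_fst hc.measurable_snd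
  have hb : ∀ τ t s s', s ∈ Icc (-1 / 2 : ℝ) (1 / 2) → s' ∈ Icc (-1 / 2 : ℝ) (1 / 2) →
      ‖∫ x in s'..s, drift f p q (x, t + τ)‖ₑ ^ 2
        ≤ ∫⁻ x, ‖drift f p q (x, t + τ)‖ₑ ^ 2 ∂periodMeasure := by
    intro τ t s s' hs hs'
    have h1 : ‖∫ x in s'..s, drift f p q (x, t + τ)‖ₑ
        ≤ ∫⁻ x, ‖drift f p q (x, t + τ)‖ₑ ∂periodMeasure := by
      rw [← ofReal_norm, intervalIntegral.norm_integral_eq_norm_integral_uIoc, ofReal_norm]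
      refine (enorm_integral_le_lintegral_enorm _).trans (lintegral_mono_set ?_)
      exact uIoc_subset_uIcc.trans (uIcc_subset_Icc hs' hs)
    have h2 := sq_lintegral_le periodMeasure (f := fun x => ‖drift f p q (x, t + τ)‖ₑ)
      (by fun_prop)
    rw [measure_univ, one_mul] at h2
    exact (pow_le_pow_left' h1 2).trans h2
  have hi : ∀ τ, ∫⁻ t, ∫⁻ x, ‖drift f p q (x, t + τ)‖ₑ ^ 2 ∂periodMeasure ∂periodMeasure
      = ∫⁻ x in square, ‖drift f p q x‖ₑ ^ 2 := by
    intro τ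
    rw [volume_restrict_square, lintegral_prod_symm _ (by fun_prop)]
    refine lintegral_periodMeasure_add
      (g := fun t => ∫⁻ x, ‖drift f p q (x, t)‖ₑ ^ 2 ∂periodMeasure) (fun t => ?_) τ
    simp only [drift_add_one f hc.periodic_fst hc.periodic_snd]
  have h1 := ae_restrict_of_ae (s := Icc (-1 / 2 : ℝ) (1 / 2)) (hc.rise_sub hf ε)
  have hmem := ae_restrict_mem (μ := (volume : Measure ℝ)) (measurableSet_Icc
    (a := (-1 / 2 : ℝ)) (b := 1 / 2))
  change ∀ᵐ s ∂(volume.restrict (Icc (-1 / 2 : ℝ) (1 / 2))), _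
  filter_upwards [h1, hmem] with s h1 hs
  change ∀ᵐ s' ∂(volume.restrict (Icc (-1 / 2 : ℝ) (1 / 2))), _
  filter_upwards [ae_restrict_of_ae h1, hmem] with s' h1 hs'
  calc ∫⁻ t, ‖rise f q ε (s, t) - rise f q ε (s', t)‖ₑ ^ 2 ∂periodMeasure
      ≤ ∫⁻ t, 2 * ((∫⁻ x, ‖drift f p q (x, t + ε)‖ₑ ^ 2 ∂periodMeasure)
          + ∫⁻ x, ‖drift f p q (x, t + 0)‖ₑ ^ 2 ∂periodMeasure) ∂periodMeasure := by
        refine lintegral_mono_ae ?_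
        have h1' : ∀ᵐ t ∂periodMeasure, _ := ae_restrict_of_ae h1
        filter_upwards [h1'] with t ht
        rw [ht]
        refine (pow_le_pow_left' (enorm_sub_le) 2).trans ((ennreal_add_sq_le _ _).trans ?_)
        gcongr
        · exact hb ε t s s' hs hs'
        · simpa using hb 0 t s s' hs hs'
    _ = 4 * ∫⁻ x in square, ‖drift f p q x‖ₑ ^ 2 := by
        have m : ∀ τ, Measurable fun t => ∫⁻ x, ‖drift f p q (x, t + τ)‖ₑ ^ 2 ∂periodMeasure :=
          fun τ => Measurable.lintegral_prod_left' (f := fun z : ℝ × ℝ =>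
            ‖drift f p q (z.1, z.2 + τ)‖ₑ ^ 2) (by fun_prop)
        rw [lintegral_const_mul' _ _ (by simp), lintegral_add_right _ (m 0), hi, hi]
        ring

theorem IsSign.measurable_rise (hf : IsSign f) (hq : Measurable q) {ε : ℝ} (hε : 0 ≤ ε) :
    Measurable (rise f q ε) := by
  have hm := hf.continuous_shear.measurable
  have h1 : StronglyMeasurable fun z : (ℝ × ℝ) × ℝ => q (shear f z.1 + (0, z.2)) :=
    Measurable.stronglyMeasurable (by fun_prop)
  have h2 := (h1.integral_prod_right' (ν := volume.restrict (Ioc 0 ε))).measurable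
  have h3 : rise f q ε = fun x => ∫ τ in Ioc 0 ε, q (shear f x + (0, τ)) := by
    ext x; exact intervalIntegral.integral_of_le hε
  rwa [h3]

/-- A function of bounded variation is close to the vertical averages, in sheared coordinates, of
an approximation of it. -/
theorem lintegral_sub_rise_sq_le (hf : IsSign f) (hqm : Measurable q) (hqb : ∀ x, |q x| ≤ C)
    (hq : Periodic2 q) (hh : Measurable h) (hs : ∀ x, h x = 1 ∨ h x = -1) (hp : Periodic2 h)
    {A : ℝ≥0∞} {V ε : ℝ} (hε : 0 < ε) (hV0 : 0 ≤ V)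
    (hV : ∀ T, 0 ≤ T → ∫⁻ x in square, ‖h x - h (x + (0, T))‖ₑ ≤ ENNReal.ofReal (T * V))
    (hqA : ∫⁻ x in square, ‖q x - h x‖ₑ ^ 2 ≤ A) :
    ∫⁻ x in square, ‖h (shear f x) - ε⁻¹ * rise f q ε x‖ₑ ^ 2
      ≤ 2 * (2 * ENNReal.ofReal (ε * V) + A) := by
  have hm := hf.continuous_shear.measurable
  have hinv : ENNReal.ofReal ε⁻¹ * ENNReal.ofReal ε = 1 := by
    rw [← ENNReal.ofReal_mul (by positivity), inv_mul_cancel₀ hε.ne', ENNReal.ofReal_one]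
  -- the averages of `h` and of `q` are compared by Jensen's inequality
  have h1 : ∀ x, ‖h (shear f x) - ε⁻¹ * rise f q ε x‖ₑ ^ 2 ≤ ENNReal.ofReal ε⁻¹ *
      ∫⁻ τ in Ioc 0 ε, ‖h (shear f x) - q (shear f x + (0, τ))‖ₑ ^ 2 := by
    intro x
    have e1 : h (shear f x) - ε⁻¹ * rise f q ε x
        = ε⁻¹ * ∫ τ in Ioc 0 ε, (h (shear f x) - q (shear f x + (0, τ))) := by
      have hi : Integrable (fun τ => q (shear f x + (0, τ))) (volume.restrict (Ioc 0 ε)) :=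
        Integrable.of_bound (C := C) (Measurable.aestronglyMeasurable (by fun_prop))
          (Eventually.of_forall fun τ => hqb _)
      rw [integral_sub (integrable_const _) hi, rise,
          intervalIntegral.integral_of_le hε.le, mul_sub]
      congr 1
      simp [hε.le, ← mul_assoc, inv_mul_cancel₀ hε.ne']
    have e2 := sq_lintegral_le (volume.restrict (Ioc 0 ε))
      (f := fun τ => ‖h (shear f x) - q (shear f x + (0, τ))‖ₑ) (by fun_prop)
    rw [Measure.restrict_apply_univ, Real.volume_Ioc, sub_zero] at e2
    rw [e1, enorm_mul, mul_pow, Real.enorm_of_nonneg (by positivity : 0 ≤ ε⁻¹)]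
    calc _ ≤ ENNReal.ofReal ε⁻¹ ^ 2 * (ENNReal.ofReal ε *
          ∫⁻ τ in Ioc 0 ε, ‖h (shear f x) - q (shear f x + (0, τ))‖ₑ ^ 2) := by
          gcongr
          exact (pow_le_pow_left' (enorm_integral_le_lintegral_enorm _) 2).trans e2
      _ = (ENNReal.ofReal ε⁻¹ * ENNReal.ofReal ε) * (ENNReal.ofReal ε⁻¹ *
          ∫⁻ τ in Ioc 0 ε, ‖h (shear f x) - q (shear f x + (0, τ))‖ₑ ^ 2) := by ring
      _ = _ := by rw [hinv, one_mul]
  have h2 : ∀ τ ∈ Ioc 0 ε, ∫⁻ x in square, ‖h (shear f x) - q (shear f x + (0, τ))‖ₑ ^ 2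
      ≤ 2 * (2 * ENNReal.ofReal (ε * V) + A) := by
    intro τ hτ
    have hper := hq.comp_add (0, τ)
    have hper' := hp.comp_add (0, τ)
    refine (lintegral_square_comp_shear hf (g := fun x => ‖h x - q (x + (0, τ))‖ₑ ^ 2) (by fun_prop)
      fun s t => by simp only [(hp s t).2, (hper s t).2]).trans_le ?_
    have e1 : ∀ x, ‖h x - q (x + (0, τ))‖ₑ ^ 2
        ≤ 2 * (2 * ‖h x - h (x + (0, τ))‖ₑ + ‖q (x + (0, τ)) - h (x + (0, τ))‖ₑ ^ 2) := by
      intro x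
      rw [← enorm_sub_sq_of_sign (hs _) (hs _), enorm_sub_rev (q _)]
      refine le_trans ?_ (ennreal_add_sq_le _ _)
      gcongr
      rw [← sub_add_sub_cancel (h x) (h (x + (0, τ))) (q (x + (0, τ)))]
      exact enorm_add_le _ _
    have e2 : ∫⁻ x in square, ‖q (x + (0, τ)) - h (x + (0, τ))‖ₑ ^ 2
        = ∫⁻ x in square, ‖q x - h x‖ₑ ^ 2 := by
      rw [← lintegral_square_shear (g := fun x => ‖q x - h x‖ₑ ^ 2) (F := fun _ => τ) (by fun_prop)
        measurable_const fun s t => by simp only [(hp s t).2, (hq s t).2]]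
      simp [Prod.add_def]
    have m1 : Measurable fun x => 2 * ‖h x - h (x + (0, τ))‖ₑ := by fun_prop
    have m2 : Measurable fun x => ‖h x - h (x + (0, τ))‖ₑ := by fun_prop
    refine (lintegral_mono e1).trans ?_
    rw [lintegral_const_mul' _ _ (by simp), lintegral_add_left m1, lintegral_const_mul _ m2, e2]
    gcongr
    exact (hV τ hτ.1.le).trans (ENNReal.ofReal_le_ofReal (by gcongr; exact hτ.2))
  have mz : Measurable fun z : (ℝ × ℝ) × ℝ =>
      ‖h (shear f z.1) - q (shear f z.1 + (0, z.2))‖ₑ ^ 2 := by fun_prop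
  refine (lintegral_mono h1).trans ?_
  rw [lintegral_const_mul' _ _ ENNReal.ofReal_ne_top, lintegral_lintegral_swap mz.aemeasurable]
  calc _ ≤ ENNReal.ofReal ε⁻¹ *
        ∫⁻ τ in Ioc 0 ε, 2 * (2 * ENNReal.ofReal (ε * V) + A) := by
        gcongr ENNReal.ofReal ε⁻¹ * ?_
        exact setLIntegral_mono measurable_const h2
    _ = (ENNReal.ofReal ε⁻¹ * ENNReal.ofReal ε) * (2 * (2 * ENNReal.ofReal (ε * V) + A)) := by
        rw [setLIntegral_const, Real.volume_Ioc, sub_zero]; ring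
    _ = _ := by rw [hinv, one_mul]

/-- In sheared coordinates, `h` is close to its trace on a suitable vertical line. -/
theorem exists_trace (hf : IsSign f) (hqm : Measurable q) (hh : Measurable h) {N R : ℝ≥0∞} {ε : ℝ}
    (hε : 0 < ε)
    (hN : ∫⁻ x in square, ‖h (shear f x) - ε⁻¹ * rise f q ε x‖ₑ ^ 2 ≤ N)
    (hR : ∀ᵐ s ∂periodMeasure, ∀ᵐ s' ∂periodMeasure,
      ∫⁻ t, ‖rise f q ε (s, t) - rise f q ε (s', t)‖ₑ ^ 2 ∂periodMeasure ≤ R) :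
    ∃ s, ∫⁻ x in square, ‖h (shear f x) - h (shear f (s, x.2))‖ₑ ^ 2
      ≤ 6 * N + 3 * ENNReal.ofReal ε⁻¹ ^ 2 * R := by
  have hm := hf.continuous_shear.measurable
  have hr := hf.measurable_rise hqm hε.le
  set X : ℝ × ℝ → ℝ := fun x => h (shear f x) - ε⁻¹ * rise f q ε x with hX
  have hXm : Measurable X := by fun_prop
  set Y : ℝ → ℝ≥0∞ := fun s => ∫⁻ t, ‖X (s, t)‖ₑ ^ 2 ∂periodMeasure with hY
  have hYm : Measurable Y :=
    Measurable.lintegral_prod_right' (f := fun z : ℝ × ℝ => ‖X z‖ₑ ^ 2) (by fun_prop)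
  have hYN : ∫⁻ s, Y s ∂periodMeasure ≤ N := by
    rwa [volume_restrict_square, lintegral_prod _ (by fun_prop)] at hN
  set r := ENNReal.ofReal ε⁻¹
  have key : ∀ s s' t, ‖h (shear f (s', t)) - h (shear f (s, t))‖ₑ ^ 2
      ≤ 3 * (‖X (s', t)‖ₑ ^ 2 + r ^ 2 * ‖rise f q ε (s, t) - rise f q ε (s', t)‖ₑ ^ 2
        + ‖X (s, t)‖ₑ ^ 2) := by
    intro s s' t
    have e1 : r * ‖rise f q ε (s, t) - rise f q ε (s', t)‖ₑ
        = ‖ε⁻¹ * (rise f q ε (s', t) - rise f q ε (s, t))‖ₑ := by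
      rw [enorm_mul, Real.enorm_of_nonneg (by positivity : 0 ≤ ε⁻¹), enorm_sub_rev]
    rw [← mul_pow, e1]
    refine le_trans ?_ (ennreal_add_add_sq_le _ _ _)
    gcongr
    calc ‖h (shear f (s', t)) - h (shear f (s, t))‖ₑ
        = ‖X (s', t) + ε⁻¹ * (rise f q ε (s', t) - rise f q ε (s, t)) + -X (s, t)‖ₑ := by
          congr 1; simp only [hX]; ring
      _ ≤ _ := by
          refine (enorm_add_le _ _).trans ?_
          rw [enorm_neg]
          exact add_le_add_left (enorm_add_le _ _) _
  have mX : ∀ s, Measurable fun t => ‖X (s, t)‖ₑ ^ 2 := fun s => by fun_prop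
  have mD : ∀ s s', Measurable fun t =>
      r ^ 2 * ‖rise f q ε (s, t) - rise f q ε (s', t)‖ₑ ^ 2 := fun s s' => by fun_prop
  set Q : ℝ → ℝ≥0∞ := fun s => ∫⁻ x in square, ‖h (shear f x) - h (shear f (s, x.2))‖ₑ ^ 2
  have hQ : ∀ᵐ s ∂periodMeasure, Q s ≤ 3 * (N + r ^ 2 * R + Y s) := by
    filter_upwards [hR] with s hs
    simp only [Q]
    rw [volume_restrict_square, lintegral_prod _ (by fun_prop)]
    calc _ ≤ ∫⁻ s', 3 * (Y s' + r ^ 2 * R + Y s) ∂periodMeasure := by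
          refine lintegral_mono_ae ?_
          filter_upwards [hs] with s' hs'
          refine (lintegral_mono (key s s')).trans ?_
          rw [lintegral_const_mul' _ _ (by simp), lintegral_add_right _ (mX s),
            lintegral_add_right _ (mD s s'), lintegral_const_mul' _ _ (by simp [r])]
          gcongr
      _ ≤ _ := by
          rw [lintegral_const_mul' _ _ (by simp), lintegral_add_right _ measurable_const,
            lintegral_add_right _ measurable_const, lintegral_const, lintegral_const, measure_univ,
            mul_one, mul_one]
          gcongr
  have hQm : Measurable Q := Measurable.lintegral_prod_right' (f := fun z : ℝ × (ℝ × ℝ) =>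
    ‖h (shear f z.2) - h (shear f (z.1, z.2.2))‖ₑ ^ 2) (by fun_prop)
  -- the error averaged over all vertical lines is bounded, so some line is good
  obtain ⟨s, hs⟩ := exists_le_lintegral (μ := periodMeasure) hQm.aemeasurable
  refine ⟨s, hs.trans ((lintegral_mono_ae hQ).trans ?_)⟩
  rw [lintegral_const_mul' _ _ (by simp), lintegral_add_left measurable_const, lintegral_const,
    measure_univ, mul_one]
  calc _ ≤ 3 * (N + r ^ 2 * R + N) := by gcongr
    _ = _ := by ring

end Shear

/-! ### Covariance on the torus -/

section Shear
variable {f : ℝ → ℝ} {p q h w : ℝ × ℝ → ℝ} {C : ℝ}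

/-- Over a full period in the vertical variable, the drift does not contribute. -/
theorem IsCurlCompat.rise_one_eq (hc : IsCurlCompat p q C) (hf : IsSign f) :
    ∀ᵐ s, ∀ᵐ s', ∀ᵐ t, rise f q 1 (s, t) = rise f q 1 (s', t) := by
  filter_upwards [hc.rise_sub hf 1] with s h1
  filter_upwards [h1] with s' h2
  filter_upwards [h2] with t h3
  simp only [drift_add_one f hc.periodic_fst hc.periodic_snd, sub_self] at h3
  exact sub_eq_zero.1 h3

/-- Over a full period, the vertical integrals do not see the shear. -/
theorem rise_one (f : ℝ → ℝ) (hq : Periodic2 q) (s t : ℝ) :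
    rise f q 1 (s, t) = ∫ t, q (s, t) ∂periodMeasure := by
  have e : ∀ τ, shear f (s, t) + (0, τ) = (s, (shear f (s, t)).2 + τ) := fun τ => by
    ext <;> simp [shear]
  rw [periodMeasure_eq_Ioc _ rfl, ← intervalIntegral.integral_of_le (by norm_num), rise]
  simp only [e]
  rw [intervalIntegral.integral_comp_add_left (fun t => q (s, t)), add_zero]
  exact (hq.snd s).intervalIntegral_add_eq _ _

/-- The means of `q` over vertical lines do not depend on the line, so `q` is uncorrelated with
functions of the horizontal variable. -/
theorem IsCurlCompat.integral_mul_fst (hc : IsCurlCompat p q C) (hf : IsSign f) :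
    ∫ x in square, q x * f x.1 = (∫ x in square, q x) * ∫ x in square, f x.1 := by
  have hfm := hf.1
  have hqm := hc.measurable_snd
  have hi : Integrable (fun x : ℝ × ℝ => q x * f x.1) (periodMeasure.prod periodMeasure) :=
    Integrable.of_bound (C := C) (Measurable.aestronglyMeasurable (by fun_prop))
      (Eventually.of_forall fun x => by
        rw [norm_mul]
        exact (mul_le_of_le_one_right (norm_nonneg _) (hf.norm_le_one _)).trans (hc.bound_snd x))
  have hi2 : Integrable (fun x : ℝ × ℝ => f x.1) (periodMeasure.prod periodMeasure) :=
    Integrable.of_bound (C := 1) (Measurable.aestronglyMeasurable (by fun_prop))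
      (Eventually.of_forall fun x => hf.norm_le_one _)
  have hi3 : Integrable q (periodMeasure.prod periodMeasure) :=
    Integrable.of_bound (C := C) hqm.aestronglyMeasurable (Eventually.of_forall hc.bound_snd)
  obtain ⟨s, hs⟩ := (hc.rise_one_eq hf).exists
  have hm : ∀ᵐ s' ∂periodMeasure, ∫ t, q (s', t) ∂periodMeasure
      = ∫ t, q (s, t) ∂periodMeasure := by
    refine ae_restrict_of_ae ?_
    filter_upwards [hs] with s' hs'
    obtain ⟨t, ht⟩ := hs'.exists
    rw [← rise_one f hc.periodic_snd s t, ← rise_one f hc.periodic_snd s' t, ht]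
  rw [volume_restrict_square, integral_prod _ hi, integral_prod _ hi2, integral_prod _ hi3,
    integral_congr_ae hm]
  simp only [integral_mul_const, integral_const, probReal_univ, one_smul]
  rw [← integral_const_mul]
  refine integral_congr_ae ?_
  filter_upwards [hm] with s' hs'
  rw [hs']

theorem abs_integral_square_le {g k : ℝ × ℝ → ℝ} (hk : Integrable k (volume.restrict square))
    (h : ∀ x, |g x| ≤ k x) : |∫ x in square, g x| ≤ ∫ x in square, k x := by
  rw [← Real.norm_eq_abs]
  exact norm_integral_le_of_norm_le hk (Eventually.of_forall h)

/-- If `q` is close to `h` and `w` is close to a function of the horizontal variable, then `h` and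
`w` are almost uncorrelated. -/
theorem IsCurlCompat.abs_covariance_le (hc : IsCurlCompat p q C) (hf : IsSign f)
    (hh : Measurable h) (hw : Measurable w) (hs : ∀ x, h x = 1 ∨ h x = -1)
    (ws : ∀ x, w x = 1 ∨ w x = -1) {A κ : ℝ} (hA : 0 ≤ A)
    (hqA : ∫⁻ x in square, ‖q x - h x‖ₑ ^ 2 ≤ ENNReal.ofReal A)
    (hκ : ∫ x in square, |w x - f x.1| ≤ κ) :
    |(∫ x in square, w x * h x) - (∫ x in square, h x) * ∫ x in square, w x|
      ≤ 2 * √A + 2 * κ := by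
  have hfm := hf.1
  have hqm := hc.measurable_snd
  have hs1 : ∀ x, |h x| = 1 := fun x => by rcases hs x with e | e <;> simp [e]
  have ws1 : ∀ x, |w x| = 1 := fun x => by rcases ws x with e | e <;> simp [e]
  have fs1 : ∀ x, |f x| = 1 := fun x => by rcases hf.2 x with e | e <;> simp [e]
  have bi : ∀ {g : ℝ × ℝ → ℝ} (D : ℝ), Measurable g → (∀ x, |g x| ≤ D) →
      Integrable g (volume.restrict square) := fun D hg hb =>
    Integrable.of_bound (C := D) hg.aestronglyMeasurable (Eventually.of_forall hb)
  have ih := bi 1 hh fun x => (hs1 x).le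
  have iw := bi 1 hw fun x => (ws1 x).le
  have iq := bi C hqm hc.bound_snd
  have if' : Integrable (fun x : ℝ × ℝ => f x.1) (volume.restrict square) :=
    bi 1 (by fun_prop) fun x => (fs1 _).le
  have iwh : Integrable (fun x => w x * h x) (volume.restrict square) :=
    bi 1 (by fun_prop) fun x => by rw [abs_mul, hs1, ws1, one_mul]
  have iqf : Integrable (fun x : ℝ × ℝ => q x * f x.1) (volume.restrict square) :=
    bi C (by fun_prop) fun x => by rw [abs_mul, fs1, mul_one]; exact hc.bound_snd x
  have iα : Integrable (fun x => |q x - h x|) (volume.restrict square) := (iq.sub ih).abs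
  have iκ : Integrable (fun x : ℝ × ℝ => |w x - f x.1|) (volume.restrict square) := (iw.sub if').abs
  have hα : ∫ x in square, |q x - h x| ≤ √A := by
    refine Real.le_sqrt_of_sq_le ?_
    have e1 := sq_lintegral_le (volume.restrict square) (f := fun x => ‖q x - h x‖ₑ) (by fun_prop)
    rw [measure_univ, one_mul, 
      ← ofReal_integral_norm_eq_lintegral_enorm (f := fun x => q x - h x) (iq.sub ih)] at e1
    have e2 := e1.trans hqA
    rw [← ENNReal.ofReal_pow (integral_nonneg fun x => norm_nonneg _)] at e2
    exact (ENNReal.ofReal_le_ofReal_iff hA).1 e2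
  have b1 : |∫ x in square, (w x * h x - q x * f x.1)| ≤ κ + √A := by
    refine (abs_integral_square_le (iκ.add iα) fun x => ?_).trans ?_
    · rw [show w x * h x - q x * f x.1 = h x * (w x - f x.1) - f x.1 * (q x - h x) by ring]
      refine (abs_sub _ _).trans (le_of_eq ?_)
      rw [abs_mul, abs_mul, hs1, fs1, one_mul, one_mul]; rfl
    · simp only [Pi.add_apply]
      rw [integral_add iκ iα]
      exact add_le_add hκ hα
  have b2 : |(∫ x in square, q x) - ∫ x in square, h x| ≤ √A := by
    rw [← integral_sub iq ih]
    exact (abs_integral_square_le iα fun x => le_rfl).trans hα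
  have b3 : |(∫ x in square, w x) - ∫ x in square, f x.1| ≤ κ := by
    rw [← integral_sub iw if']
    exact (abs_integral_square_le iκ fun x => le_rfl).trans hκ
  have b4 : |∫ x in square, h x| ≤ 1 := by
    simpa using abs_integral_square_le (integrable_const 1) fun x => (hs1 x).le
  have b5 : |∫ x in square, f x.1| ≤ 1 := by
    simpa using abs_integral_square_le (g := fun x : ℝ × ℝ => f x.1) (integrable_const 1)
      fun x => (fs1 x.1).le
  rw [integral_sub iwh iqf, hc.integral_mul_fst hf] at b1
  set a1 := ∫ x in square, w x * h x
  set a2 := ∫ x in square, q x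
  set a3 := ∫ x in square, h x
  set a4 := ∫ x in square, w x
  set a5 := ∫ x in square, f x.1
  have b6 : |(a2 - a3) * a5| ≤ √A := by
    rw [abs_mul]; exact (mul_le_of_le_one_right (abs_nonneg _) b5).trans b2
  have b7 : |a3 * (a4 - a5)| ≤ κ := by
    rw [abs_mul]; exact (mul_le_of_le_one_left (abs_nonneg _) b4).trans b3
  rw [show a1 - a3 * a4 = (a1 - a2 * a5) + (a2 - a3) * a5 - a3 * (a4 - a5) by ring]
  have b8 := abs_sub ((a1 - a2 * a5) + (a2 - a3) * a5) (a3 * (a4 - a5))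
  have b9 := abs_add_le (a1 - a2 * a5) ((a2 - a3) * a5)
  linarith

end Shear

/-! ### Volume fractions and the energy on the torus -/

section Torus
variable {χ : Fin 4 → ℝ × ℝ → ℝ}

theorem IsPhase.modChar_eq_partner (h : IsPhase χ) (k : Fin 3) (x : ℝ × ℝ) :
    modChar χ k x = 2 * (χ 0 x + χ (partner k) x) - 1 := by
  have := h.sum_eq_one x
  fin_cases k <;> simp [modChar, partner] <;> linarith

theorem IsPhase.integrableOn_square (h : IsPhase χ) (i : Fin 4) :
    Integrable (χ i) (volume.restrict square) :=
  Integrable.of_bound (C := 1) (h.measurable i).aestronglyMeasurable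
    (Eventually.of_forall (h.abs_le_one i))

theorem IsPhase.integral_modChar (h : IsPhase χ) (k : Fin 3) :
    ∫ x in square, modChar χ k x = 2 * (volFrac χ 0 + volFrac χ (partner k)) - 1 := by
  have hi := h.integrableOn_square
  have i1 : Integrable (fun x => 2 * (χ 0 x + χ (partner k) x)) (volume.restrict square) :=
    ((hi _).add (hi _)).const_mul 2
  simp only [h.modChar_eq_partner]
  rw [integral_sub i1 (integrable_const _), integral_const_mul,
    integral_add (hi _) (hi _)]
  simp [volFrac]

theorem IsPhase.volFrac_sum (h : IsPhase χ) (σ : Equiv.Perm (Fin 3)) :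
    volFrac χ 0 + (volFrac χ (partner (σ 0)) + volFrac χ (partner (σ 1))
      + volFrac χ (partner (σ 2))) = 1 := by
  have hi := h.integrableOn_square
  have e := Equiv.sum_comp σ fun k => volFrac χ (partner k)
  simp only [Fin.sum_univ_three] at e
  rw [e]
  simp only [volFrac, partner]
  have e2 : ∫ x in square, (χ 0 x + (χ 3 x + χ 1 x + χ 2 x)) = 1 := by
    rw [integral_congr_ae (g := fun _ => (1 : ℝ)) (Eventually.of_forall fun x => ?_)]
    · simp
    · have := h.sum_eq_one x
      beta_reduce
      linarith
  have i1 : Integrable (fun x => χ 3 x + χ 1 x) (volume.restrict square) := (hi _).add (hi _)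
  have i2 : Integrable (fun x => χ 3 x + χ 1 x + χ 2 x) (volume.restrict square) := i1.add (hi _)
  rw [integral_add (hi _) i2, integral_add i1 (hi _), integral_add (hi _) (hi _)] at e2
  exact e2

/-- The incompatibility of the volume fractions is a covariance of two modified
characteristic functions. -/
theorem IsPhase.volFrac_eq_covariance (h : IsPhase χ) (σ : Equiv.Perm (Fin 3)) :
    volFrac χ 0 * (volFrac χ (partner (σ 1)) + volFrac χ (partner (σ 0)))
        - volFrac χ (partner (σ 0)) * (volFrac χ 0 + volFrac χ (partner (σ 2)))
      = ((∫ x in square, modChar χ (σ 2) x * modChar χ (σ 0) x)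
        - (∫ x in square, modChar χ (σ 0) x) * ∫ x in square, modChar χ (σ 2) x) / 4 := by
  simp only [← h.modChar_one_eq σ]
  rw [h.integral_modChar, h.integral_modChar, h.integral_modChar]
  have := h.volFrac_sum σ
  have e : volFrac χ (partner (σ 1)) = 1 - volFrac χ 0 - volFrac χ (partner (σ 0))
    - volFrac χ (partner (σ 2)) := by linarith
  rw [e]; ring

theorem phaseStrain_one_two (δ : ℝ) (χ : Fin 4 → ℝ × ℝ → ℝ) (σ : Equiv.Perm (Fin 3)) (x : ℝ × ℝ) :
    phaseStrain δ χ x (σ 1) (σ 2) = modChar χ (σ 0) x := by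
  simpa using phaseStrain_offDiag δ χ ((finRotate 3).trans σ) x

theorem phaseStrain_zero_two (δ : ℝ) (χ : Fin 4 → ℝ × ℝ → ℝ) (σ : Equiv.Perm (Fin 3)) (x : ℝ × ℝ) :
    phaseStrain δ χ x (σ 0) (σ 2) = modChar χ (σ 1) x := by
  have h0 : Equiv.swap (1 : Fin 3) 2 0 = 0 := by decide
  simpa [h0] using phaseStrain_offDiag δ χ ((Equiv.swap 1 2).trans σ) x

/-- The consequences of finite energy for a strain on the torus: the approximation of the
phase strain by a bounded field with vanishing curl and the control of translations. -/
theorem IsPlanarStrain.exists_field {σ : Equiv.Perm (Fin 3)} {δ η : ℝ}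
    {e : ℝ × ℝ → Matrix (Fin 3) (Fin 3) ℝ} (hη : 0 < η) (h : IsPhase χ)
    (hχ : ∀ i, Periodic2 (χ i)) (he : IsPlanarStrain σ univ e) (hp : Periodic2 e)
    (hE : torusEnergy δ η e χ ≤ 1) :
    ∃ (p q : ℝ × ℝ → ℝ) (C V A : ℝ), IsCurlCompat p q C ∧ 0 ≤ V ∧ 0 ≤ A ∧
      (torusEnergy δ η e χ).toReal = η ^ (1 / 3 : ℝ) * V + η ^ (-2 / 3 : ℝ) * A ∧
      (∀ T, 0 ≤ T → ∫⁻ x in square, ‖modChar χ (σ 0) x - modChar χ (σ 0) (x + (0, T))‖ₑ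
        ≤ ENNReal.ofReal (T * (2 * V))) ∧
      (∫⁻ x in square, ‖q x - modChar χ (σ 0) x‖ₑ ^ 2 ≤ ENNReal.ofReal A) ∧
      ∫⁻ x in square, ‖p x - modChar χ (σ 2) x * modChar χ (σ 0) x‖ₑ ^ 2 ≤ ENNReal.ofReal A := by
  obtain ⟨p, q, C, hc, hpe, hqe⟩ := he.exists_isCurlCompat hp
  obtain ⟨hS, hA, hEe⟩ := energy_parts hη hE
  refine ⟨p, q, C, _, _, hc, ENNReal.toReal_nonneg, ENNReal.toReal_nonneg, hEe, ?_, ?_, ?_⟩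
  · intro T hT
    have h1 := h.integral_modChar_le hχ hS (σ 0) hT
    have h2 := h.measurable_modChar (σ 0)
    simp only [Prod.smul_mk, smul_eq_mul, mul_zero, mul_one] at h1
    exact lintegral_enorm_le_of_integral_abs isCompact_square.measure_ne_top (by fun_prop)
      (fun x => h.abs_modChar_sub_le_two _ _ _) h1
  · rw [ENNReal.ofReal_toReal hA]
    refine lintegral_mono_ae ?_
    filter_upwards [ae_restrict_of_ae hqe] with x hx
    have := enorm_entry_le_strainDefect δ e χ x (σ 1) (σ 2)
    rw [phaseStrain_one_two, ← hx] at this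
    exact (pow_le_pow_left' this 2).trans (strainDefect_sq δ e χ x).le
  · rw [ENNReal.ofReal_toReal hA]
    refine lintegral_mono_ae ?_
    filter_upwards [ae_restrict_of_ae hpe] with x hx
    have := enorm_entry_le_strainDefect δ e χ x (σ 0) (σ 2)
    rw [phaseStrain_zero_two, ← hx, h.modChar_one_eq σ] at this
    exact (pow_le_pow_left' this 2).trans (strainDefect_sq δ e χ x).le

end Torus

/-! ### The choice of the averaging length -/

/-- The errors of averages over the full period, when `b ≤ a`, that is, when the averaging length
`a / b` would exceed one. -/
theorem long_average_bound {a b V A : ℝ} (ha : 0 < a) (ha1 : a ≤ 1) (hb : 0 ≤ b) (hba : b ≤ a)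
    (hV : a ^ 3 * V ≤ b ^ 6) (hA : A ≤ a ^ 6 * b ^ 6) :
    24 * (2 * V) + 12 * A ≤ 60 * (b ^ 5 / a ^ 2) := by
  have h1 : V ≤ b ^ 5 / a ^ 2 := by
    rw [le_div_iff₀ (by positivity)]
    refine le_of_mul_le_mul_left ?_ ha
    calc a * (V * a ^ 2) = a ^ 3 * V := by ring
      _ ≤ b ^ 6 := hV
      _ = b * b ^ 5 := by ring
      _ ≤ a * b ^ 5 := by gcongr
  have h2 : A ≤ b ^ 5 / a ^ 2 := by
    rw [le_div_iff₀ (by positivity)]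
    calc A * a ^ 2 ≤ a ^ 6 * b ^ 6 * a ^ 2 := by gcongr
      _ = a ^ 8 * (b * b ^ 5) := by ring
      _ ≤ 1 * (1 * b ^ 5) := by
          gcongr
          · exact pow_le_one₀ ha.le ha1
          · exact hba.trans ha1
      _ = b ^ 5 := by ring
  linarith

/-- The errors of averages of length `a / b ≤ 1`. -/
theorem short_average_bound {a b V A K : ℝ} (ha : 0 < a) (ha1 : a ≤ 1) (hb1 : b ≤ 1)
    (hab : a ≤ b) (hV : a ^ 3 * V ≤ b ^ 6) (hA : A ≤ a ^ 6 * b ^ 6) :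
    24 * (a / b * (2 * V)) + 12 * A + 72 * ((b / a) ^ 2 * (A + K * b ^ 3))
      ≤ (132 + 72 * K) * (b ^ 5 / a ^ 2) := by
  have hb : 0 < b := ha.trans_le hab
  have h1 : a / b * V ≤ b ^ 5 / a ^ 2 := by
    rw [div_mul_eq_mul_div, div_le_div_iff₀ hb (by positivity)]
    calc a * V * a ^ 2 = a ^ 3 * V := by ring
      _ ≤ b ^ 6 := hV
      _ = b ^ 5 * b := by ring
  have h2 : A ≤ b ^ 5 / a ^ 2 := by
    rw [le_div_iff₀ (by positivity)]
    calc A * a ^ 2 ≤ a ^ 6 * b ^ 6 * a ^ 2 := by gcongr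
      _ = a ^ 8 * (b * b ^ 5) := by ring
      _ ≤ 1 * (1 * b ^ 5) := by
          gcongr
          exact pow_le_one₀ ha.le ha1
      _ = b ^ 5 := by ring
  have h3 : A ≤ b ^ 3 := by
    calc A ≤ a ^ 6 * b ^ 6 := hA
      _ = a ^ 6 * (b ^ 3 * b ^ 3) := by ring
      _ ≤ 1 * (1 * b ^ 3) := by
          gcongr
          · exact pow_le_one₀ ha.le ha1
          · exact pow_le_one₀ hb.le hb1
      _ = b ^ 3 := by ring
  have h4 : (b / a) ^ 2 * A ≤ b ^ 5 / a ^ 2 := by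
    calc (b / a) ^ 2 * A ≤ (b / a) ^ 2 * b ^ 3 := by gcongr
      _ = b ^ 5 / a ^ 2 := by rw [div_pow]; ring
  have h5 : (b / a) ^ 2 * (K * b ^ 3) = K * (b ^ 5 / a ^ 2) := by rw [div_pow]; ring
  rw [mul_add, h5]
  linarith

section Shear
variable {f : ℝ → ℝ} {p q h w : ℝ × ℝ → ℝ} {C : ℝ}

/-- In sheared coordinates, `h` is close to a function of the second variable. In terms of the
energy `E` and the parameter `η`, the numbers are `a = η ^ (1 / 9)` and `b = E ^ (1 / 6)`. -/
theorem IsCurlCompat.exists_profile (hc : IsCurlCompat p q C) (hf : IsSign f)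
    (hh : Measurable h) (hw : Measurable w) (hs : ∀ x, h x = 1 ∨ h x = -1)
    (ws : ∀ x, w x = 1 ∨ w x = -1) (hp : Periodic2 h) {a b V A K : ℝ} (ha : 0 < a) (ha1 : a ≤ 1)
    (hb : 0 ≤ b) (hb1 : b ≤ 1) (hK : 0 ≤ K) (hV0 : 0 ≤ V) (hA0 : 0 ≤ A)
    (hV : ∀ T, 0 ≤ T → ∫⁻ x in square, ‖h x - h (x + (0, T))‖ₑ ≤ ENNReal.ofReal (T * (2 * V)))
    (hqA : ∫⁻ x in square, ‖q x - h x‖ₑ ^ 2 ≤ ENNReal.ofReal A)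
    (hpA : ∫⁻ x in square, ‖p x - w x * h x‖ₑ ^ 2 ≤ ENNReal.ofReal A)
    (hκ : ∫⁻ x in square, ‖w x - f x.1‖ₑ ≤ ENNReal.ofReal (K * b ^ 3))
    (haV : a ^ 3 * V ≤ b ^ 6) (hAab : A ≤ a ^ 6 * b ^ 6) :
    ∃ g : ℝ → ℝ, Measurable g ∧ Function.Periodic g 1 ∧
      ∫⁻ x in square, ‖h (shear f x) - g x.2‖ₑ ^ 2
        ≤ ENNReal.ofReal ((132 + 72 * K) * (b ^ 5 / a ^ 2)) := by
  have hm := hf.continuous_shear.measurable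
  -- it suffices to find a good vertical line
  suffices H : ∃ s, ∫⁻ x in square, ‖h (shear f x) - h (shear f (s, x.2))‖ₑ ^ 2
      ≤ ENNReal.ofReal ((132 + 72 * K) * (b ^ 5 / a ^ 2)) by
    obtain ⟨s, hs⟩ := H
    refine ⟨fun t => h (shear f (s, t)), by fun_prop, fun t => ?_, hs⟩
    simp only [shear_add, hp.add_one_snd]
  have hN := fun {ε : ℝ} (hε : 0 < ε) => lintegral_sub_rise_sq_le hf hc.measurable_snd hc.bound_snd
    hc.periodic_snd hh hs hp hε (by positivity) hV hqA
  rcases le_or_gt a b with hab | hab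
  · -- averages of length `a / b` balance the translation error and the drift
    have hb0 : 0 < b := ha.trans_le hab
    have hε : 0 < a / b := by positivity
    have hD := lintegral_drift_sq_le hf hc.measurable_fst hc.measurable_snd hc.periodic_fst
      hc.periodic_snd hh hw hs ws hqA hpA hκ
    obtain ⟨s, h1⟩ := exists_trace hf hc.measurable_snd hh hε (hN hε)
      (hc.lintegral_rise_sub_sq_le hf (a / b))
    refine ⟨s, h1.trans ?_⟩
    calc _ ≤ 6 * (2 * (2 * ENNReal.ofReal (a / b * (2 * V)) + ENNReal.ofReal A))
          + 3 * ENNReal.ofReal (a / b)⁻¹ ^ 2 *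
            (4 * (6 * (ENNReal.ofReal A + ENNReal.ofReal (K * b ^ 3)))) := by gcongr
      _ = 24 * ENNReal.ofReal (a / b * (2 * V)) + 12 * ENNReal.ofReal A
          + 72 * (ENNReal.ofReal (a / b)⁻¹ ^ 2 *
            (ENNReal.ofReal A + ENNReal.ofReal (K * b ^ 3))) := by ring
      _ = ENNReal.ofReal (24 * (a / b * (2 * V)) + 12 * A
          + 72 * ((b / a) ^ 2 * (A + K * b ^ 3))) := by
        rw [inv_div, ENNReal.ofReal_add (by positivity) (by positivity),
          ENNReal.ofReal_add (by positivity) (by positivity),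
          ENNReal.ofReal_mul (by norm_num : (0 : ℝ) ≤ 24),
          ENNReal.ofReal_mul (by norm_num : (0 : ℝ) ≤ 12),
          ENNReal.ofReal_mul (by norm_num : (0 : ℝ) ≤ 72),
          ENNReal.ofReal_mul (by positivity : 0 ≤ (b / a) ^ 2),
          ENNReal.ofReal_pow (by positivity), ENNReal.ofReal_add hA0 (by positivity)]
        norm_num
      _ ≤ _ := ENNReal.ofReal_le_ofReal (short_average_bound ha ha1 hb1 hab haV hAab)
  · -- averages over the whole period, to which the drift does not contribute
    have hR : ∀ᵐ s ∂periodMeasure, ∀ᵐ s' ∂periodMeasure,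
        ∫⁻ t, ‖rise f q 1 (s, t) - rise f q 1 (s', t)‖ₑ ^ 2 ∂periodMeasure ≤ 0 := by
      have h1 : ∀ᵐ s ∂periodMeasure, _ := ae_restrict_of_ae (hc.rise_one_eq hf)
      filter_upwards [h1] with s h2
      have h2' : ∀ᵐ s ∂periodMeasure, _ := ae_restrict_of_ae h2
      filter_upwards [h2'] with s' h3
      have h3' : ∀ᵐ s ∂periodMeasure, _ := ae_restrict_of_ae h3
      rw [lintegral_congr_ae (g := fun _ => 0)]
      · simp
      · filter_upwards [h3'] with t ht
        simp [ht]
    obtain ⟨s, h1⟩ := exists_trace hf hc.measurable_snd hh one_pos (hN one_pos) hR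
    refine ⟨s, h1.trans ?_⟩
    calc _ = 24 * ENNReal.ofReal (2 * V) + 12 * ENNReal.ofReal A := by
          rw [one_mul, mul_zero, add_zero]; ring
      _ = ENNReal.ofReal (24 * (2 * V) + 12 * A) := by
        rw [ENNReal.ofReal_add (by positivity) (by positivity),
          ENNReal.ofReal_mul (by norm_num : (0 : ℝ) ≤ 24),
          ENNReal.ofReal_mul (by norm_num : (0 : ℝ) ≤ 12)]
        norm_num
      _ ≤ _ := ENNReal.ofReal_le_ofReal
        ((long_average_bound ha ha1 hb hab.le haV hAab).trans (by gcongr; linarith))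

theorem eLpNorm_two_sq {α : Type*} [MeasurableSpace α] (μ : Measure α) (g : α → ℝ) :
    eLpNorm g 2 μ ^ 2 = ∫⁻ x, ‖g x‖ₑ ^ 2 ∂μ := by
  have := eLpNorm_nnreal_pow_eq_lintegral (f := g) (μ := μ) (p := 2) two_ne_zero
  simpa using this

/-- The norm of the difference of the products of close functions with values `1` and `-1`. -/
theorem lintegral_mul_sub_mul_sq_le (hf : IsSign f) (hh : Measurable h) (hw : Measurable w)
    (hs : ∀ x, h x = 1 ∨ h x = -1) (ws : ∀ x, w x = 1 ∨ w x = -1) (hp : Periodic2 w) {g : ℝ → ℝ}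
    (hg : Measurable g) :
    ∫⁻ x in square, ‖w (shear f x) * h (shear f x) - f x.1 * g x.2‖ₑ ^ 2
      ≤ 4 * (∫⁻ x in square, ‖w x - f x.1‖ₑ)
        + 2 * ∫⁻ x in square, ‖h (shear f x) - g x.2‖ₑ ^ 2 := by
  have hm := hf.continuous_shear.measurable
  have hfm := hf.1
  have key : ∀ x, ‖w (shear f x) * h (shear f x) - f x.1 * g x.2‖ₑ ^ 2
      ≤ 4 * ‖w (shear f x) - f x.1‖ₑ + 2 * ‖h (shear f x) - g x.2‖ₑ ^ 2 := by
    intro x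
    have e1 : ‖h (shear f x)‖ₑ = 1 := by rcases hs (shear f x) with e | e <;> simp [e]
    have e2 : ‖f x.1‖ₑ = 1 := by rcases hf.2 x.1 with e | e <;> simp [e]
    have e3 : (4 : ℝ≥0∞) * ‖w (shear f x) - f x.1‖ₑ = 2 * ‖w (shear f x) - f x.1‖ₑ ^ 2 := by
      rw [enorm_sub_sq_of_sign (ws _) (hf.2 _), ← mul_assoc]; norm_num
    rw [e3, ← mul_add]
    refine le_trans ?_ (ennreal_add_sq_le _ _)
    gcongr
    calc _ = ‖(w (shear f x) - f x.1) * h (shear f x) + f x.1 * (h (shear f x) - g x.2)‖ₑ := by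
          congr 1; ring
      _ ≤ _ := by
          refine (enorm_add_le _ _).trans_eq ?_
          rw [enorm_mul, enorm_mul, e1, e2, mul_one, one_mul]
  have m1 : Measurable fun x : ℝ × ℝ => 2 * ‖h (shear f x) - g x.2‖ₑ ^ 2 := by fun_prop
  refine (lintegral_mono key).trans ?_
  rw [lintegral_add_right _ m1, lintegral_const_mul' _ _ (by simp),
    lintegral_const_mul' _ _ (by simp)]
  gcongr 4 * ?_ + _
  exact (lintegral_square_comp_shear hf (g := fun x => ‖w x - f x.1‖ₑ) (by fun_prop)
    fun s t => by simp only [(hp s t).2]).le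

end Shear

theorem Periodic2.modChar {χ : Fin 4 → ℝ × ℝ → ℝ} (h : ∀ i, Periodic2 (χ i)) (k : Fin 3) :
    Periodic2 (modChar χ k) := by
  intro s t
  fin_cases k <;> simp [CrossingTwins.modChar, fun i => (h i s t).1, fun i => (h i s t).2]

/-- On the torus: the estimate for the volume fractions and the profile in sheared coordinates. -/
theorem torus_estimates {K : ℝ} (hK : 0 < K) {σ : Equiv.Perm (Fin 3)} {δ η : ℝ}
    {χ : Fin 4 → ℝ × ℝ → ℝ} {e : ℝ × ℝ → Matrix (Fin 3) (Fin 3) ℝ} {f : ℝ → ℝ} (hη : 0 < η)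
    (hη1 : η ≤ 1) (h : IsPhase χ) (hχ : ∀ i, Periodic2 (χ i)) (he : IsPlanarStrain σ univ e)
    (hp : Periodic2 e) (hE : torusEnergy δ η e χ ≤ 1) (hf : IsSign f)
    (hfw : ∫ x in square, |modChar χ (σ 2) x - f x.1|
      ≤ K * (torusEnergy δ η e χ).toReal ^ (1 / 2 : ℝ)) :
    (|volFrac χ 0 * (volFrac χ (partner (σ 1)) + volFrac χ (partner (σ 0)))
        - volFrac χ (partner (σ 0)) * (volFrac χ 0 + volFrac χ (partner (σ 2)))|
      ≤ (264 + 148 * K) * (torusEnergy δ η e χ).toReal ^ (1 / 4 : ℝ)) ∧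
    ∃ g : ℝ → ℝ, Measurable g ∧
      eLpNorm (fun p : ℝ × ℝ => modChar χ (σ 0) (shear f p) - g p.2) 2
          (volume.restrict (shear f ⁻¹' square)) ^ 2
        ≤ ENNReal.ofReal ((264 + 148 * K) *
          (η ^ (-2 / 9 : ℝ) * (torusEnergy δ η e χ).toReal ^ (5 / 6 : ℝ))) ∧
      eLpNorm (fun p : ℝ × ℝ => modChar χ (σ 1) (shear f p) - f (shear f p).1 * g p.2) 2
          (volume.restrict (shear f ⁻¹' square))
        ≤ ENNReal.ofReal ((264 + 148 * K) *
          max (η ^ (-1 / 9 : ℝ) * (torusEnergy δ η e χ).toReal ^ (5 / 12 : ℝ))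
            ((torusEnergy δ η e χ).toReal ^ (1 / 4 : ℝ))) := by
  obtain ⟨p, q, C, V, A, hc, hV0, hA0, hEe, hV, hqA, hpA⟩ := he.exists_field hη h hχ hp hE
  set E := (torusEnergy δ η e χ).toReal with hEdef
  have hE0 : 0 ≤ E := ENNReal.toReal_nonneg
  have hE1 : E ≤ 1 := by simpa using ENNReal.toReal_mono ENNReal.one_ne_top hE
  set a : ℝ := η ^ (1 / 9 : ℝ) with ha
  set b : ℝ := E ^ (1 / 6 : ℝ) with hb
  have ha0 : 0 < a := Real.rpow_pos_of_pos hη _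
  have ha1 : a ≤ 1 := Real.rpow_le_one hη.le hη1 (by norm_num)
  have hb0 : 0 ≤ b := Real.rpow_nonneg hE0 _
  have hb1 : b ≤ 1 := Real.rpow_le_one hE0 hE1 (by norm_num)
  have eb6 : b ^ 6 = E := by rw [hb, ← Real.rpow_natCast, ← Real.rpow_mul hE0]; norm_num
  have eb3 : E ^ (1 / 2 : ℝ) = b ^ 3 := by
    rw [hb, ← Real.rpow_natCast, ← Real.rpow_mul hE0]; norm_num
  have eb5 : E ^ (5 / 6 : ℝ) = b ^ 5 := by
    rw [hb, ← Real.rpow_natCast, ← Real.rpow_mul hE0]; norm_num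
  have ea3 : η ^ (1 / 3 : ℝ) = a ^ 3 := by
    rw [ha, ← Real.rpow_natCast, ← Real.rpow_mul hη.le]; norm_num
  have ea6 : η ^ (-2 / 3 : ℝ) = (a ^ 6)⁻¹ := by
    rw [ha, ← Real.rpow_natCast, ← Real.rpow_mul hη.le, ← Real.rpow_neg hη.le]; norm_num
  have ea2 : η ^ (-2 / 9 : ℝ) = (a ^ 2)⁻¹ := by
    rw [ha, ← Real.rpow_natCast, ← Real.rpow_mul hη.le, ← Real.rpow_neg hη.le]; norm_num
  rw [ea3, ea6] at hEe
  have haV : a ^ 3 * V ≤ b ^ 6 := by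
    rw [eb6, hEe]; exact le_add_of_nonneg_right (by positivity)
  have hAab : A ≤ a ^ 6 * b ^ 6 := by
    rw [eb6, hEe, mul_add, mul_inv_cancel_left₀ (by positivity)]
    exact le_add_of_nonneg_left (by positivity)
  rw [eb3] at hfw
  have hhm := h.measurable_modChar (σ 0)
  have hwm := h.measurable_modChar (σ 2)
  have hfm := hf.1
  have hm := hf.continuous_shear.measurable
  have hs := h.modChar_eq (σ 0)
  have ws := h.modChar_eq (σ 2)
  have hhp := Periodic2.modChar hχ (σ 0)
  have hwp := Periodic2.modChar hχ (σ 2)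
  have hκ : ∫⁻ x in square, ‖modChar χ (σ 2) x - f x.1‖ₑ ≤ ENNReal.ofReal (K * b ^ 3) := by
    refine lintegral_enorm_le_of_integral_abs (C := 2) isCompact_square.measure_ne_top (by fun_prop)
      (fun x => ?_) hfw
    rcases ws x with e1 | e1 <;> rcases hf.2 x.1 with e2 | e2 <;> rw [e1, e2] <;> norm_num
  refine ⟨?_, ?_⟩
  · rw [h.volFrac_eq_covariance σ, abs_div, abs_of_pos (by norm_num : (0 : ℝ) < 4)]
    have h1 := hc.abs_covariance_le hf hhm hwm hs ws hA0 hqA hfw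
    have h2 : √A ≤ b ^ 3 := by
      refine Real.sqrt_le_iff.2 ⟨by positivity, hAab.trans ?_⟩
      calc a ^ 6 * b ^ 6 ≤ 1 * b ^ 6 := by gcongr; exact pow_le_one₀ ha0.le ha1
        _ = (b ^ 3) ^ 2 := by ring
    have h3 : b ^ 3 ≤ E ^ (1 / 4 : ℝ) := by
      rw [← eb3]; exact Real.rpow_le_rpow_of_exponent_ge_of_imp hE0 hE1 (by norm_num) (by norm_num)
    have h4 : 0 ≤ b ^ 3 := by positivity
    calc _ ≤ (2 * √A + 2 * (K * b ^ 3)) / 4 := by gcongr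
      _ ≤ (264 + 148 * K) * b ^ 3 := by nlinarith [mul_nonneg hK.le h4]
      _ ≤ _ := by gcongr
  · obtain ⟨g, hg, hgp, hgb⟩ := hc.exists_profile hf hhm hwm hs ws hhp ha0 ha1 hb0 hb1 hK.le hV0 hA0
      hV hqA hpA hκ haV hAab
    have hper : ∀ (k : Fin 3) (s t : ℝ), modChar χ k (shear f (s, t + 1))
        = modChar χ k (shear f (s, t)) := fun k s t => by
      rw [shear_add, (Periodic2.modChar hχ k).add_one_snd]
    have hT : 0 ≤ b ^ 5 / a ^ 2 := by positivity
    refine ⟨g, hg, ?_, ?_⟩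
    · rw [eLpNorm_two_sq, lintegral_preimage_shear hf (by fun_prop)
        fun s t => by simp only [hper, hgp t], ea2, eb5]
      refine hgb.trans (ENNReal.ofReal_le_ofReal ?_)
      rw [inv_mul_eq_div]
      gcongr <;> linarith
    · set m := max (η ^ (-1 / 9 : ℝ) * E ^ (5 / 12 : ℝ)) (E ^ (1 / 4 : ℝ)) with hmdef
      have hm0 : 0 ≤ m := le_max_of_le_right (Real.rpow_nonneg hE0 _)
      have hm1 : b ^ 5 / a ^ 2 ≤ m ^ 2 := by
        have e1 : b ^ 5 / a ^ 2 = (η ^ (-1 / 9 : ℝ) * E ^ (5 / 12 : ℝ)) ^ 2 := by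
          rw [← inv_mul_eq_div, ← ea2, ← eb5, mul_pow, ← Real.rpow_natCast, ← Real.rpow_natCast,
            ← Real.rpow_mul hη.le, ← Real.rpow_mul hE0]
          norm_num
        rw [e1]
        exact pow_le_pow_left₀ (by positivity) (le_max_left _ _) 2
      have hm2 : b ^ 3 ≤ m ^ 2 := by
        have e1 : b ^ 3 = (E ^ (1 / 4 : ℝ)) ^ 2 := by
          rw [← eb3, ← Real.rpow_natCast, ← Real.rpow_mul hE0]
          norm_num
        rw [e1]
        exact pow_le_pow_left₀ (by positivity) (le_max_right _ _) 2
      refine (ENNReal.pow_le_pow_left_iff two_ne_zero).1 ?_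
      have hmk := h.measurable_modChar (σ 1)
      change eLpNorm (fun x : ℝ × ℝ => modChar χ (σ 1) (shear f x) - f x.1 * g x.2) 2 _ ^ 2 ≤ _
      rw [eLpNorm_two_sq, lintegral_preimage_shear hf (by fun_prop)
        fun s t => by simp only [hper, hgp t]]
      simp only [h.modChar_one_eq σ]
      refine (lintegral_mul_sub_mul_sq_le hf hhm hwm hs ws hwp hg).trans ?_
      calc _ ≤ 4 * ENNReal.ofReal (K * b ^ 3)
            + 2 * ENNReal.ofReal ((132 + 72 * K) * (b ^ 5 / a ^ 2)) := by gcongr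
        _ = ENNReal.ofReal (4 * (K * b ^ 3) + 2 * ((132 + 72 * K) * (b ^ 5 / a ^ 2))) := by
          rw [ENNReal.ofReal_add (by positivity) (by positivity),
            ENNReal.ofReal_mul (by norm_num : (0 : ℝ) ≤ 4),
            ENNReal.ofReal_mul (by norm_num : (0 : ℝ) ≤ 2)]
          norm_num
        _ ≤ ENNReal.ofReal (((264 + 148 * K) * m) ^ 2) := by
          apply ENNReal.ofReal_le_ofReal
          calc _ ≤ 4 * (K * m ^ 2) + 2 * ((132 + 72 * K) * m ^ 2) := by gcongr
            _ = (264 + 148 * K) * m ^ 2 := by ring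
            _ ≤ (264 + 148 * K) ^ 2 * m ^ 2 := by
              gcongr
              nlinarith
            _ = _ := by ring
        _ = _ := ENNReal.ofReal_pow (by positivity) 2

end CrossingTwins

/-- With `σ = 1` the planar variables are $(y_1, y_2)$ and `σ 0, σ 1, σ 2` are the indices 1, 2, 3;
the other permutations give the symmetric cases. -/
theorem theorem2 :
    -- Part (1)
    (∃ r : ℝ, 0 < r ∧ ∃ C : ℝ, 0 < C ∧
      ∀ (σ : Equiv.Perm (Fin 3)) (δ η : ℝ) (χ : Fin 4 → ℝ × ℝ → ℝ)
        (e : ℝ × ℝ → Matrix (Fin 3) (Fin 3) ℝ),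
        0 < δ → 0 < η → η ≤ 1 → IsPhase χ → IsPlanarStrain σ (Metric.ball 0 1) e →
        energy σ δ η e χ ≤ 1 →
        ∃ f : ℝ → ℝ, IsSign f ∧
          ((∫ y in Metric.ball (0 : E3) r, |modChar χ (σ 2) (planar σ y) - f (y (σ 0))|
              ≤ C * (energy σ δ η e χ).toReal ^ (1 / 2 : ℝ)) ∨
           (∫ y in Metric.ball (0 : E3) r, |modChar χ (σ 2) (planar σ y) - f (y (σ 1))|
              ≤ C * (energy σ δ η e χ).toReal ^ (1 / 2 : ℝ)))) ∧
    -- Parts (2) and (3), in the periodic setting, if the first case holds with constant `K`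
    (∀ K : ℝ, 0 < K → ∃ C : ℝ, 0 < C ∧
      ∀ (σ : Equiv.Perm (Fin 3)) (δ η : ℝ) (χ : Fin 4 → ℝ × ℝ → ℝ)
        (e : ℝ × ℝ → Matrix (Fin 3) (Fin 3) ℝ) (f : ℝ → ℝ),
        0 < δ → 0 < η → η ≤ 1 → IsPhase χ → (∀ i, Periodic2 (χ i)) →
        IsPlanarStrain σ univ e → Periodic2 e →
        torusEnergy δ η e χ ≤ 1 →
        IsSign f → Function.Periodic f 1 →
        (∫ p in square, |modChar χ (σ 2) p - f p.1|
          ≤ K * (torusEnergy δ η e χ).toReal ^ (1 / 2 : ℝ)) →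
        -- Part (2)
        (|volFrac χ 0 * (volFrac χ (partner (σ 1)) + volFrac χ (partner (σ 0)))
            - volFrac χ (partner (σ 0)) * (volFrac χ 0 + volFrac χ (partner (σ 2)))|
          ≤ C * (torusEnergy δ η e χ).toReal ^ (1 / 4 : ℝ)) ∧
        -- Part (3)
        ∃ g : ℝ → ℝ, Measurable g ∧
          eLpNorm (fun p : ℝ × ℝ => modChar χ (σ 0) (shear f p) - g p.2) 2
              (volume.restrict (shear f ⁻¹' square)) ^ 2
            ≤ ENNReal.ofReal
                (C * (η ^ (-2 / 9 : ℝ) * (torusEnergy δ η e χ).toReal ^ (5 / 6 : ℝ))) ∧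
          eLpNorm (fun p : ℝ × ℝ => modChar χ (σ 1) (shear f p) - f (shear f p).1 * g p.2) 2
              (volume.restrict (shear f ⁻¹' square))
            ≤ ENNReal.ofReal
                (C * max (η ^ (-1 / 9 : ℝ) * (torusEnergy δ η e χ).toReal ^ (5 / 12 : ℝ))
                  ((torusEnergy δ η e χ).toReal ^ (1 / 4 : ℝ)))) := by
  refine ⟨?_, fun K hK => ⟨264 + 148 * K, by positivity, ?_⟩⟩
  · obtain ⟨C, hC, h⟩ := exists_isSign_ball
    exact ⟨1 / 4, by norm_num, C, hC, fun σ δ η χ e _ hη hη1 hχ he hE =>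
      h σ δ η χ e hη hη1 hχ he hE⟩
  · intro σ δ η χ e f _ hη hη1 h hχ he hp hE hf _ hfw
    exact torus_estimates hK hη hη1 h hχ he hp hE hf hfw
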